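/- **Setting.** Let $d\in\{2,3\}$ and let $\Omega\subset\mathbb{R}^d$ be a bounded open set with a finite facet-to-facet partition $\mathfrak{T}_h$ into closed simplices, or into closed axis-parallel boxes: the interiors of the cells are pairwise disjoint and contained in $\Omega$, the cells cover $\Omega$, and each facet ($(d-1)$-dimensional face) of a cell is either contained in $\partial\Omega$ (boundary facet) or (interior facet, if not contained in $\partial\Omega$) also a facet of another cell. Let $k(x)$, $x \in\Omega$, be symmetric, measurable, with $k_{\min}|\zeta|^2\le\zeta^Tk(x)\zeta\le k_{\max}|\zeta|^2$ for all $x\in\Omega$, $\zeta\in\mathbb{R}^d$, where $0<k_{\min}\le k_{\max}$; let $f\in L^2(\Omega)$. $(\cdot,\cdot)_D$ is the $L^2(D)$ inner product and $(\cdot,\cdot)=(\cdot,\cdot)_\Omega$. $RT_0$ denotes the lowest-order Raviart–Thomas fields: $a+bx$ ($a\in\mathbb{R}^d$, $b\in\mathbb{R}$) on simplices, $(a_i+b_ix_i)_{i}$ ($a,b\in\mathbb{R}^d$) on boxes. Put $V_h=\{v\in H(\mathrm{div},\Omega): v|_K\in RT_0\ \forall K\}$, $Q_h=\{q\in L^2(\Omega):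 q|_K \text{ constant }\forall K\}$. For each cell $K$ let $S\supseteq K$ be a block of the same kind (simplex or box; $k$ is also given on $S$), let $(\chi_j^K)_j$ and $(\chi_l^S)_l$, indexed by the facets, be bases of $RT_0$, and let $c_{jl}$ be the constants with $\chi_j^K=\sum_lc_{jl}\chi_l^S|_K$. For $D=K$ or $D=S$ let $((\eta^D_{\chi},\psi^D_{\chi}),\phi^D_{\chi})\in ([L^2(D)]^d\times H(\mathrm{div},D))\times L^2(D)$ be a solution of $$\psi+k\eta=0,\quad \eta-\nabla\phi=0,\quad \mathrm{div}\,\psi=\mathrm{div}\,\chi\ \text{ in }D,\qquad \psi\cdot n=\chi\cdot n\ \text{ on }\partial D$$ with $\chi=\chi_j^K$, resp. $\chi=\chi_l^S$. On $K$ put $\bar\psi_{\chi_j}^K=\sum_lc_{jl}\psi_{\chi_l}^S$ and $\bar\eta_{\chi_j}^K=\sum_lc_{jl}\eta_{\chi_l}^S$. Assume that for each $K$ the functions $\bar\psi_{\chi_j}^K$ are linearly independent on $K$, so that $\mathcal{M}_h\big(\sum_ja_j\bar\psi_{\chi_j}^K\big)=\sum_ja_j\chi_j^K$ on $K$ is well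 defined. Put $$X_{1,h}^{os}=\{\theta\in[L^2(\Omega)]^d:\theta|_K\in\mathrm{span}_j\{\bar\eta_{\chi_j}^K\}\ \forall K\},\quad \tilde X_{2,h}^{os}=\{u\in[L^2(\Omega)]^d:u|_K\in\mathrm{span}_j\{\bar\psi_{\chi_j}^K\}\ \forall K\},$$ $$X_{2,h}^{os}=\{u\in\tilde X_{2,h}^{os}:\mathcal{M}_hu\in V_h\},\quad X_{2,h}^{l}=\{u\in H(\mathrm{div},\Omega):u|_K\in\mathrm{span}_j\{\psi_{\chi_j}^K\}\ \forall K\}.$$ Let $\Pi_h^l$ be the space of $L^2$ functions $\pi$ on the union of all facets such that $\pi|_e\in X_{2,h}^l\cdot n_e$ for each interior facet $e$ and $\pi|_e=0$ for each boundary facet $e$. Let $[C_h^{os}(\tau),\pi]=\sum_K(\mathcal{M}_h(\tau)\cdot n,\pi)_{\partial K}$, where $\mathcal{M}_h(\tau)$ is taken from inside $K$ and $n$ is the outward unit normal of $K$. *Nonconforming oversampling expanded mixed MsFEM:* find $(\theta,u,p)\in X_{1,h}^{os}\times X_{2,h}^{os}\times Q_h$ with $$(k\theta,\xi)+(u,\xi)=0\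 \ \forall\xi\in X_{1,h}^{os},\qquad (\theta,\tau)+\sum_K(p,\mathrm{div}\,\tau)_K=0\ \ \forall\tau\in X_{2,h}^{os},\qquad \sum_K(\mathrm{div}\,u,q)_K=(f,q)\ \ \forall q\in Q_h.$$ *Hybridized oversampling expanded mixed MsFEM:* find $(\bar\theta,\bar u,\bar p,\lambda)\in X_{1,h}^{os}\times\tilde X_{2,h}^{os}\times Q_h\times\Pi_h^l$ with $$(k\bar\theta,\xi)+(\bar u,\xi)=0\ \ \forall\xi\in X_{1,h}^{os},\qquad (\bar\theta,\tau)+\sum_K(\bar p,\mathrm{div}\,\tau)_K=[C_h^{os}(\tau),\lambda]\ \ \forall\tau\in\tilde X_{2,h}^{os},$$ $$\sum_K(\mathrm{div}\,\bar u,q)_K=(f,q)\ \ \forall q\in Q_h,\qquad [C_h^{os}(\bar u),\pi]=0\ \ \forall\pi\in\Pi_h^l.$$ **Theorem.** The hybridized problem has a unique solution $(\bar\theta,\bar u,\bar p,\lambda)$, the nonconforming problem has a unique solution $(\theta,u,p)$, and $\bar\theta=\theta$, $\bar u=u$, $\bar p=p$. -/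

import Mathlib

open MeasureTheory Set Filter
open scoped ContDiff Gradient

noncomputable section

namespace ExpMsFEM

/-- The Euclidean space `ℝ^d`. -/
abbrev E (d : ℕ) : Type := EuclideanSpace ℝ (Fin d)

/-! ### Cells, facets and the lowest-order Raviart-Thomas space -/

/-- The two kinds of meshes on which the classic lowest-order Raviart-Thomas space is defined:
simplices (triangles, tetrahedra), and axis-parallel boxes (rectangles, bricks). -/
inductive MeshShape : Type
  | simplicial
  | rectangular

/-- A cell: a nondegenerate `d`-simplex, or a nondegenerate box given by its two extreme corners. -/
def Cell (d : ℕ) : MeshShape → Type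
  | .simplicial => Affine.Simplex ℝ (E d) d
  | .rectangular => {p : E d × E d // ∀ i, p.1 i < p.2 i}

/-- Labels of the facets ((d-1)-dimensional faces) of a cell: for a simplex a facet is labelled by
the opposite vertex, for a box by a coordinate direction and the choice of lower / upper side. -/
def FacetIdx (d : ℕ) : MeshShape → Type
  | .simplicial => Fin (d + 1)
  | .rectangular => Fin d × Bool

instance FacetIdx.instFintype (d : ℕ) : (sh : MeshShape) → Fintype (FacetIdx d sh)
  | .simplicial => inferInstanceAs (Fintype (Fin (d + 1)))
  | .rectangular => inferInstanceAs (Fintype (Fin d × Bool))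

/-- The (closed) set of points of a cell. -/
def Cell.carrier {d : ℕ} : {sh : MeshShape} → Cell d sh → Set (E d)
  | .simplicial, s => convexHull ℝ (Set.range (Affine.Simplex.points s))
  | .rectangular, p => {x | ∀ i, p.1.1 i ≤ x i ∧ x i ≤ p.1.2 i}

/-- The (closed) facets of a cell. -/
def Cell.facet {d : ℕ} : {sh : MeshShape} → Cell d sh → FacetIdx d sh → Set (E d)
  | .simplicial, s, j => convexHull ℝ (Affine.Simplex.points s '' {i | i ≠ (j : Fin (d + 1))})
  | .rectangular, p, (i, false) => {x ∈ Cell.carrier (sh := .rectangular) p | x i = p.1.1 i}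
  | .rectangular, p, (i, true) => {x ∈ Cell.carrier (sh := .rectangular) p | x i = p.1.2 i}

/-- The open cell. Volume integrals over a cell are taken over its interior. -/
def Cell.int {d : ℕ} {sh : MeshShape} (K : Cell d sh) : Set (E d) := interior K.carrier

/-- `n` is the outward unit normal of `K` on its facet `F`. -/
def IsOutwardUnitNormal {d : ℕ} (K F : Set (E d)) (n : E d) : Prop :=
  ‖n‖ = 1 ∧ ∀ y ∈ F, ∀ x ∈ K, inner ℝ n (x - y) ≤ 0

/-- The outward unit normal of the cell `K` on its facet `j`. -/
def Cell.normal {d : ℕ} {sh : MeshShape} (K : Cell d sh) (j : FacetIdx d sh) : E d :=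
  Classical.epsilon (IsOutwardUnitNormal K.carrier (K.facet j))

/-- The local lowest-order Raviart-Thomas space, as a space of polynomial vector fields on `ℝ^d`:
`a + b x` with `a ∈ ℝ^d`, `b ∈ ℝ` on simplices; `(a_i + b_i x_i)_i` with `a, b ∈ ℝ^d` on boxes. -/
def RT0 (d : ℕ) : MeshShape → Set (E d → E d)
  | .simplicial => {v | ∃ (a : E d) (b : ℝ), ∀ x, v x = a + b • x}
  | .rectangular => {v | ∃ a b : E d, ∀ x i, v x i = a i + b i * x i}

/-- `χ` is a basis of the local space `RT0`, indexed by the facets of a cell. -/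
def IsRT0Basis {d : ℕ} {sh : MeshShape} (χ : FacetIdx d sh → E d → E d) : Prop :=
  LinearIndependent ℝ χ ∧ (Submodule.span ℝ (Set.range χ) : Set (E d → E d)) = RT0 d sh

/-! ### Weak derivatives and normal traces -/

/-- The classical divergence of a (smooth) vector field. -/
def divergence {d : ℕ} (v : E d → E d) (x : E d) : ℝ :=
  ∑ i, fderiv ℝ v x (EuclideanSpace.single i 1) i

/-- `g ∈ L²(D)` is the weak divergence of `v` in the open set `D`. -/
def HasWeakDiv {d : ℕ} (D : Set (E d)) (v : E d → E d) (g : E d → ℝ) : Prop :=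
  MemLp g 2 (volume.restrict D) ∧
  ∀ w : E d → ℝ, ContDiff ℝ ∞ w → HasCompactSupport w → tsupport w ⊆ D →
    ∫ x in D, inner ℝ (v x) (∇ w x) = - ∫ x in D, g x * w x

/-- `v ∈ H(div, D)`. -/
def MemHdiv {d : ℕ} (D : Set (E d)) (v : E d → E d) : Prop :=
  MemLp v 2 (volume.restrict D) ∧ ∃ g, HasWeakDiv D v g

/-- The weak divergence in `D` of a field in `H(div, D)` (unique up to null sets). -/
def weakDiv {d : ℕ} (D : Set (E d)) (v : E d → E d) : E d → ℝ :=
  Classical.epsilon (HasWeakDiv D v)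

/-- `η` is the weak gradient of `φ` in the open set `D`. -/
def HasWeakGrad {d : ℕ} (D : Set (E d)) (φ : E d → ℝ) (η : E d → E d) : Prop :=
  ∀ w : E d → ℝ, ContDiff ℝ ∞ w → HasCompactSupport w → tsupport w ⊆ D →
    ∫ x in D, φ x • ∇ w x = - ∫ x in D, w x • η x

/-- `v ∈ H⁰(div, D)`: `v ∈ H(div, D)` with `v · n = 0` on `∂D`, the normal trace being understood
through Green's formula. -/
def MemHdivZero {d : ℕ} (D : Set (E d)) (v : E d → E d) : Prop :=
  MemHdiv D v ∧
  ∀ w : E d → ℝ, ContDiff ℝ ∞ w → HasCompactSupport w →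
    (∫ x in D, inner ℝ (v x) (∇ w x)) + ∫ x in D, weakDiv D v x * w x = 0

/-- The product `k v` of a matrix-valued coefficient and a vector field. -/
def mulField {d : ℕ} (k : E d → Matrix (Fin d) (Fin d) ℝ) (v : E d → E d) (x : E d) : E d :=
  Matrix.toEuclideanLin (k x) (v x)

/-- `((η, ψ), φ)` solves the multiscale basis problem on `D` with data `χ`:
`ψ + k η = 0`, `η - ∇φ = 0`, `div ψ = div χ` in `D` and `ψ · n = χ · n` on `∂D`. -/
structure SolvesBasisProblem {d : ℕ} (k : E d → Matrix (Fin d) (Fin d) ℝ) (D : Set (E d))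
    (χ η ψ : E d → E d) (φ : E d → ℝ) : Prop where
  eta_mem : MemLp η 2 (volume.restrict D)
  phi_mem : MemLp φ 2 (volume.restrict D)
  psi_mem : MemHdiv D ψ
  flux : ∀ᵐ x ∂(volume.restrict D), ψ x + mulField k η x = 0
  grad : HasWeakGrad D φ η
  div_eq : HasWeakDiv D ψ (divergence χ)
  bdry : MemHdivZero D (fun x => ψ x - χ x)

/-! ### Meshes -/

/-- `T` is a finite facet-to-facet partition of `Ω` into cells. -/
structure IsMesh {d : ℕ} {sh : MeshShape} {ι : Type} (Ω : Set (E d)) (T : ι → Cell d sh) :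
    Prop where
  int_subset : ∀ K, (T K).int ⊆ Ω
  cover : Ω ⊆ ⋃ K, (T K).carrier
  disjoint : ∀ K K', K ≠ K' → Disjoint (T K).int (T K').int
  conform : ∀ K j, (T K).facet j ⊆ frontier Ω ∨
    ∃ K' j', K' ≠ K ∧ (T K').facet j' = (T K).facet j

/-- The union of all facets of the mesh. -/
def skeleton {d : ℕ} {sh : MeshShape} {ι : Type} (T : ι → Cell d sh) : Set (E d) :=
  ⋃ (K) (j), (T K).facet j

/-! ### The data of the method -/

/-- The objects from which the oversampling expanded mixed multiscale method is built. The laws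
that they have to satisfy are collected in `OSData.IsAdmissible`. -/
structure OSData (d : ℕ) (sh : MeshShape) (ι : Type) where
  /-- the domain -/
  Ω : Set (E d)
  /-- the coefficient -/
  k : E d → Matrix (Fin d) (Fin d) ℝ
  /-- the coarse cells -/
  T : ι → Cell d sh
  /-- the oversampling block `S ⊇ K` of each coarse cell `K` -/
  S : ι → Cell d sh
  /-- the velocity basis functions `χ_j^K` -/
  χ : ι → FacetIdx d sh → E d → E d
  /-- the velocity basis functions `χ_j^S` -/
  χS : ι → FacetIdx d sh → E d → E d
  /-- the constants `c_{jl}` -/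
  c : ι → FacetIdx d sh → FacetIdx d sh → ℝ
  /-- `η_{χ_j}^K`: local multiscale gradient basis, solved on `K` -/
  η : ι → FacetIdx d sh → E d → E d
  /-- `ψ_{χ_j}^K`: local multiscale velocity basis, solved on `K` -/
  ψ : ι → FacetIdx d sh → E d → E d
  /-- `φ_{χ_j}^K` -/
  φ : ι → FacetIdx d sh → E d → ℝ
  /-- `η_{χ_j}^S`: multiscale gradient functions solved on the larger block `S` -/
  ηS : ι → FacetIdx d sh → E d → E d
  /-- `ψ_{χ_j}^S`: multiscale velocity functions solved on the larger block `S` -/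
  ψS : ι → FacetIdx d sh → E d → E d
  /-- `φ_{χ_j}^S` -/
  φS : ι → FacetIdx d sh → E d → ℝ

namespace OSData

variable {d : ℕ} {sh : MeshShape} {ι : Type}

/-- The standing assumptions on the domain, the coefficient and the mesh, and the equations that
define the basis functions and the constants `c_{jl}`. -/
structure IsAdmissible (P : OSData d sh ι) : Prop where
  isOpen : IsOpen P.Ω
  mesh : IsMesh P.Ω P.T
  k_meas : ∀ i j, AEMeasurable (fun x => P.k x i j) (volume.restrict P.Ω)
  k_symm : ∀ x ∈ P.Ω, (P.k x).IsSymm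
  k_elliptic : ∃ kmin kmax : ℝ, 0 < kmin ∧ ∀ x ∈ P.Ω, ∀ ζ : E d,
    kmin * ‖ζ‖ ^ 2 ≤ inner ℝ ζ (Matrix.toEuclideanLin (P.k x) ζ) ∧
    inner ℝ ζ (Matrix.toEuclideanLin (P.k x) ζ) ≤ kmax * ‖ζ‖ ^ 2
  subset_block : ∀ K, (P.T K).carrier ⊆ (P.S K).carrier
  basis : ∀ K, IsRT0Basis (P.χ K)
  basisS : ∀ K, IsRT0Basis (P.χS K)
  coef : ∀ K j, ∀ x ∈ (P.T K).carrier, P.χ K j x = ∑ l, P.c K j l • P.χS K l x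
  solves : ∀ K j, SolvesBasisProblem P.k (P.T K).int (P.χ K j) (P.η K j) (P.ψ K j) (P.φ K j)
  solvesS : ∀ K j,
    SolvesBasisProblem P.k (P.S K).int (P.χS K j) (P.ηS K j) (P.ψS K j) (P.φS K j)

/-- The oversampling velocity functions `ψ̄_{χ_j}^K = ∑_l c_{jl} ψ_{χ_l}^S` (used on `K` only). -/
def psiBar (P : OSData d sh ι) (K : ι) (j : FacetIdx d sh) (x : E d) : E d :=
  ∑ l, P.c K j l • P.ψS K l x

/-- The oversampling gradient functions `η̄_{χ_j}^K = ∑_l c_{jl} η_{χ_l}^S` (used on `K` only). -/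
def etaBar (P : OSData d sh ι) (K : ι) (j : FacetIdx d sh) (x : E d) : E d :=
  ∑ l, P.c K j l • P.ηS K l x

/-- The functions `ψ̄_{χ_j}^K` are linearly independent on each cell `K`, i.e. they are basis
functions of their span, so that the operator `M_h`, which is given by its values on them, is
well defined. -/
def PsiBarIndependent (P : OSData d sh ι) : Prop :=
  ∀ K, ∀ a : FacetIdx d sh → ℝ,
    (∀ᵐ x ∂(volume.restrict (P.T K).int), ∑ j, a j • P.psiBar K j x = 0) → a = 0

/-- `L²(Ω)`. -/
abbrev L2 (P : OSData d sh ι) : Type := Lp ℝ 2 (volume.restrict P.Ω)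

/-- `[L²(Ω)]^d`. -/
abbrev L2Vec (P : OSData d sh ι) : Type := Lp (E d) 2 (volume.restrict P.Ω)

/-- `L²` of the union of the facets, with respect to surface measure. -/
abbrev L2Skeleton (P : OSData d sh ι) : Type :=
  Lp ℝ 2 ((Measure.euclideanHausdorffMeasure (d - 1)).restrict (skeleton P.T))

/-- `v|_K ∈ span {b_j}`. -/
def LocallyInSpan (P : OSData d sh ι) (K : ι) (b : FacetIdx d sh → E d → E d)
    (v : E d → E d) : Prop :=
  ∃ w ∈ Submodule.span ℝ (Set.range b), v =ᵐ[volume.restrict (P.T K).int] w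

/-- The gradient space `X_{1,h}^{os}`. -/
def X1 (P : OSData d sh ι) : Set P.L2Vec :=
  {θ | ∀ K, P.LocallyInSpan K (P.etaBar K) θ}

/-- The velocity space `X̃_{2,h}^{os}` of the hybrid formulation. -/
def X2Tilde (P : OSData d sh ι) : Set P.L2Vec :=
  {u | ∀ K, P.LocallyInSpan K (P.psiBar K) u}

/-- The pressure space `Q_h` that goes with `RT0`: piecewise constants. -/
def Q (P : OSData d sh ι) : Set P.L2 :=
  {q | ∀ K, ∃ a : ℝ, ∀ᵐ x ∂(volume.restrict (P.T K).int), q x = a}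

/-- The coefficients of `u|_K` with respect to the basis functions `ψ̄_{χ_j}^K`. -/
def coeff (P : OSData d sh ι) (K : ι) (u : E d → E d) : FacetIdx d sh → ℝ :=
  Classical.epsilon fun a : FacetIdx d sh → ℝ =>
    ∀ᵐ x ∂(volume.restrict (P.T K).int), u x = ∑ j, a j • P.psiBar K j x

/-- The local operator `M_h|_K`, `∑_j a_j ψ̄_{χ_j}^K ↦ ∑_j a_j χ_j^K`; its value is a polynomial
vector field, so that it can be evaluated on the facets of `K`. -/
def MhLocal (P : OSData d sh ι) (K : ι) (u : E d → E d) (x : E d) : E d :=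
  ∑ j, P.coeff K u j • P.χ K j x

/-- The operator `M_h`: on each open cell `K` it is given by `M_h|_K`. -/
def Mh [Fintype ι] (P : OSData d sh ι) (u : E d → E d) (x : E d) : E d :=
  ∑ K, (P.T K).int.indicator (P.MhLocal K u) x

/-- The Raviart-Thomas space `V_h ⊂ H(div, Ω)`. -/
def V (P : OSData d sh ι) : Set (E d → E d) :=
  {v | MemHdiv P.Ω v ∧ ∀ K, ∃ w ∈ RT0 d sh, v =ᵐ[volume.restrict (P.T K).int] w}

/-- The nonconforming velocity space `X_{2,h}^{os}`. -/
def X2 [Fintype ι] (P : OSData d sh ι) : Set P.L2Vec :=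
  {u | u ∈ P.X2Tilde ∧ P.Mh u ∈ P.V}

/-- The velocity space `X_{2,h}^l` of the local (not oversampled) method. -/
def X2Local (P : OSData d sh ι) : Set P.L2Vec :=
  {u | MemHdiv P.Ω u ∧ ∀ K, P.LocallyInSpan K (P.ψ K) u}

/-- The function `g` on the facet `j` of `K` is the normal trace `v · n` there: Green's formula
holds with all test functions that vanish on the other facets of `K`. -/
def IsNormalTrace (P : OSData d sh ι) (K : ι) (j : FacetIdx d sh) (v : E d → E d)
    (g : E d → ℝ) : Prop :=
  ∀ w : E d → ℝ, ContDiff ℝ ∞ w → HasCompactSupport w →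
    (∀ i, i ≠ j → ∀ x ∈ (P.T K).facet i, w x = 0) →
    (∫ x in (P.T K).int, inner ℝ (v x) (∇ w x)) +
        ∫ x in (P.T K).int, weakDiv (P.T K).int v x * w x =
      ∫ x in (P.T K).facet j, g x * w x ∂(Measure.euclideanHausdorffMeasure (d - 1))

/-- The Lagrange multiplier space `Π_h^l`: on an interior facet the multiplier is the normal
component of a function of `X_{2,h}^l`, on the boundary it vanishes. -/
def Multipliers (P : OSData d sh ι) : Set P.L2Skeleton :=
  {π | (∀ K j, ¬ (P.T K).facet j ⊆ frontier P.Ω →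
          ∃ v ∈ P.X2Local, P.IsNormalTrace K j v π) ∧
       (∀ K j, (P.T K).facet j ⊆ frontier P.Ω →
          ∀ᵐ x ∂((Measure.euclideanHausdorffMeasure (d - 1)).restrict ((P.T K).facet j)),
            π x = 0)}

/-- `[C_h^{os}(τ), π] = ∑_K (M_h(τ) · n, π)_{∂K}`. -/
def C [Fintype ι] (P : OSData d sh ι) (τ : E d → E d) (π : E d → ℝ) : ℝ :=
  ∑ K, ∑ j, ∫ x in (P.T K).facet j, inner ℝ (P.MhLocal K τ x) ((P.T K).normal j) * π x
    ∂(Measure.euclideanHausdorffMeasure (d - 1))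

/-- `(v, w)` in `[L²(Ω)]^d`. -/
def ip (P : OSData d sh ι) (v w : E d → E d) : ℝ := ∫ x in P.Ω, inner ℝ (v x) (w x)

/-- `∑_K (q, div v)_K`. -/
def brokenDiv [Fintype ι] (P : OSData d sh ι) (q : E d → ℝ) (v : E d → E d) : ℝ :=
  ∑ K, ∫ x in (P.T K).int, q x * weakDiv (P.T K).int v x

/-- `(θ, u, p)` solves the nonconforming oversampling expanded mixed problem. -/
structure SolvesNonconforming [Fintype ι] (P : OSData d sh ι) (f : P.L2)
    (s : P.L2Vec × P.L2Vec × P.L2) : Prop where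
  theta_mem : s.1 ∈ P.X1
  u_mem : s.2.1 ∈ P.X2
  p_mem : s.2.2 ∈ P.Q
  eq1 : ∀ ξ ∈ P.X1, P.ip (mulField P.k s.1) ξ + P.ip s.2.1 ξ = 0
  eq2 : ∀ τ ∈ P.X2, P.ip s.1 τ + P.brokenDiv s.2.2 τ = 0
  eq3 : ∀ q ∈ P.Q, P.brokenDiv q s.2.1 = ∫ x in P.Ω, f x * q x

/-- `(θ, u, p, lam)` solves the hybridized oversampling expanded mixed problem. -/
structure SolvesHybrid [Fintype ι] (P : OSData d sh ι) (f : P.L2)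
    (s : P.L2Vec × P.L2Vec × P.L2 × P.L2Skeleton) : Prop where
  theta_mem : s.1 ∈ P.X1
  u_mem : s.2.1 ∈ P.X2Tilde
  p_mem : s.2.2.1 ∈ P.Q
  lam_mem : s.2.2.2 ∈ P.Multipliers
  eq1 : ∀ ξ ∈ P.X1, P.ip (mulField P.k s.1) ξ + P.ip s.2.1 ξ = 0
  eq2 : ∀ τ ∈ P.X2Tilde, P.ip s.1 τ + P.brokenDiv s.2.2.1 τ = P.C τ s.2.2.2
  eq3 : ∀ q ∈ P.Q, P.brokenDiv q s.2.1 = ∫ x in P.Ω, f x * q x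
  eq4 : ∀ π ∈ P.Multipliers, P.C s.2.1 π = 0

end OSData

end ExpMsFEM

end

/-! All unknowns are described by coefficients on the cells. Since `ψ̄ = -k η̄` on each cell
(`psiBar_eq`), the first equation says that the velocity with coefficients `b - a` is orthogonal to
`X1`, where `a` belongs to `θ` and `b` to `u`. Testing with the gradient field of `b - a` and using
ellipticity gives `b = a` (`flux_equation_iff`). What remains is a saddle-point problem for one
coefficient vector and the pressure, plus the multiplier in the hybrid case.

Everything else depends on facet fluxes. A Raviart–Thomas field has a constant normal component on
each facet, and on a cell its coefficients correspond bijectively to its fluxes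
(`fluxMap_injective`, `fluxMap_surjective`). The functions `ψ̄_j` have the divergence of `χ_j`, so
the divergence form depends only on the fluxes of `M_h u`. The condition `M_h u ∈ V_h` means that
these fluxes are opposite on the two sides of every interior facet (`velocity_mem_X2_iff`). The
multipliers are exactly the functions that are constant on each facet and zero on boundary facets
(`mem_multipliers_iff`), so `C(u, ·) = 0` expresses the same matching condition (`balanced_iff`).
Hence every hybrid solution gives a nonconforming one: the fourth equation puts `u` in `X2`, and the
multiplier term drops out for test fields in `X2`.

Uniqueness for the nonconforming problem: with zero load, testing with the solution itself removes
the divergence term, and definiteness gives `a = 0`. A piecewise constant pressure orthogonal to all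
divergences of matching fluxes takes equal values on neighbouring cells, and testing with the
pressure times the position field then makes it vanish (`pressure_coeff_eq_zero`). For the hybrid
problem, a multiplier annihilated by all fluxes is zero (`multiplier_eq_zero`). Existence follows by
dimension: the hybrid problem is a square finite-dimensional linear system with trivial kernel.

The analytic input is Green's formula on polytopes (`IsPolytope.green`), proved with products of
smooth cut-offs. It identifies weak divergences and normal traces on cells, and relates membership
in `H(div)` to matching fluxes. -/

noncomputable section

namespace ExpMsFEM

/-! ### Hyperplanes: surface measure and slab coordinates -/

section Hyperplane

variable {m : ℕ}

/-- The parametrisation of the hyperplane through `z` with normal `n`. -/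
def hyperplaneMap (n z : E (m + 1)) (y : (Submodule.span ℝ {n})ᗮ) : E (m + 1) := z + y

theorem isometry_hyperplaneMap (n z : E (m + 1)) : Isometry (hyperplaneMap n z) := by
  intro x y
  simp only [hyperplaneMap, edist_add_left]
  rfl

theorem inner_normal_coe {n : E (m + 1)} (y : (Submodule.span ℝ {n})ᗮ) :
    inner ℝ n (y : E (m + 1)) = 0 :=
  Submodule.mem_orthogonal_singleton_iff_inner_right.1 y.2

theorem range_hyperplaneMap {n z : E (m + 1)} {b : ℝ} (hz : inner ℝ n z = b) :
    Set.range (hyperplaneMap n z) = {x | inner ℝ n x = b} := by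
  ext x
  constructor
  · rintro ⟨y, rfl⟩
    simp [hyperplaneMap, inner_add_right, hz, inner_normal_coe]
  · intro hx
    refine ⟨⟨x - z, ?_⟩, by simp [hyperplaneMap]⟩
    rw [Submodule.mem_orthogonal_singleton_iff_inner_right, inner_sub_right, hz]
    simpa [sub_eq_zero] using hx

theorem finrank_span_orthogonal {n : E (m + 1)} (hn : ‖n‖ = 1) :
    Module.finrank ℝ (Submodule.span ℝ {n})ᗮ = m := by
  have : Fact (Module.finrank ℝ (E (m + 1)) = m + 1) := ⟨by simp⟩
  exact Submodule.finrank_orthogonal_span_singleton (by rintro rfl; simp at hn)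

theorem measurableEmbedding_hyperplaneMap (n z : E (m + 1)) :
    MeasurableEmbedding (hyperplaneMap n z) :=
  (isometry_hyperplaneMap n z).isClosedEmbedding.measurableEmbedding

/-- An isometry carries Hausdorff measure to Hausdorff measure on its range, and on the
`m`-dimensional parameter space this measure is Lebesgue measure. All facet integrals are computed
through this transport. -/
theorem map_hyperplaneMap {n z : E (m + 1)} {b : ℝ} (hn : ‖n‖ = 1) (hz : inner ℝ n z = b) :
    Measure.map (hyperplaneMap n z) volume =
      (Measure.euclideanHausdorffMeasure m).restrict {x | inner ℝ n x = b} := by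
  rw [← InnerProductSpace.euclideanHausdorffMeasure_eq_volume, finrank_span_orthogonal hn,
    (isometry_hyperplaneMap n z).map_euclideanHausdorffMeasure, range_hyperplaneMap hz]

theorem restrict_hyperplane {n z : E (m + 1)} {b : ℝ} (hn : ‖n‖ = 1) (hz : inner ℝ n z = b)
    {F : Set (E (m + 1))} (hF : F ⊆ {x | inner ℝ n x = b}) (hFm : MeasurableSet F) :
    (Measure.euclideanHausdorffMeasure m).restrict F =
      Measure.map (hyperplaneMap n z) (volume.restrict (hyperplaneMap n z ⁻¹' F)) := by
  rw [← (measurableEmbedding_hyperplaneMap n z).restrict_map, map_hyperplaneMap hn hz,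
    Measure.restrict_restrict hFm, inter_eq_left.2 hF]

theorem measure_hyperplane {n z : E (m + 1)} {b : ℝ} (hn : ‖n‖ = 1) (hz : inner ℝ n z = b)
    {F : Set (E (m + 1))} (hF : F ⊆ {x | inner ℝ n x = b}) (hFm : MeasurableSet F) :
    Measure.euclideanHausdorffMeasure m F = volume (hyperplaneMap n z ⁻¹' F) := by
  have := congrArg (fun μ => μ univ) (restrict_hyperplane hn hz hF hFm)
  simpa [Measure.map_apply (measurableEmbedding_hyperplaneMap n z).measurable] using this

theorem setIntegral_hyperplane {n z : E (m + 1)} {b : ℝ} (hn : ‖n‖ = 1) (hz : inner ℝ n z = b)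
    {F : Set (E (m + 1))} (hF : F ⊆ {x | inner ℝ n x = b}) (hFm : MeasurableSet F)
    (g : E (m + 1) → ℝ) :
    ∫ x in F, g x ∂(Measure.euclideanHausdorffMeasure m) =
      ∫ y in hyperplaneMap n z ⁻¹' F, g (hyperplaneMap n z y) := by
  rw [restrict_hyperplane hn hz hF hFm, (measurableEmbedding_hyperplaneMap n z).integral_map]

/-- An affine condition that fails somewhere on the hyperplane holds only on a null set. -/
theorem volume_hyperplaneMap_preimage_eq {n z z' n' : E (m + 1)} {b : ℝ} (hz : inner ℝ n z = b)
    (hz' : inner ℝ n z' = b) {b' : ℝ} (h : inner ℝ n' z' ≠ b') :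
    volume {y | inner ℝ n' (hyperplaneMap n z y) = b'} = 0 := by
  let f : (Submodule.span ℝ {n})ᗮ →ₗ[ℝ] ℝ :=
    (innerₛₗ ℝ n') ∘ₗ (Submodule.span ℝ {n})ᗮ.subtype
  -- In parameter space the condition cuts out an affine subspace. The parameter of `z'` lies
  -- outside it, so it is proper and hence Lebesgue-null.
  let s : AffineSubspace ℝ (Submodule.span ℝ {n})ᗮ :=
    (AffineSubspace.mk' (b' - inner ℝ n' z) (⊥ : Submodule ℝ ℝ)).comap f.toAffineMap
  have hs : (s : Set _) = {y | inner ℝ n' (hyperplaneMap n z y) = b'} := by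
    ext y
    simp only [s, AffineSubspace.coe_comap, Set.mem_preimage, SetLike.mem_coe,
      AffineSubspace.mem_mk', vsub_eq_sub, Submodule.mem_bot, mem_ofPred_eq, hyperplaneMap,
      inner_add_right, LinearMap.coe_toAffineMap, f, LinearMap.comp_apply, innerₛₗ_apply_apply,
      Submodule.subtype_apply]
    constructor <;> intro h <;> linarith
  rw [← hs]
  apply Measure.addHaar_affineSubspace
  intro htop
  obtain ⟨y, rfl⟩ : z' ∈ Set.range (hyperplaneMap n z) := by
    rw [range_hyperplaneMap hz]; exact hz'
  have : y ∈ (s : Set _) := by rw [htop]; trivial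
  rw [hs] at this
  exact h this

/-- Change of variables to slab coordinates along a line `L` and its orthogonal complement. -/
theorem integral_eq_integral_slab_of_isometry {n : E (m + 1)} (z : E (m + 1))
    (L : Submodule ℝ (E (m + 1))) (e : ℝ ≃ₗᵢ[ℝ] L) (hen : ∀ s, (e s : E (m + 1)) = s • n) {ε : ℝ}
    (hε : 0 < ε) (g : E (m + 1) → ℝ) :
    ∫ x, g x = ε * ∫ p : ℝ × Lᗮ, g (z + p.2 - (ε * p.1) • n) := by
  have h1 := (L.measurePreserving_measurableEquivProd z).symm
  rw [InnerProductSpace.euclideanHausdorffMeasure_eq_volume] at h1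
  let T : ℝ × Lᗮ ≃ᵐ L × Lᗮ :=
    e.toHomeomorph.toMeasurableEquiv.prodCongr (MeasurableEquiv.refl _)
  have h2 : MeasurePreserving T volume volume :=
    e.measurePreserving.prod (MeasurePreserving.id volume)
  have h3 := h1.comp h2
  have h4 := h3.integral_comp ((L.measurableEquivProd z).symm.measurableEmbedding.comp
    T.measurableEmbedding) g
  rw [← h4]
  -- The factor `-ε` makes a positive first coordinate point against `n`, that is, into the
  -- half-space, and measures depth in units of `ε`.
  have h5 : MeasurableEmbedding (Prod.map (fun s : ℝ => -ε * s) (id : Lᗮ → Lᗮ)) :=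
    (measurableEmbedding_mulLeft₀ (by linarith [hε] : -ε ≠ 0)).prodMap MeasurableEmbedding.id
  have h6 : Measure.map (Prod.map (fun s : ℝ => -ε * s) (id : Lᗮ → Lᗮ))
      (volume.prod volume) = ENNReal.ofReal ε⁻¹ • (volume.prod volume) := by
    rw [← Measure.map_prod_map _ _ (by fun_prop) measurable_id,
      Real.map_volume_mul_left (by linarith [hε] : -ε ≠ 0), Measure.map_id, Measure.prod_smul_left,
      inv_neg, abs_neg, abs_of_pos (inv_pos.2 hε)]
  have h7 := h5.integral_map (μ := volume.prod volume)
    (fun p => g (((L.measurableEquivProd z).symm ∘ T) p))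
  rw [h6, integral_smul_measure, ENNReal.toReal_ofReal (inv_nonneg.2 hε.le)] at h7
  have h8 : ∀ p : ℝ × Lᗮ, ((L.measurableEquivProd z).symm ∘ T)
      (Prod.map (fun s : ℝ => -ε * s) id p) = z + p.2 - (ε * p.1) • n := by
    intro p
    have : T (Prod.map (fun s : ℝ => -ε * s) id p) = (e (-ε * p.1), p.2) := rfl
    rw [Function.comp_apply, this, Submodule.measurableEquivProd_symm_apply, hen, vadd_eq_add]
    rw [neg_mul, neg_smul]
    abel
  simp only [h8, smul_eq_mul] at h7
  rw [Measure.volume_eq_prod, ← mul_inv_cancel_left₀ hε.ne' (∫ a, _ ∂_), h7]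

/-- Change of variables to slab coordinates along the hyperplane through `z` with normal `n`. -/
theorem integral_eq_integral_slab {n : E (m + 1)} (z : E (m + 1)) (hn : ‖n‖ = 1) {ε : ℝ}
    (hε : 0 < ε) (g : E (m + 1) → ℝ) :
    ∫ x, g x = ε * ∫ p : ℝ × (Submodule.span ℝ {n})ᗮ,
      g (hyperplaneMap n z p.2 - (ε * p.1) • n) :=
  integral_eq_integral_slab_of_isometry z _ (LinearIsometryEquiv.toSpanUnitSingleton n hn)
    (fun _ => rfl) hε g

end Hyperplane

/-! ### Polytopes and Green's formula -/

/-- `K` is a full-dimensional polytope with facets `F j`, outward unit normals `n j`, and no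
redundant inequality. -/
structure IsPolytope {m : ℕ} {J : Type*} (K : Set (E (m + 1))) (F : J → Set (E (m + 1)))
    (n : J → E (m + 1)) (b : J → ℝ) : Prop where
  norm_normal : ∀ j, ‖n j‖ = 1
  mem_iff : ∀ x, x ∈ K ↔ ∀ j, inner ℝ (n j) x ≤ b j
  mem_facet_iff : ∀ j x, x ∈ F j ↔ x ∈ K ∧ inner ℝ (n j) x = b j
  exists_relint : ∀ j, ∃ z, inner ℝ (n j) z = b j ∧ ∀ i, i ≠ j → inner ℝ (n i) z < b i
  exists_interior : ∃ z, ∀ j, inner ℝ (n j) z < b j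
  bounded : Bornology.IsBounded K

/-- The smooth step function used for cut-offs is flat outside `[0, 1]`. -/
theorem deriv_smoothTransition_eq_zero {t : ℝ} (ht : t ∉ Icc (0 : ℝ) 1) :
    deriv Real.smoothTransition t = 0 := by
  rw [mem_Icc, not_and_or, not_le, not_le] at ht
  rcases ht with ht | ht
  · have : Real.smoothTransition =ᶠ[nhds t] fun _ => 0 := by
      filter_upwards [Iio_mem_nhds ht] with s hs
      exact Real.smoothTransition.zero_of_nonpos (le_of_lt hs)
    rw [this.deriv_eq]; simp
  · have : Real.smoothTransition =ᶠ[nhds t] fun _ => 1 := by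
      filter_upwards [Ioi_mem_nhds ht] with s hs
      exact Real.smoothTransition.one_of_one_le (le_of_lt hs)
    rw [this.deriv_eq]; simp

theorem contDiff_smoothTransition : ContDiff ℝ ∞ Real.smoothTransition :=
  Real.smoothTransition.contDiff (n := ⊤)

theorem continuous_deriv_smoothTransition : Continuous (deriv Real.smoothTransition) :=
  contDiff_smoothTransition.continuous_deriv (by simp)

theorem hasCompactSupport_deriv_smoothTransition :
    HasCompactSupport (deriv Real.smoothTransition) :=
  HasCompactSupport.intro isCompact_Icc fun _ => deriv_smoothTransition_eq_zero

/-- This normalisation gives a boundary layer of any width unit mass across its facet. -/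
theorem integral_deriv_smoothTransition : ∫ t, deriv Real.smoothTransition t = 1 := by
  rw [integral_of_hasDerivAt_of_tendsto (m := 0) (n := 1) (f := Real.smoothTransition)]
  · simp
  · exact fun x => (contDiff_smoothTransition.differentiable (by simp) x).hasDerivAt
  · exact continuous_deriv_smoothTransition.integrable_of_hasCompactSupport
      hasCompactSupport_deriv_smoothTransition
  · refine tendsto_const_nhds.congr' ?_
    filter_upwards [eventually_le_atBot 0] with t ht
    exact (Real.smoothTransition.zero_of_nonpos ht).symm
  · refine tendsto_const_nhds.congr' ?_
    filter_upwards [eventually_ge_atTop 1] with t ht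
    exact (Real.smoothTransition.one_of_one_le ht).symm

/-- A smooth step in the variable `t / ε` converges to the indicator function of `t > 0`. -/
theorem tendsto_smoothTransition_div_of_pos {a : ℕ → ℝ} {c : ℝ} (ha : Tendsto a atTop (nhds c))
    (hc : 0 < c) : ∀ᶠ k : ℕ in atTop, Real.smoothTransition (a k / (1 / ((k : ℝ) + 1))) = 1 := by
  have h1 : ∀ᶠ k in atTop, c / 2 < a k := ha.eventually (lt_mem_nhds (half_lt_self hc))
  -- Together with `a k > c / 2` this makes `a k * (k + 1)` at least `1`.
  have h2 : ∀ᶠ k : ℕ in atTop, 2 / c ≤ (k : ℝ) :=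
    tendsto_natCast_atTop_atTop.eventually_ge_atTop _
  filter_upwards [h1, h2] with k hk1 hk2
  apply Real.smoothTransition.one_of_one_le
  rw [div_div_eq_mul_div, div_one]
  rw [div_le_iff₀ hc] at hk2
  nlinarith [(Nat.cast_nonneg k : (0 : ℝ) ≤ k)]

theorem tendsto_smoothTransition_div_of_neg {a : ℕ → ℝ} {c : ℝ} (ha : Tendsto a atTop (nhds c))
    (hc : c < 0) : ∀ᶠ k : ℕ in atTop, Real.smoothTransition (a k / (1 / ((k : ℝ) + 1))) = 0 := by
  filter_upwards [ha.eventually (gt_mem_nhds hc)] with k hk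
  exact Real.smoothTransition.zero_of_nonpos (div_nonpos_of_nonpos_of_nonneg hk.le (by positivity))

/-! ### Elementary geometry and surface measure of polytopes. -/

namespace IsPolytope

variable {m : ℕ} {J : Type*} {K : Set (E (m + 1))} {F : J → Set (E (m + 1))}
  {n : J → E (m + 1)} {b : J → ℝ}

theorem facet_subset (hK : IsPolytope K F n b) (j : J) : F j ⊆ K :=
  fun x hx => ((hK.mem_facet_iff j x).1 hx).1

theorem facet_subset_hyperplane (hK : IsPolytope K F n b) (j : J) :
    F j ⊆ {x | inner ℝ (n j) x = b j} :=
  fun x hx => ((hK.mem_facet_iff j x).1 hx).2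

theorem isClosed (hK : IsPolytope K F n b) : IsClosed K := by
  have : K = ⋂ j, {x | inner ℝ (n j) x ≤ b j} := by
    ext x; simp [hK.mem_iff]
  rw [this]
  exact isClosed_iInter fun j => isClosed_le (by fun_prop) continuous_const

theorem isCompact (hK : IsPolytope K F n b) : IsCompact K :=
  Metric.isCompact_of_isClosed_isBounded hK.isClosed hK.bounded

theorem convex (hK : IsPolytope K F n b) : Convex ℝ K := by
  have : K = ⋂ j, {x | inner ℝ (n j) x ≤ b j} := by
    ext x; simp [hK.mem_iff]
  rw [this]
  exact convex_iInter fun j => convex_halfSpace_le (innerₛₗ ℝ (n j)).isLinear _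

theorem isClosed_facet (hK : IsPolytope K F n b) (j : J) : IsClosed (F j) := by
  have : F j = K ∩ {x | inner ℝ (n j) x = b j} := by
    ext x; simp [hK.mem_facet_iff]
  rw [this]
  exact hK.isClosed.inter (isClosed_eq (by fun_prop) continuous_const)

theorem measurableSet_facet (hK : IsPolytope K F n b) (j : J) : MeasurableSet (F j) :=
  (hK.isClosed_facet j).measurableSet

theorem isCompact_facet (hK : IsPolytope K F n b) (j : J) : IsCompact (F j) :=
  hK.isCompact.of_isClosed_subset (hK.isClosed_facet j) (hK.facet_subset j)

theorem isOpen_strict [Finite J] (n : J → E (m + 1)) (b : J → ℝ) (s : Set J) :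
    IsOpen {x | ∀ j ∈ s, inner ℝ (n j) x < b j} := by
  simp only [Set.ofPred_forall]
  refine isOpen_iInter_of_finite fun j => isOpen_iInter_of_finite fun _ =>
    isOpen_lt (by fun_prop) continuous_const

/-- At an interior point a short step along the unit normal stays in `K`, so no constraint is
active. Conversely, finitely many strict inequalities define an open subset of `K`. -/
theorem mem_interior_iff [Finite J] (hK : IsPolytope K F n b) (x : E (m + 1)) :
    x ∈ interior K ↔ ∀ j, inner ℝ (n j) x < b j := by
  constructor
  · intro hx j
    obtain ⟨r, hr, hball⟩ := Metric.isOpen_iff.1 isOpen_interior x hx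
    have hmem : x + (r / 2) • n j ∈ K := by
      apply interior_subset; apply hball
      simp [norm_smul, hK.norm_normal, abs_of_pos hr, hr]
    have := (hK.mem_iff _).1 hmem j
    rw [inner_add_right, inner_smul_right, real_inner_self_eq_norm_sq, hK.norm_normal] at this
    linarith
  · intro hx
    refine mem_interior.2 ⟨{x | ∀ j ∈ (univ : Set J), inner ℝ (n j) x < b j}, ?_,
      isOpen_strict n b univ, fun j _ => hx j⟩
    exact fun y hy => (hK.mem_iff y).2 fun j => (hy j trivial).le

theorem nonempty_interior [Finite J] (hK : IsPolytope K F n b) : (interior K).Nonempty :=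
  hK.exists_interior.imp fun z hz => (hK.mem_interior_iff z).2 hz

theorem subset_closure_interior [Finite J] (hK : IsPolytope K F n b) :
    K ⊆ closure (interior K) := by
  rw [hK.convex.closure_interior_eq_closure_of_nonempty_interior hK.nonempty_interior]
  exact subset_closure

theorem volume_frontier (hK : IsPolytope K F n b) : volume (frontier K) = 0 :=
  hK.convex.addHaar_frontier volume

/-- Almost every point of a facet lies strictly inside all the other constraints. -/
theorem measure_facet_inter (hK : IsPolytope K F n b) {i j : J} (hij : i ≠ j) :
    Measure.euclideanHausdorffMeasure m (F j ∩ {x | inner ℝ (n i) x = b i}) = 0 := by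
  obtain ⟨z, hz, hz'⟩ := hK.exists_relint j
  rw [measure_hyperplane (hK.norm_normal j) hz (inter_subset_left.trans
    (hK.facet_subset_hyperplane j)) ((hK.measurableSet_facet j).inter
      (isClosed_eq (by fun_prop) continuous_const).measurableSet)]
  exact measure_mono_null (fun y hy => hy.2)
    (volume_hyperplaneMap_preimage_eq hz hz (hz' i hij).ne)

theorem ae_facet_strict [Finite J] (hK : IsPolytope K F n b) (j : J) :
    ∀ᵐ x ∂((Measure.euclideanHausdorffMeasure m).restrict (F j)),
      x ∈ F j ∧ ∀ i, i ≠ j → inner ℝ (n i) x < b i := by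
  have h1 : ∀ i, i ≠ j → ∀ᵐ x ∂((Measure.euclideanHausdorffMeasure m).restrict (F j)),
      inner ℝ (n i) x ≠ b i := by
    intro i hi
    rw [ae_iff, Measure.restrict_apply' (hK.measurableSet_facet j)]
    convert hK.measure_facet_inter hi using 2
    ext x; simp [and_comm]
  have h2 : ∀ᵐ x ∂((Measure.euclideanHausdorffMeasure m).restrict (F j)),
      ∀ i, i ≠ j → inner ℝ (n i) x ≠ b i :=
    ae_all_iff.2 fun i => by
      by_cases hi : i = j
      · simp [hi]
      · filter_upwards [h1 i hi] with x hx _ using hx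
  filter_upwards [h2, ae_restrict_mem (hK.measurableSet_facet j)] with x hx hxF
  exact ⟨hxF, fun i hi => lt_of_le_of_ne ((hK.mem_iff x).1 (hK.facet_subset j hxF) i) (hx i hi)⟩

theorem measure_facet_lt_top (hK : IsPolytope K F n b) (j : J) :
    Measure.euclideanHausdorffMeasure m (F j) < ⊤ := by
  obtain ⟨z, hz, -⟩ := hK.exists_relint j
  rw [measure_hyperplane (hK.norm_normal j) hz (hK.facet_subset_hyperplane j)
    (hK.measurableSet_facet j)]
  exact ((isometry_hyperplaneMap _ _).isClosedEmbedding.isCompact_preimage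
    (hK.isCompact_facet j)).measure_lt_top

/-- Near a relatively interior point the facet coincides with its hyperplane, so the intersection
contains a nonempty relatively open piece. This makes the facet integral of a bump function
positive. -/
theorem measure_facet_inter_pos [Finite J] (hK : IsPolytope K F n b) {j : J} {x : E (m + 1)}
    (hx : inner ℝ (n j) x = b j) (hx' : ∀ i, i ≠ j → inner ℝ (n i) x < b i) {U : Set (E (m + 1))}
    (hU : IsOpen U) (hxU : x ∈ U) : 0 < Measure.euclideanHausdorffMeasure m (F j ∩ U) := by
  rw [measure_hyperplane (hK.norm_normal j) hx (inter_subset_left.trans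
    (hK.facet_subset_hyperplane j)) ((hK.measurableSet_facet j).inter hU.measurableSet)]
  have hcont : Continuous (hyperplaneMap (n j) x) := (isometry_hyperplaneMap _ _).continuous
  have hV : IsOpen (hyperplaneMap (n j) x ⁻¹' ({y | ∀ i ∈ {i | i ≠ j}, inner ℝ (n i) y < b i} ∩ U)) :=
    ((isOpen_strict n b {i | i ≠ j}).inter hU).preimage hcont
  refine (hV.measure_pos volume ⟨0, ?_⟩).trans_le (measure_mono ?_)
  · refine ⟨?_, ?_⟩
    · intro i hi; simpa [hyperplaneMap] using hx' i hi
    · simpa [hyperplaneMap] using hxU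
  · rintro y ⟨hy1, hy2⟩
    have hyj : inner ℝ (n j) (hyperplaneMap (n j) x y) = b j := by
      have : hyperplaneMap (n j) x y ∈ Set.range (hyperplaneMap (n j) x) := ⟨y, rfl⟩
      rwa [range_hyperplaneMap hx] at this
    refine ⟨(hK.mem_facet_iff _ _).2 ⟨(hK.mem_iff _).2 fun i => ?_, hyj⟩, hy2⟩
    by_cases hi : i = j
    · subst hi; exact hyj.le
    · exact (hy1 i hi).le

theorem measure_facet_pos [Finite J] (hK : IsPolytope K F n b) (j : J) :
    0 < Measure.euclideanHausdorffMeasure m (F j) := by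
  obtain ⟨z, hz, hz'⟩ := hK.exists_relint j
  simpa using hK.measure_facet_inter_pos hz hz' isOpen_univ (mem_univ _)

end IsPolytope

/-! ### Boundary layers, Gauss' theorem and Green's formula. -/

namespace IsPolytope

variable {m : ℕ} {J : Type*} [Fintype J] {K : Set (E (m + 1))} {F : J → Set (E (m + 1))}
  {n : J → E (m + 1)} {b : J → ℝ}

theorem integrableOn_facet (hK : IsPolytope K F n b) (j : J) {h : E (m + 1) → ℝ}
    (hc : Continuous h) : IntegrableOn h (F j) (Measure.euclideanHausdorffMeasure m) := by
  obtain ⟨C, hC⟩ := (hK.isCompact_facet j).exists_bound_of_continuousOn hc.continuousOn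
  refine Measure.integrableOn_of_bounded (M := C) (hK.measure_facet_lt_top j).ne
    hc.aestronglyMeasurable ?_
  filter_upwards [ae_restrict_mem (hK.measurableSet_facet j)] with x hx using hC x hx

open Classical in
/-- The boundary layers at the facet `j` concentrate on that facet. -/
theorem tendsto_integral_layer (hK : IsPolytope K F n b) (j : J) {h : E (m + 1) → ℝ}
    (hc : Continuous h) (hs : HasCompactSupport h) :
    Tendsto (fun k : ℕ => ∫ x, (1 / (1 / ((k : ℝ) + 1))) *
      (deriv Real.smoothTransition ((b j - inner ℝ (n j) x) / (1 / ((k : ℝ) + 1))) *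
      (∏ i ∈ Finset.univ.erase j,
        Real.smoothTransition ((b i - inner ℝ (n i) x) / (1 / ((k : ℝ) + 1)))) * h x)) atTop
      (nhds (∫ x in F j, h x ∂(Measure.euclideanHausdorffMeasure m))) := by
  obtain ⟨z, hz, hz'⟩ := hK.exists_relint j
  have hn := hK.norm_normal j
  rw [setIntegral_hyperplane hn hz (hK.facet_subset_hyperplane j) (hK.measurableSet_facet j)]
  let N := (Submodule.span ℝ {n j})ᗮ
  -- In these coordinates `p.1` is the slack of constraint `j` divided by the layer width, so the
  -- derivative of the step no longer depends on `k`.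
  let Ψ : ℕ → ℝ × N → E (m + 1) := fun k p =>
    hyperplaneMap (n j) z p.2 - ((1 / ((k : ℝ) + 1)) * p.1) • n j
  have hmapc : Continuous (hyperplaneMap (n j) z) := (isometry_hyperplaneMap _ _).continuous
  have hΨ : ∀ k, Continuous (Ψ k) := fun k => by fun_prop
  have hj : ∀ k p, (b j - inner ℝ (n j) (Ψ k p)) / (1 / ((k : ℝ) + 1)) = p.1 := by
    intro k p
    have hk : (0 : ℝ) < (k : ℝ) + 1 := by positivity
    simp only [Ψ, hyperplaneMap, inner_sub_right, inner_add_right, inner_normal_coe, hz,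
      inner_smul_right, real_inner_self_eq_norm_sq, hn]
    field_simp
    ring
  let G : ℕ → ℝ × N → ℝ := fun k p => deriv Real.smoothTransition p.1 *
    (∏ i ∈ Finset.univ.erase j,
      Real.smoothTransition ((b i - inner ℝ (n i) (Ψ k p)) / (1 / ((k : ℝ) + 1)))) * h (Ψ k p)
  have hint : ∀ k : ℕ, ∫ x, (1 / (1 / ((k : ℝ) + 1))) *
      (deriv Real.smoothTransition ((b j - inner ℝ (n j) x) / (1 / ((k : ℝ) + 1))) *
      (∏ i ∈ Finset.univ.erase j,
        Real.smoothTransition ((b i - inner ℝ (n i) x) / (1 / ((k : ℝ) + 1)))) * h x) =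
      ∫ p, G k p := by
    intro k
    have hk : (0 : ℝ) < 1 / ((k : ℝ) + 1) := by positivity
    rw [integral_eq_integral_slab z hn hk, integral_const_mul, ← mul_assoc,
      mul_one_div_cancel hk.ne', one_mul]
    refine integral_congr_ae (Eventually.of_forall fun p => ?_)
    have := hj k p
    simp only [Ψ] at this
    simp only [G, Ψ, this]
  simp only [hint]
  have hlim : ∫ y in hyperplaneMap (n j) z ⁻¹' F j, h (hyperplaneMap (n j) z y) =
      ∫ p : ℝ × N, deriv Real.smoothTransition p.1 *
        (hyperplaneMap (n j) z ⁻¹' F j).indicator (fun y => h (hyperplaneMap (n j) z y)) p.2 := by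
    rw [Measure.volume_eq_prod, integral_prod_mul, integral_deriv_smoothTransition, one_mul,
      integral_indicator ((hK.measurableSet_facet j).preimage hmapc.measurable)]
  rw [hlim]
  obtain ⟨C, hC⟩ := hc.bounded_above_of_compact_support hs
  obtain ⟨M, hM⟩ := continuous_deriv_smoothTransition.bounded_above_of_compact_support
    hasCompactSupport_deriv_smoothTransition
  obtain ⟨R, hR⟩ := hs.isCompact.isBounded.exists_norm_le
  have hC0 : 0 ≤ C := (norm_nonneg _).trans (hC 0)
  have hM0 : 0 ≤ M := (norm_nonneg _).trans (hM 0)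
  -- The step derivative confines `p.1` to `[0, 1]`. The support of `h` lies in the ball of radius
  -- `R`, and the shift by `z` and a layer depth of at most `1` give the radius for `p.2`.
  refine tendsto_integral_of_dominated_convergence
    ((Icc (0 : ℝ) 1 ×ˢ Metric.closedBall (0 : N) (R + ‖z‖ + 1)).indicator fun _ => M * C) ?_ ?_ ?_ ?_
  · intro k
    refine Continuous.aestronglyMeasurable ?_
    simp only [G]
    refine ((continuous_deriv_smoothTransition.comp continuous_fst).mul
      (continuous_finsetProd _ fun i _ => ?_)).mul (hc.comp (hΨ k))
    exact Real.smoothTransition.continuous.comp (by fun_prop)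
  · rw [integrable_indicator_iff (measurableSet_Icc.prod measurableSet_closedBall)]
    refine integrableOn_const ?_ enorm_ne_top
    rw [Measure.volume_eq_prod, Measure.prod_prod]
    exact ENNReal.mul_ne_top (by simp) measure_closedBall_lt_top.ne
  · intro k
    refine Eventually.of_forall fun p => ?_
    by_cases hp : p ∈ Icc (0 : ℝ) 1 ×ˢ Metric.closedBall (0 : N) (R + ‖z‖ + 1)
    · rw [indicator_of_mem hp]
      simp only [G, norm_mul]
      refine mul_le_mul ?_ (hC _) (norm_nonneg _) hM0
      rw [← mul_one M]
      refine mul_le_mul (hM _) ?_ (norm_nonneg _) hM0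
      rw [norm_prod]
      refine Finset.prod_le_one (fun _ _ => norm_nonneg _) fun i _ => ?_
      rw [Real.norm_of_nonneg (Real.smoothTransition.nonneg _)]
      exact Real.smoothTransition.le_one _
    · rw [indicator_of_notMem hp]
      by_cases h1 : p.1 ∈ Icc (0 : ℝ) 1
      · have h2 : h (Ψ k p) = 0 := by
          by_contra hne
          refine hp ⟨h1, ?_⟩
          have h3 := hR _ (subset_tsupport _ hne)
          have h4 : (p.2 : E (m + 1)) = Ψ k p - z + ((1 / ((k : ℝ) + 1)) * p.1) • n j := by
            simp only [Ψ, hyperplaneMap]; abel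
          have h5 : ‖((1 / ((k : ℝ) + 1)) * p.1) • n j‖ ≤ 1 := by
            rw [norm_smul, hn, mul_one, Real.norm_of_nonneg (mul_nonneg (by positivity) h1.1)]
            refine mul_le_one₀ ?_ h1.1 h1.2
            rw [div_le_one (by positivity)]
            linarith [(Nat.cast_nonneg k : (0 : ℝ) ≤ k)]
          rw [mem_closedBall_zero_iff]
          change ‖(p.2 : E (m + 1))‖ ≤ _
          rw [h4]
          exact (norm_add_le _ _).trans (add_le_add ((norm_sub_le _ _).trans
            (add_le_add h3 le_rfl)) h5)
        simp [G, h2]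
      · simp [G, deriv_smoothTransition_eq_zero h1]
  -- For almost every foot point no other constraint is active, so each remaining cut-off is
  -- eventually constant, equal to `1` or `0`.
  · have hae : ∀ᵐ p : ℝ × N, ∀ i, i ≠ j → inner ℝ (n i) (hyperplaneMap (n j) z p.2) ≠ b i := by
      refine (Measure.quasiMeasurePreserving_snd (μ := (volume : Measure ℝ))
        (ν := (volume : Measure N))).ae (p := fun y => ∀ i, i ≠ j →
          inner ℝ (n i) (hyperplaneMap (n j) z y) ≠ b i) ?_
      refine ae_all_iff.2 fun i => ?_
      by_cases hi : i = j
      · simp [hi]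
      · have := volume_hyperplaneMap_preimage_eq (z := z) hz hz (hz' i hi).ne
        filter_upwards [compl_mem_ae_iff.2 this] with y hy _ using hy
    filter_upwards [hae] with p hp
    have hΨlim : Tendsto (fun k => Ψ k p) atTop (nhds (hyperplaneMap (n j) z p.2)) := by
      have h1 : Tendsto (fun k : ℕ => ((1 / ((k : ℝ) + 1)) * p.1) • n j) atTop
          (nhds (((0 : ℝ) * p.1) • n j)) :=
        (tendsto_one_div_add_atTop_nhds_zero_nat.mul_const _).smul_const _
      simpa [Ψ] using (tendsto_const_nhds (x := hyperplaneMap (n j) z p.2)).sub h1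
    have hilim : ∀ i, Tendsto (fun k => b i - inner ℝ (n i) (Ψ k p)) atTop
        (nhds (b i - inner ℝ (n i) (hyperplaneMap (n j) z p.2))) := fun i =>
      tendsto_const_nhds.sub (tendsto_const_nhds.inner hΨlim)
    have hyj : inner ℝ (n j) (hyperplaneMap (n j) z p.2) = b j := by
      have : hyperplaneMap (n j) z p.2 ∈ Set.range (hyperplaneMap (n j) z) := ⟨p.2, rfl⟩
      rwa [range_hyperplaneMap hz] at this
    by_cases hpF : p.2 ∈ hyperplaneMap (n j) z ⁻¹' F j
    · rw [indicator_of_mem hpF]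
      have h1 : ∀ᶠ k : ℕ in atTop, ∀ i ∈ Finset.univ.erase j,
          Real.smoothTransition ((b i - inner ℝ (n i) (Ψ k p)) / (1 / ((k : ℝ) + 1))) = 1 := by
        refine (Filter.eventually_all_finset _).2 fun i hi => ?_
        refine tendsto_smoothTransition_div_of_pos (hilim i) (sub_pos.2 ?_)
        exact lt_of_le_of_ne ((hK.mem_iff _).1 (hK.facet_subset j hpF) i)
          (hp i (Finset.ne_of_mem_erase hi))
      have h2 : Tendsto (fun k => deriv Real.smoothTransition p.1 * h (Ψ k p)) atTop
          (nhds (deriv Real.smoothTransition p.1 * h (hyperplaneMap (n j) z p.2))) :=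
        tendsto_const_nhds.mul ((hc.tendsto _).comp hΨlim)
      refine h2.congr' ?_
      filter_upwards [h1] with k hk
      simp only [G]
      rw [Finset.prod_eq_one hk, mul_one]
    · rw [indicator_of_notMem hpF, mul_zero]
      obtain ⟨i, hi, hlt⟩ : ∃ i, i ≠ j ∧ b i - inner ℝ (n i) (hyperplaneMap (n j) z p.2) < 0 := by
        by_contra hcon
        push Not at hcon
        refine hpF ((hK.mem_facet_iff _ _).2 ⟨(hK.mem_iff _).2 fun i => ?_, hyj⟩)
        by_cases hi : i = j
        · subst hi; exact hyj.le
        · linarith [hcon i hi]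
      refine tendsto_const_nhds.congr' ?_
      filter_upwards [tendsto_smoothTransition_div_of_neg (hilim i) hlt] with k hk
      simp only [G]
      rw [Finset.prod_eq_zero (Finset.mem_erase.2 ⟨hi, Finset.mem_univ i⟩) hk]
      simp

open Classical in
/-- Gauss' theorem on a polytope, for the derivative of a scalar function in a direction `e`. -/
theorem integral_fderiv (hK : IsPolytope K F n b) {h : E (m + 1) → ℝ} (hc : ContDiff ℝ 1 h)
    (hs : HasCompactSupport h) (e : E (m + 1)) :
    ∫ x in interior K, fderiv ℝ h x e =
      ∑ j, inner ℝ (n j) e * ∫ x in F j, h x ∂(Measure.euclideanHausdorffMeasure m) := by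
  have hdc : Continuous fun x => fderiv ℝ h x e :=
    (hc.continuous_fderiv (by simp)).clm_apply continuous_const
  have hds : HasCompactSupport fun x => fderiv ℝ h x e :=
    (hs.fderiv (𝕜 := ℝ)).comp_left (g := fun L : E (m + 1) →L[ℝ] ℝ => L e) (by simp)
  -- A smooth step in the slack of constraint `i`, of width `1 / (k + 1)`. The product over `i`
  -- vanishes outside the interior of `K` and tends pointwise to its indicator.
  let c : ℕ → J → E (m + 1) → ℝ := fun k i x =>
    Real.smoothTransition ((b i - inner ℝ (n i) x) / (1 / ((k : ℝ) + 1)))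
  have hcc : ∀ k i, Continuous (c k i) := fun k i =>
    Real.smoothTransition.continuous.comp (by fun_prop)
  have hcd : ∀ k i x, HasFDerivAt (c k i)
      ((deriv Real.smoothTransition ((b i - inner ℝ (n i) x) / (1 / ((k : ℝ) + 1))) *
        -(1 / (1 / ((k : ℝ) + 1)))) • (innerSL ℝ (n i))) x := by
    intro k i x
    have h1 : HasFDerivAt (fun x => (b i - inner ℝ (n i) x) / (1 / ((k : ℝ) + 1)))
        (-(1 / (1 / ((k : ℝ) + 1))) • (innerSL ℝ (n i))) x := by
      have h2 := (((innerSL ℝ (n i)).hasFDerivAt (x := x)).const_sub (b i)).mul_const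
        (1 / (1 / ((k : ℝ) + 1)))
      refine (h2.congr_fderiv ?_).congr_of_eventuallyEq (Eventually.of_forall fun y => ?_)
      · rw [smul_neg, neg_smul]
      · exact div_eq_mul_one_div _ _
    have h3 := (contDiff_smoothTransition.differentiable (by simp)
      ((b i - inner ℝ (n i) x) / (1 / ((k : ℝ) + 1)))).hasDerivAt.comp_hasFDerivAt x h1
    exact h3.congr_fderiv (smul_smul _ _ _)
  have hgd : ∀ k x, HasFDerivAt (fun x => ∏ i, c k i x) (∑ j, (∏ i ∈ Finset.univ.erase j, c k i x) •
      ((deriv Real.smoothTransition ((b j - inner ℝ (n j) x) / (1 / ((k : ℝ) + 1))) *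
        -(1 / (1 / ((k : ℝ) + 1)))) • (innerSL ℝ (n j)))) x := fun k x =>
    HasFDerivAt.finsetProd fun i _ => hcd k i x
  have hgf : ∀ k x, fderiv ℝ (fun x => ∏ i, c k i x) x e = -∑ j, inner ℝ (n j) e *
      ((1 / (1 / ((k : ℝ) + 1))) *
      (deriv Real.smoothTransition ((b j - inner ℝ (n j) x) / (1 / ((k : ℝ) + 1))) *
      (∏ i ∈ Finset.univ.erase j, c k i x))) := by
    intro k x
    rw [(hgd k x).fderiv, _root_.sum_apply, ← Finset.sum_neg_distrib]
    refine Finset.sum_congr rfl fun j _ => ?_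
    simp only [_root_.smul_apply, innerSL_apply_apply, smul_eq_mul]
    ring
  have hlc : ∀ (k : ℕ) j, Continuous fun x => (1 / (1 / ((k : ℝ) + 1))) *
      (deriv Real.smoothTransition ((b j - inner ℝ (n j) x) / (1 / ((k : ℝ) + 1))) *
      (∏ i ∈ Finset.univ.erase j, c k i x)) := fun k j =>
    continuous_const.mul ((continuous_deriv_smoothTransition.comp (by fun_prop)).mul
      (continuous_finsetProd _ fun i _ => hcc k i))
  have hgfc : ∀ k, Continuous fun x => fderiv ℝ (fun x => ∏ i, c k i x) x e := by
    intro k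
    simp only [hgf]
    exact (continuous_finsetSum _ fun j _ => continuous_const.mul (hlc k j)).neg
  have hgc : ∀ k, Continuous fun x => ∏ i, c k i x := fun k =>
    continuous_finsetProd _ fun i _ => hcc k i
  -- Integration by parts on the whole space moves the derivative onto the cut-offs; the product
  -- rule then yields one boundary layer per facet.
  have hparts : ∀ k : ℕ, ∫ x, (∏ i, c k i x) * fderiv ℝ h x e =
      ∑ j, inner ℝ (n j) e * ∫ x, (1 / (1 / ((k : ℝ) + 1))) *
      (deriv Real.smoothTransition ((b j - inner ℝ (n j) x) / (1 / ((k : ℝ) + 1))) *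
      (∏ i ∈ Finset.univ.erase j, c k i x) * h x) := by
    intro k
    rw [integral_mul_fderiv_eq_neg_fderiv_mul_of_integrable
      (((hgfc k).mul hc.continuous).integrable_of_hasCompactSupport (hs.mul_left))
      (((hgc k).mul hdc).integrable_of_hasCompactSupport (hds.mul_left))
      (((hgc k).mul hc.continuous).integrable_of_hasCompactSupport (hs.mul_left))
      (fun x _ => (hgd k x).differentiableAt) (fun x _ => hc.differentiable (by simp) x),
      ← integral_neg]
    simp only [← integral_const_mul]
    rw [← integral_finsetSum]
    · refine integral_congr_ae (Eventually.of_forall fun x => ?_)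
      simp only [hgf, neg_mul, neg_neg, Finset.sum_mul]
      exact Finset.sum_congr rfl fun j _ => by ring
    · intro j _
      refine Integrable.const_mul ?_ _
      refine (((hlc k j).mul hc.continuous).integrable_of_hasCompactSupport
        (hs.mul_left)).congr (Eventually.of_forall fun x => ?_)
      simp only [Pi.mul_apply]
      ring
  have hlim1 : Tendsto (fun k : ℕ => ∫ x, (∏ i, c k i x) * fderiv ℝ h x e) atTop
      (nhds (∑ j, inner ℝ (n j) e * ∫ x in F j, h x ∂(Measure.euclideanHausdorffMeasure m))) := by
    simp only [hparts]
    exact tendsto_finsetSum _ fun j _ => (hK.tendsto_integral_layer j hc.continuous hs).const_mul _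
  -- The same sequence has two descriptions of its limit: facet integrals by the boundary layers,
  -- and the interior integral by dominated convergence.
  refine tendsto_nhds_unique ?_ hlim1
  rw [← integral_indicator isOpen_interior.measurableSet]
  refine tendsto_integral_of_dominated_convergence (fun x => ‖fderiv ℝ h x e‖) ?_ ?_ ?_ ?_
  · exact fun k => ((hgc k).mul hdc).aestronglyMeasurable
  · exact (hdc.integrable_of_hasCompactSupport hds).norm
  · refine fun k => Eventually.of_forall fun x => ?_
    rw [norm_mul]
    refine mul_le_of_le_one_left (norm_nonneg _) ?_
    rw [norm_prod]
    refine Finset.prod_le_one (fun _ _ => norm_nonneg _) fun i _ => ?_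
    rw [Real.norm_of_nonneg (Real.smoothTransition.nonneg _)]
    exact Real.smoothTransition.le_one _
  · refine Eventually.of_forall fun x => ?_
    by_cases hx : x ∈ interior K
    · rw [indicator_of_mem hx]
      have h1 : ∀ᶠ k : ℕ in atTop, ∀ i ∈ Finset.univ, c k i x = 1 :=
        (Filter.eventually_all_finset _).2 fun i _ =>
          tendsto_smoothTransition_div_of_pos tendsto_const_nhds
            (sub_pos.2 ((hK.mem_interior_iff x).1 hx i))
      refine tendsto_const_nhds.congr' ?_
      filter_upwards [h1] with k hk
      rw [Finset.prod_eq_one hk, one_mul]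
    · rw [indicator_of_notMem hx]
      rw [hK.mem_interior_iff] at hx
      push Not at hx
      obtain ⟨i, hi⟩ := hx
      refine tendsto_const_nhds.congr fun k => ?_
      have : c k i x = 0 := Real.smoothTransition.zero_of_nonpos
        (div_nonpos_of_nonpos_of_nonneg (sub_nonpos.2 hi) (by positivity))
      rw [Finset.prod_eq_zero (Finset.mem_univ i) this, zero_mul]

/-- Green's formula on a polytope for a smooth field `v` and a smooth test function `w`. -/
theorem green (hK : IsPolytope K F n b) {v : E (m + 1) → E (m + 1)} (hv : ContDiff ℝ 1 v)
    {w : E (m + 1) → ℝ} (hw : ContDiff ℝ ∞ w) (hs : HasCompactSupport w) :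
    (∫ x in interior K, inner ℝ (v x) (∇ w x)) + ∫ x in interior K, divergence v x * w x =
      ∑ j, ∫ x in F j, inner ℝ (v x) (n j) * w x ∂(Measure.euclideanHausdorffMeasure m) := by
  have hw1 : ContDiff ℝ 1 w := hw.of_le (by simp)
  have hvi : ∀ i, ContDiff ℝ 1 fun x => v x i := fun i => by fun_prop
  have hvw : ∀ i, ContDiff ℝ 1 fun x => v x i * w x := fun i => (hvi i).mul hw1
  have hvs : ∀ i, HasCompactSupport fun x => v x i * w x := fun i => hs.mul_left
  have hdi : ∀ i x, fderiv ℝ (fun x => v x i * w x) x (EuclideanSpace.single i 1) =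
      v x i * (∇ w x) i + fderiv ℝ v x (EuclideanSpace.single i 1) i * w x := by
    intro i x
    have h1 : DifferentiableAt ℝ (fun x => v x i) x := (hvi i).differentiable (by simp) x
    have h2 : DifferentiableAt ℝ w x := hw1.differentiable (by simp) x
    have h3 : fderiv ℝ (fun x => v x i) x (EuclideanSpace.single i 1) =
        fderiv ℝ v x (EuclideanSpace.single i 1) i := by
      have := ((EuclideanSpace.proj (𝕜 := ℝ) i).hasFDerivAt.comp x
        (hv.differentiable (by simp) x).hasFDerivAt).fderiv
      change (fderiv ℝ ((EuclideanSpace.proj (𝕜 := ℝ) i) ∘ v) x) _ = _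
      rw [this]; simp
    have h4 : (∇ w x) i = fderiv ℝ w x (EuclideanSpace.single i 1) := by
      have : inner ℝ (∇ w x) (EuclideanSpace.single i (1 : ℝ)) =
        fderiv ℝ w x (EuclideanSpace.single i 1) := by simp [gradient]
      rw [← this, real_inner_comm, EuclideanSpace.inner_single_left]
      simp
    rw [fderiv_fun_mul h1 h2]
    simp only [_root_.add_apply, _root_.smul_apply, smul_eq_mul, h3, h4]
    ring
  have hgc : Continuous (∇ w) := by
    unfold gradient
    exact (LinearIsometryEquiv.continuous _).comp (hw1.continuous_fderiv (by simp))
  have hgs : HasCompactSupport (∇ w) :=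
    (hs.fderiv (𝕜 := ℝ)).comp_left (g := (InnerProductSpace.toDual ℝ (E (m + 1))).symm) (by simp)
  have hdivc : Continuous (divergence v) := by
    unfold divergence
    have : Continuous (fderiv ℝ v) := hv.continuous_fderiv (by simp)
    fun_prop
  rw [← integral_add]
  -- The integrand is the divergence of `w v`, so Gauss' theorem applies to each component in its
  -- own coordinate direction.
  · have h1 : ∀ x, inner ℝ (v x) (∇ w x) + divergence v x * w x =
        ∑ i, fderiv ℝ (fun x => v x i * w x) x (EuclideanSpace.single i 1) := by
      intro x
      simp only [hdi, divergence, Finset.sum_add_distrib, Finset.sum_mul, PiLp.inner_apply]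
      simp [mul_comm]
    simp only [h1]
    have hdint : ∀ i, IntegrableOn (fun x => fderiv ℝ (fun x => v x i * w x) x
        (EuclideanSpace.single i 1)) (interior K) := by
      intro i
      refine (Continuous.integrable_of_hasCompactSupport
        (((hvw i).continuous_fderiv (by simp)).clm_apply continuous_const) ?_).integrableOn
      exact ((hvs i).fderiv (𝕜 := ℝ)).comp_left
        (g := fun L : E (m + 1) →L[ℝ] ℝ => L (EuclideanSpace.single i 1)) (by simp)
    rw [integral_finsetSum _ fun i _ => hdint i]
    simp only [hK.integral_fderiv (hvw _) (hvs _)]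
    rw [Finset.sum_comm]
    refine Finset.sum_congr rfl fun j _ => ?_
    simp only [← integral_const_mul]
    rw [← integral_finsetSum]
    · refine integral_congr_ae (Eventually.of_forall fun x => ?_)
      simp only [PiLp.inner_apply, Finset.sum_mul]
      refine Finset.sum_congr rfl fun i _ => ?_
      simp
      ring
    · intro i _
      refine Integrable.const_mul ?_ _
      exact hK.integrableOn_facet j (hvw i).continuous
  · exact ((hv.continuous.inner hgc).integrable_of_hasCompactSupport
      (HasCompactSupport.intro hgs.isCompact fun x hx => by
        simp [image_eq_zero_of_notMem_tsupport hx])).integrableOn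
  · exact ((hdivc.mul hw.continuous).integrable_of_hasCompactSupport hs.mul_left).integrableOn

end IsPolytope

/-! ### Cells are polytopes -/

instance FacetIdx.instDecidableEq (d : ℕ) : (sh : MeshShape) → DecidableEq (FacetIdx d sh)
  | .simplicial => inferInstanceAs (DecidableEq (Fin (d + 1)))
  | .rectangular => inferInstanceAs (DecidableEq (Fin d × Bool))

/-- The gradient of `ℓ`, reversed and normalised, is the outward normal of the half-space `ℓ ≥ 0`.
This turns barycentric coordinates into facet inequalities. -/
theorem exists_normal_of_affineMap {m : ℕ} (ℓ : E (m + 1) →ᵃ[ℝ] ℝ) (h : ∃ x y, ℓ x ≠ ℓ y) :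
    ∃ (n : E (m + 1)) (b c : ℝ), ‖n‖ = 1 ∧ 0 < c ∧ ∀ x, b - inner ℝ n x = c * ℓ x := by
  let g : E (m + 1) := (InnerProductSpace.toDual ℝ (E (m + 1))).symm ℓ.linear.toContinuousLinearMap
  have hg : ∀ x, inner ℝ g x = ℓ.linear x := fun x => by simp [g]
  have hℓ : ∀ x, ℓ x = ℓ.linear x + ℓ 0 := fun x => congrFun ℓ.decomp x
  have hg0 : g ≠ 0 := by
    rintro h0
    obtain ⟨x, y, hxy⟩ := h
    apply hxy
    rw [hℓ x, hℓ y, ← hg, ← hg, h0]; simp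
  have hgpos : 0 < ‖g‖ := norm_pos_iff.2 hg0
  refine ⟨-(‖g‖⁻¹ • g), ‖g‖⁻¹ * ℓ 0, ‖g‖⁻¹, ?_, inv_pos.2 hgpos, fun x => ?_⟩
  · rw [norm_neg, norm_smul, norm_inv, norm_norm, inv_mul_cancel₀ hgpos.ne']
  · rw [inner_neg_left, inner_smul_left, hg, hℓ x]
    simp
    ring

/-- The affine basis formed by the vertices of a full-dimensional simplex. -/
def simplexBasis {m : ℕ} (s : Affine.Simplex ℝ (E (m + 1)) (m + 1)) :
    AffineBasis (Fin (m + 1 + 1)) ℝ (E (m + 1)) :=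
  ⟨s.points, s.independent, by
    rw [s.independent.affineSpan_eq_top_iff_card_eq_finrank_add_one]; simp⟩

/-- The zero set of a barycentric coordinate is convex and contains the other vertices. Conversely,
dropping the zero term from the barycentric combination leaves a convex combination of those
vertices. -/
theorem simplex_facet {m : ℕ} (s : Affine.Simplex ℝ (E (m + 1)) (m + 1)) (j : Fin (m + 1 + 1))
    (x : E (m + 1)) : x ∈ convexHull ℝ (s.points '' {i | i ≠ j}) ↔
      x ∈ convexHull ℝ (Set.range s.points) ∧ (simplexBasis s).coord j x = 0 := by
  constructor
  · intro hx
    refine ⟨convexHull_mono (image_subset_range _ _) hx, ?_⟩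
    have hc : Convex ℝ {x | (simplexBasis s).coord j x = 0} :=
      (convex_singleton (0 : ℝ)).affine_preimage ((simplexBasis s).coord j)
    refine convexHull_min ?_ hc hx
    rintro _ ⟨i, hi, rfl⟩
    exact (simplexBasis s).coord_apply_ne (Ne.symm hi)
  · rintro ⟨hx, hj⟩
    have hx' : x ∈ convexHull ℝ (Set.range (simplexBasis s)) := hx
    rw [(simplexBasis s).convexHull_eq_nonneg_coord] at hx'
    have h1 := (simplexBasis s).sum_coord_apply_eq_one x
    rw [← (simplexBasis s).linear_combination_coord_eq_self x]
    rw [← Finset.add_sum_erase _ _ (Finset.mem_univ j), hj, zero_smul, zero_add]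
    rw [← Finset.add_sum_erase _ _ (Finset.mem_univ j), hj, zero_add] at h1
    refine (convex_convexHull ℝ _).sum_mem (fun i _ => hx' i) h1 fun i hi => ?_
    exact subset_convexHull ℝ _ ⟨i, Finset.ne_of_mem_erase hi, rfl⟩

theorem exists_isPolytope_simplex {m : ℕ} (s : Affine.Simplex ℝ (E (m + 1)) (m + 1)) :
    ∃ n b, IsPolytope (convexHull ℝ (Set.range s.points))
      (fun j => convexHull ℝ (s.points '' {i | i ≠ j})) n b := by
  let B := simplexBasis s
  have hne : ∀ j, ∃ x y, B.coord j x ≠ B.coord j y := fun j => by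
    obtain ⟨i, hi⟩ := exists_ne j
    exact ⟨B j, B i, by rw [B.coord_apply_eq, B.coord_apply_ne hi.symm]; simp⟩
  choose n b c hn hc hb using fun j => exists_normal_of_affineMap (B.coord j) (hne j)
  have hle : ∀ j x, inner ℝ (n j) x ≤ b j ↔ 0 ≤ B.coord j x := fun j x => by
    rw [← mul_nonneg_iff_of_pos_left (hc j), ← hb j x, sub_nonneg]
  have hlt : ∀ j x, inner ℝ (n j) x < b j ↔ 0 < B.coord j x := fun j x => by
    rw [← mul_pos_iff_of_pos_left (hc j), ← hb j x, sub_pos]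
  have heq : ∀ j x, inner ℝ (n j) x = b j ↔ B.coord j x = 0 := fun j x => by
    rw [eq_comm, ← sub_eq_zero, hb j x, mul_eq_zero, or_iff_right (hc j).ne']
  have hmem : ∀ x, x ∈ convexHull ℝ (Set.range s.points) ↔ ∀ j, 0 ≤ B.coord j x := fun x => by
    have : Set.range s.points = Set.range B := rfl
    rw [this, B.convexHull_eq_nonneg_coord]; rfl
  refine ⟨n, b, hn, fun x => ?_, fun j x => ?_, fun j => ?_, ?_, ?_⟩
  · rw [hmem]; exact forall_congr' fun j => (hle j x).symm
  · rw [heq]; exact simplex_facet s j x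
  -- The barycentre of the facet: equal weights on its `m + 1` vertices.
  · let w : Fin (m + 1 + 1) → ℝ := fun i => if i = j then 0 else 1 / (m + 1)
    have hw : Finset.univ.sum w = 1 := by
      simp only [w]
      rw [← Finset.add_sum_erase _ _ (Finset.mem_univ j), if_pos rfl, zero_add,
        Finset.sum_congr rfl fun i hi => if_neg (Finset.ne_of_mem_erase hi), Finset.sum_const,
        Finset.card_erase_of_mem (Finset.mem_univ j)]
      simp
      field_simp
    refine ⟨Finset.univ.affineCombination ℝ B w, ?_, fun i hi => ?_⟩
    · rw [heq, B.coord_apply_combination_of_mem (Finset.mem_univ _) hw]; simp [w]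
    · rw [hlt, B.coord_apply_combination_of_mem (Finset.mem_univ _) hw]
      simp only [w, if_neg hi]; positivity
  · let w : Fin (m + 1 + 1) → ℝ := fun i => 1 / (m + 1 + 1)
    have hw : Finset.univ.sum w = 1 := by
      simp [w]
      field_simp
    refine ⟨Finset.univ.affineCombination ℝ B w, fun i => ?_⟩
    rw [hlt, B.coord_apply_combination_of_mem (Finset.mem_univ _) hw]
    simp only [w]; positivity
  · exact isBounded_convexHull.2 (Set.finite_range s.points).isBounded

theorem exists_isPolytope_simplicial {m : ℕ} (K : Cell (m + 1) .simplicial) :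
    ∃ n b, IsPolytope K.carrier K.facet n b :=
  exists_isPolytope_simplex (m := m) K

/-- The outward unit normals of a box. -/
def boxNormal {m : ℕ} (j : FacetIdx (m + 1) .rectangular) : E (m + 1) :=
  match j with
  | (i, false) => -EuclideanSpace.single i 1
  | (i, true) => EuclideanSpace.single i 1

theorem isPolytope_rectangular {m : ℕ} (K : Cell (m + 1) .rectangular) :
    ∃ b, IsPolytope K.carrier K.facet boxNormal b := by
  obtain ⟨⟨lo, hi⟩, hlt⟩ := K
  change ∀ i, lo i < hi i at hlt
  let b : FacetIdx (m + 1) .rectangular → ℝ := fun j => match j with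
    | (i, false) => -lo i
    | (i, true) => hi i
  have hf : ∀ i (x : E (m + 1)), inner ℝ (boxNormal (i, false)) x = -x i := fun i x => by
    simp [boxNormal, EuclideanSpace.inner_single_left]
  have ht : ∀ i (x : E (m + 1)), inner ℝ (boxNormal (i, true)) x = x i := fun i x => by
    simp [boxNormal, EuclideanSpace.inner_single_left]
  have hmid : ∀ i, lo i < (lo i + hi i) / 2 ∧ (lo i + hi i) / 2 < hi i := fun i =>
    ⟨by linarith [hlt i], by linarith [hlt i]⟩
  refine ⟨b, ?_, fun x => ?_, ?_, ?_, ?_, ?_⟩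
  · rintro ⟨i, _ | _⟩ <;> simp [boxNormal]
  · constructor
    · rintro h ⟨i, _ | _⟩
      · rw [hf]; exact neg_le_neg (h i).1
      · rw [ht]; exact (h i).2
    · intro h i
      have h1 := h (i, false)
      have h2 := h (i, true)
      rw [hf] at h1
      rw [ht] at h2
      exact ⟨neg_le_neg_iff.1 h1, h2⟩
  · rintro ⟨i, _ | _⟩ x
    · rw [hf]
      change _ ∧ x i = lo i ↔ _ ∧ -x i = -lo i
      rw [neg_inj]
    · rw [ht]; rfl
  · rintro ⟨i, s⟩
    -- The centre of the facet: coordinate `i` is extreme, the others are midpoints.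
    refine ⟨WithLp.toLp 2 fun k => if k = i then (if s then hi i else lo i)
      else (lo k + hi k) / 2, ?_, ?_⟩
    · cases s
      · rw [hf]; simp [b]
      · rw [ht]; simp [b]
    · rintro ⟨k, s'⟩ hne
      have hh := hmid k
      have := hlt k
      cases s' <;> cases s <;> by_cases hki : k = i
      · exact absurd (by rw [hki]) hne
      · rw [hf]; simpa [b, hki] using hh.1
      · rw [hf]; subst hki; simpa [b] using this
      · rw [hf]; simpa [b, hki] using hh.1
      · rw [ht]; subst hki; simpa [b] using this
      · rw [ht]; simpa [b, hki] using hh.2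
      · exact absurd (by rw [hki]) hne
      · rw [ht]; simpa [b, hki] using hh.2
  · refine ⟨WithLp.toLp 2 fun k => (lo k + hi k) / 2, ?_⟩
    rintro ⟨k, _ | _⟩
    · rw [hf]; simpa [b] using (hmid k).1
    · rw [ht]; simpa [b] using (hmid k).2
  · have : IsCompact ((EuclideanSpace.equiv (Fin (m + 1)) ℝ).symm '' Icc (fun i => lo i)
        (fun i => hi i)) :=
      isCompact_Icc.image (EuclideanSpace.equiv (Fin (m + 1)) ℝ).symm.continuous
    refine this.isBounded.subset fun x hx => ⟨fun i => x i, ?_, rfl⟩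
    exact ⟨fun i => (hx i).1, fun i => (hx i).2⟩

/-- At a relatively interior point of the facet every direction `u` with `⟨n j, u⟩ ≤ 0` is feasible,
which leaves a single unit normal. Hence the choice in `Cell.normal` is unambiguous. -/
theorem IsPolytope.isOutwardUnitNormal_iff {m : ℕ} {J : Type*} [Finite J] {K : Set (E (m + 1))}
    {F : J → Set (E (m + 1))} {n : J → E (m + 1)} {b : J → ℝ} (hK : IsPolytope K F n b) (j : J)
    (ν : E (m + 1)) : IsOutwardUnitNormal K (F j) ν ↔ ν = n j := by
  constructor
  · rintro ⟨hν, h⟩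
    obtain ⟨z, hz, hz'⟩ := hK.exists_relint j
    have hzF : z ∈ F j := (hK.mem_facet_iff j z).2 ⟨(hK.mem_iff z).2 fun i => by
      by_cases hi : i = j
      · subst hi; exact hz.le
      · exact (hz' i hi).le, hz⟩
    have key : ∀ u : E (m + 1), inner ℝ (n j) u ≤ 0 → inner ℝ ν u ≤ 0 := by
      intro u hu
      have hopen : IsOpen {t : ℝ | z + t • u ∈ {x | ∀ i ∈ {i | i ≠ j}, inner ℝ (n i) x < b i}} :=
        (IsPolytope.isOpen_strict n b {i | i ≠ j}).preimage (by fun_prop)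
      obtain ⟨r, hr, hball⟩ := Metric.isOpen_iff.1 hopen 0 (by simpa using hz')
      have hmem : z + (r / 2) • u ∈ K := by
        refine (hK.mem_iff _).2 fun i => ?_
        by_cases hi : i = j
        · subst hi
          rw [inner_add_right, hz, inner_smul_right]
          nlinarith
        · exact (hball (show r / 2 ∈ Metric.ball 0 r by simp [abs_of_pos hr, hr]) i hi).le
      have := h z hzF _ hmem
      rw [add_sub_cancel_left, inner_smul_right] at this
      nlinarith
    -- The tangential part of `ν` gives `1 ≤ ⟨n j, ν⟩ ^ 2`; the direction `-n j` below fixes the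
    -- sign.
    have h1 := key (ν - inner ℝ (n j) ν • n j) (by
      rw [inner_sub_right, inner_smul_right, real_inner_self_eq_norm_sq, hK.norm_normal]; simp)
    rw [inner_sub_right, inner_smul_right, real_inner_self_eq_norm_sq, hν, real_inner_comm] at h1
    have h2 := key (-n j) (by
      rw [inner_neg_right, real_inner_self_eq_norm_sq, hK.norm_normal]; norm_num)
    rw [inner_neg_right] at h2
    have h3 : inner ℝ ν (n j) ≤ 1 := by
      have := real_inner_le_norm ν (n j)
      rwa [hν, hK.norm_normal, one_mul] at this
    exact (inner_eq_one_iff_of_norm_eq_one hν (hK.norm_normal j)).1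
      (le_antisymm h3 (by nlinarith))
  · rintro rfl
    refine ⟨hK.norm_normal j, fun y hy x hx => ?_⟩
    rw [inner_sub_right, ((hK.mem_facet_iff j y).1 hy).2]
    linarith [(hK.mem_iff x).1 hx j]

theorem IsPolytope.normal_eq {m : ℕ} {sh : MeshShape} {K : Cell (m + 1) sh}
    {n : FacetIdx (m + 1) sh → E (m + 1)} {b : FacetIdx (m + 1) sh → ℝ}
    (hK : IsPolytope K.carrier K.facet n b) : K.normal = n := by
  funext j
  exact (hK.isOutwardUnitNormal_iff j _).1 (Classical.epsilon_spec
    (p := IsOutwardUnitNormal K.carrier (K.facet j)) ⟨n j, (hK.isOutwardUnitNormal_iff j _).2 rfl⟩)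

theorem Cell.exists_isPolytope {m : ℕ} {sh : MeshShape} (K : Cell (m + 1) sh) :
    ∃ b, IsPolytope K.carrier K.facet K.normal b := by
  cases sh with
  | simplicial =>
    obtain ⟨n, b, h⟩ := exists_isPolytope_simplicial K
    exact ⟨b, h.normal_eq ▸ h⟩
  | rectangular =>
    obtain ⟨b, h⟩ := isPolytope_rectangular K
    exact ⟨b, h.normal_eq ▸ h⟩

/-- The offsets of the facet hyperplanes of a cell. -/
def Cell.offset {m : ℕ} {sh : MeshShape} (K : Cell (m + 1) sh) : FacetIdx (m + 1) sh → ℝ :=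
  K.exists_isPolytope.choose

theorem Cell.isPolytope {m : ℕ} {sh : MeshShape} (K : Cell (m + 1) sh) :
    IsPolytope K.carrier K.facet K.normal K.offset :=
  K.exists_isPolytope.choose_spec

/-! ### The Raviart-Thomas space on a cell -/

section RT0

variable {m : ℕ} {sh : MeshShape}

theorem contDiff_of_mem_RT0 {v : E (m + 1) → E (m + 1)} (hv : v ∈ RT0 (m + 1) sh) :
    ContDiff ℝ ∞ v := by
  cases sh with
  | simplicial =>
    obtain ⟨a, b, h⟩ := hv
    rw [show v = fun x => a + b • x from funext h]
    fun_prop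
  | rectangular =>
    obtain ⟨a, b, h⟩ := hv
    rw [contDiff_euclidean]
    intro i
    rw [show (fun x => v x i) = fun x => a i + b i * x i from funext fun x => h x i]
    fun_prop

theorem exists_divergence_eq {v : E (m + 1) → E (m + 1)} (hv : v ∈ RT0 (m + 1) sh) :
    ∃ c : ℝ, ∀ x, divergence v x = c := by
  cases sh with
  | simplicial =>
    obtain ⟨a, b, h⟩ := hv
    refine ⟨∑ i : Fin (m + 1), b, fun x => Finset.sum_congr rfl fun i _ => ?_⟩
    have h1 : HasFDerivAt v (b • ContinuousLinearMap.id ℝ (E (m + 1))) x := by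
      rw [show v = fun x => a + b • x from funext h]
      exact ((hasFDerivAt_id x).const_smul b).const_add a
    rw [h1.fderiv]
    simp
  | rectangular =>
    have hd := (contDiff_of_mem_RT0 hv).differentiable (by simp)
    obtain ⟨a, b, h⟩ := hv
    refine ⟨∑ i : Fin (m + 1), b i, fun x => Finset.sum_congr rfl fun i _ => ?_⟩
    have h1 := ((EuclideanSpace.proj (𝕜 := ℝ) i).hasFDerivAt.comp x (hd x).hasFDerivAt)
    have h2 : HasFDerivAt (fun x : E (m + 1) => a i + b i * x i)
        (b i • (EuclideanSpace.proj (𝕜 := ℝ) i)) x :=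
      ((EuclideanSpace.proj (𝕜 := ℝ) i).hasFDerivAt.const_mul (b i)).const_add (a i)
    have h3 : (EuclideanSpace.proj (𝕜 := ℝ) i) ∘ v = fun x : E (m + 1) => a i + b i * x i :=
      funext fun x => h x i
    rw [h3] at h1
    have h4 := congrArg (fun L => L (EuclideanSpace.single i (1 : ℝ))) (h1.unique h2)
    simpa using h4

/-- The position field belongs to the Raviart-Thomas space. -/
theorem id_mem_RT0 : (fun x => x) ∈ RT0 (m + 1) sh := by
  cases sh with
  | simplicial => exact ⟨0, 1, fun x => by simp⟩
  | rectangular => exact ⟨0, WithLp.toLp 2 fun _ => 1, fun x i => by simp⟩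

theorem divergence_id (x : E (m + 1)) : divergence (fun x : E (m + 1) => x) x = m + 1 := by
  simp [divergence, fderiv_fun_id]

/-- Raviart-Thomas fields have constant normal component on each facet. -/
theorem exists_flux (K : Cell (m + 1) sh) {v : E (m + 1) → E (m + 1)} (hv : v ∈ RT0 (m + 1) sh)
    (j : FacetIdx (m + 1) sh) :
    ∃ c : ℝ, ∀ x, inner ℝ (K.normal j) x = K.offset j → inner ℝ (v x) (K.normal j) = c := by
  cases sh with
  | simplicial =>
    obtain ⟨a, b, h⟩ := hv
    refine ⟨inner ℝ a (K.normal j) + b * K.offset j, fun x hx => ?_⟩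
    rw [h, inner_add_left, inner_smul_left, real_inner_comm _ x, hx]
    simp
  | rectangular =>
    obtain ⟨a, b, h⟩ := hv
    obtain ⟨b', hb'⟩ := isPolytope_rectangular K
    have hn := hb'.normal_eq
    rcases j with ⟨i, _ | _⟩
    · have hni : K.normal (i, false) = -EuclideanSpace.single i 1 := by rw [hn]; rfl
      refine ⟨-(a i + b i * -K.offset (i, false)), fun x hx => ?_⟩
      rw [hni] at hx ⊢
      simp only [inner_neg_left, EuclideanSpace.inner_single_left] at hx
      rw [← hx, inner_neg_right, EuclideanSpace.inner_single_right]
      simp [h]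
    · have hni : K.normal (i, true) = EuclideanSpace.single i 1 := by rw [hn]; rfl
      refine ⟨(a i + b i * K.offset (i, true)), fun x hx => ?_⟩
      rw [hni] at hx ⊢
      simp only [EuclideanSpace.inner_single_left] at hx
      rw [← hx, EuclideanSpace.inner_single_right]
      simp [h]

/-- A Raviart-Thomas field without normal components on the facets vanishes. -/
theorem eq_zero_of_flux_eq_zero (K : Cell (m + 1) sh) {v : E (m + 1) → E (m + 1)}
    (hv : v ∈ RT0 (m + 1) sh) (h0 : ∀ j, ∀ x ∈ K.facet j, inner ℝ (v x) (K.normal j) = 0) :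
    v = 0 := by
  cases sh with
  | simplicial =>
    obtain ⟨a, b, h⟩ := hv
    let s : Affine.Simplex ℝ (E (m + 1)) (m + 1) := K
    have hK := K.isPolytope
    have hmemF : ∀ i j : Fin (m + 1 + 1), i ≠ j → s.points i ∈ Cell.facet K j := fun i j hij =>
      subset_convexHull ℝ _ ⟨i, hij, rfl⟩
    -- Vertex `i` lies on every facet except the opposite one, so the value of `v` there is
    -- orthogonal to all normals but one. Up to sign it is a recession direction, and a bounded cell
    -- has only the zero one.
    have hp : ∀ i : Fin (m + 1 + 1), v (s.points i) = 0 := by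
      intro i
      by_contra hne
      have haux : ∀ u : E (m + 1), u ≠ 0 → (∀ j : Fin (m + 1 + 1), inner ℝ (K.normal j) u ≤ 0) →
          False := by
        intro u hu hle
        obtain ⟨R, hR⟩ := hK.bounded.exists_norm_le
        have hmem : ∀ t : ℝ, 0 ≤ t → s.points i + t • u ∈ K.carrier := fun t ht =>
          (hK.mem_iff _).2 fun j => by
            rw [inner_add_right, inner_smul_right]
            have h1 := (hK.mem_iff _).1 (subset_convexHull ℝ _ ⟨i, rfl⟩ :
              s.points i ∈ K.carrier) j
            nlinarith [hle j]
        have hup : 0 < ‖u‖ := norm_pos_iff.2 hu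
        have hR0 : 0 ≤ R := (norm_nonneg _).trans (hR _ (hmem 0 le_rfl))
        have h2 := hR _ (hmem ((R + ‖s.points i‖ + 1) / ‖u‖) (by positivity))
        have h3 : ‖((R + ‖s.points i‖ + 1) / ‖u‖) • u‖ = R + ‖s.points i‖ + 1 := by
          rw [norm_smul, Real.norm_of_nonneg (by positivity), div_mul_cancel₀ _ hup.ne']
        have h4 := norm_sub_le (s.points i + ((R + ‖s.points i‖ + 1) / ‖u‖) • u) (s.points i)
        rw [add_sub_cancel_left, h3] at h4
        linarith
      have hj : ∀ j : Fin (m + 1 + 1), i ≠ j → inner ℝ (K.normal j) (v (s.points i)) = 0 :=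
        fun j hij => by rw [real_inner_comm]; exact h0 j _ (hmemF i j hij)
      rcases le_total (inner ℝ (Cell.normal K i) (v (s.points i))) 0 with hi | hi
      · refine haux _ hne fun j => ?_
        by_cases hij : i = j
        · subst hij; exact hi
        · exact (hj j hij).le
      · refine haux _ (neg_ne_zero.2 hne) fun j => ?_
        rw [inner_neg_right]
        by_cases hij : i = j
        · subst hij; exact neg_nonpos.2 hi
        · rw [hj j hij, neg_zero]
    -- Vanishing of `a + b x` at two distinct vertices forces `b = 0`, then `a = 0`.
    have h01 : s.points 0 ≠ s.points 1 := s.independent.injective.ne (by simp)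
    have e0 := hp 0
    have e1 := hp 1
    rw [h] at e0 e1
    have hb : b = 0 := by
      have : b • (s.points 0 - s.points 1) = 0 := by
        rw [smul_sub, ← add_sub_add_left_eq_sub _ _ a, e0, e1, sub_zero]
      exact (smul_eq_zero.1 this).resolve_right (sub_ne_zero.2 h01)
    subst hb
    rw [zero_smul, add_zero] at e0
    funext x
    rw [h, e0]; simp
  | rectangular =>
    obtain ⟨a, b, h⟩ := hv
    obtain ⟨b', hb'⟩ := isPolytope_rectangular K
    have hn := hb'.normal_eq
    have hlt := K.2
    have hlo : ∀ i, a i + b i * K.1.1 i = 0 := by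
      intro i
      have := h0 (i, false) K.1.1 ⟨fun k => ⟨le_rfl, (hlt k).le⟩, rfl⟩
      rw [hn] at this
      simp [boxNormal, EuclideanSpace.inner_single_right, h] at this
      linarith
    have hhi : ∀ i, a i + b i * K.1.2 i = 0 := by
      intro i
      have := h0 (i, true) K.1.2 ⟨fun k => ⟨(hlt k).le, le_rfl⟩, rfl⟩
      rw [hn] at this
      simpa [boxNormal, EuclideanSpace.inner_single_right, h] using this
    funext x
    ext i
    have hb : b i = 0 := by
      have h1 : b i * (K.1.2 i - K.1.1 i) = 0 := by linarith [hlo i, hhi i]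
      exact (mul_eq_zero.1 h1).resolve_right (sub_ne_zero.2 (hlt i).ne')
    have ha := hlo i
    rw [hb] at ha
    rw [h, hb]
    simpa using ha

end RT0

/-! ### Fluxes of Raviart-Thomas fields -/

section Flux

variable {m : ℕ} {sh : MeshShape}

/-- The constant normal component of a Raviart-Thomas field on the facet `j` of `K`. -/
def Cell.flux (K : Cell (m + 1) sh) (j : FacetIdx (m + 1) sh) (v : E (m + 1) → E (m + 1)) : ℝ :=
  inner ℝ (v (K.isPolytope.exists_relint j).choose) (K.normal j)

theorem Cell.flux_sum (K : Cell (m + 1) sh) (j : FacetIdx (m + 1) sh) {ι : Type*} (s : Finset ι)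
    (a : ι → ℝ) (v : ι → E (m + 1) → E (m + 1)) :
    K.flux j (fun x => ∑ i ∈ s, a i • v i x) = ∑ i ∈ s, a i * K.flux j (v i) := by
  simp [Cell.flux, sum_inner, inner_smul_left]

theorem Cell.inner_eq_flux (K : Cell (m + 1) sh) {v : E (m + 1) → E (m + 1)}
    (hv : v ∈ RT0 (m + 1) sh) (j : FacetIdx (m + 1) sh) {x : E (m + 1)}
    (hx : inner ℝ (K.normal j) x = K.offset j) : inner ℝ (v x) (K.normal j) = K.flux j v := by
  obtain ⟨c, hc⟩ := exists_flux K hv j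
  rw [hc x hx, Cell.flux, hc _ (K.isPolytope.exists_relint j).choose_spec.1]

theorem sum_mem_RT0 {χ : FacetIdx (m + 1) sh → E (m + 1) → E (m + 1)} (hχ : IsRT0Basis χ)
    (a : FacetIdx (m + 1) sh → ℝ) : (fun x => ∑ j, a j • χ j x) ∈ RT0 (m + 1) sh := by
  rw [← hχ.2, SetLike.mem_coe]
  have : (fun x => ∑ j, a j • χ j x) = ∑ j, a j • χ j := by ext1 x; simp
  rw [this]
  exact Submodule.sum_mem _ fun j _ => Submodule.smul_mem _ _ (Submodule.subset_span ⟨j, rfl⟩)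

theorem basis_mem_RT0 {χ : FacetIdx (m + 1) sh → E (m + 1) → E (m + 1)} (hχ : IsRT0Basis χ)
    (j : FacetIdx (m + 1) sh) : χ j ∈ RT0 (m + 1) sh := by
  rw [← hχ.2]; exact Submodule.subset_span ⟨j, rfl⟩

/-- The fluxes of the field with given coefficients with respect to a basis. -/
def fluxMap (K : Cell (m + 1) sh) (χ : FacetIdx (m + 1) sh → E (m + 1) → E (m + 1)) :
    (FacetIdx (m + 1) sh → ℝ) →ₗ[ℝ] (FacetIdx (m + 1) sh → ℝ) :=
  (Matrix.of fun j i => K.flux j (χ i)).mulVecLin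

theorem fluxMap_apply (K : Cell (m + 1) sh) (χ : FacetIdx (m + 1) sh → E (m + 1) → E (m + 1))
    (a : FacetIdx (m + 1) sh → ℝ) (j : FacetIdx (m + 1) sh) :
    fluxMap K χ a j = K.flux j fun x => ∑ i, a i • χ i x := by
  rw [K.flux_sum]
  simp [fluxMap, Matrix.mulVec, dotProduct, mul_comm]

/-- Unisolvence: zero fluxes make the field vanish by `eq_zero_of_flux_eq_zero`, and linear
independence of the basis then makes the coefficients vanish. -/
theorem fluxMap_injective (K : Cell (m + 1) sh)
    {χ : FacetIdx (m + 1) sh → E (m + 1) → E (m + 1)} (hχ : IsRT0Basis χ) :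
    Function.Injective (fluxMap K χ) := by
  rw [injective_iff_map_eq_zero]
  intro a ha
  have h1 : (fun x => ∑ j, a j • χ j x) = 0 := by
    refine eq_zero_of_flux_eq_zero K (sum_mem_RT0 hχ a) fun j x hx => ?_
    rw [K.inner_eq_flux (sum_mem_RT0 hχ a) j (K.isPolytope.facet_subset_hyperplane j hx),
      ← fluxMap_apply, ha]
    rfl
  have h2 : ∑ j, a j • χ j = 0 := by
    rw [← h1]; ext1 x; simp
  funext j
  exact Fintype.linearIndependent_iff.1 hχ.1 a h2 j

/-- Coefficients and fluxes are both indexed by the facets, so injectivity gives surjectivity. -/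
theorem fluxMap_surjective (K : Cell (m + 1) sh)
    {χ : FacetIdx (m + 1) sh → E (m + 1) → E (m + 1)} (hχ : IsRT0Basis χ) :
    Function.Surjective (fluxMap K χ) :=
  LinearMap.injective_iff_surjective.1 (fluxMap_injective K hχ)

end Flux

/-! ### Weak divergences -/

section WeakDiv

theorem integrable_inner_of_memLp {α : Type*} {mα : MeasurableSpace α} {μ : Measure α} {d : ℕ}
    {v u : α → E d} (hv : MemLp v 2 μ) (hu : MemLp u 2 μ) :
    Integrable (fun x => inner ℝ (v x) (u x)) μ := by
  refine (L2.integrable_inner (𝕜 := ℝ) (hv.toLp v) (hu.toLp u)).congr ?_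
  filter_upwards [hv.coeFn_toLp, hu.coeFn_toLp] with x h1 h2
  rw [h1, h2]

variable {d : ℕ}

theorem continuous_gradient {w : E d → ℝ} (hw : ContDiff ℝ ∞ w) : Continuous (∇ w) := by
  unfold gradient
  exact (LinearIsometryEquiv.continuous _).comp (hw.continuous_fderiv (by simp))

theorem hasCompactSupport_gradient {w : E d → ℝ} (hs : HasCompactSupport w) :
    HasCompactSupport (∇ w) :=
  (hs.fderiv (𝕜 := ℝ)).comp_left (g := (InnerProductSpace.toDual ℝ (E d)).symm) (by simp)

theorem memLp_gradient {w : E d → ℝ} (hw : ContDiff ℝ ∞ w) (hs : HasCompactSupport w)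
    (D : Set (E d)) : MemLp (∇ w) 2 (volume.restrict D) :=
  ((continuous_gradient hw).memLp_of_hasCompactSupport (hasCompactSupport_gradient hs)).restrict D

theorem memLp_test {w : E d → ℝ} (hw : ContDiff ℝ ∞ w) (hs : HasCompactSupport w)
    (D : Set (E d)) : MemLp w 2 (volume.restrict D) :=
  (hw.continuous.memLp_of_hasCompactSupport hs).restrict D

theorem integrable_inner_gradient {D : Set (E d)} {v : E d → E d}
    (hv : MemLp v 2 (volume.restrict D)) {w : E d → ℝ} (hw : ContDiff ℝ ∞ w)
    (hs : HasCompactSupport w) : IntegrableOn (fun x => inner ℝ (v x) (∇ w x)) D :=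
  integrable_inner_of_memLp hv (memLp_gradient hw hs D)

theorem integrable_mul_test {D : Set (E d)} {g : E d → ℝ}
    (hg : MemLp g 2 (volume.restrict D)) {w : E d → ℝ} (hw : ContDiff ℝ ∞ w)
    (hs : HasCompactSupport w) : IntegrableOn (fun x => g x * w x) D :=
  hg.integrable_mul (memLp_test hw hs D)

theorem gradient_eq_zero_of_notMem_tsupport {w : E d → ℝ} {x : E d} (hx : x ∉ tsupport w) :
    ∇ w x = 0 := by
  have h : w =ᶠ[nhds x] 0 := notMem_tsupport_iff_eventuallyEq.1 hx
  have h1 : fderiv ℝ w x = 0 := by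
    rw [h.fderiv_eq]; simp
  rw [gradient, h1, map_zero]

/-- The weak divergence is unique up to null sets. -/
theorem HasWeakDiv.ae_eq {D : Set (E d)} (hD : IsOpen D) {v : E d → E d} {g g' : E d → ℝ}
    (h : HasWeakDiv D v g) (h' : HasWeakDiv D v g') : g =ᵐ[volume.restrict D] g' := by
  have hl : LocallyIntegrable (fun x => g x - g' x) (volume.restrict D) :=
    (h.1.sub h'.1).locallyIntegrable (by norm_num)
  have key := hD.ae_eq_zero_of_integral_contDiff_smul_eq_zero (μ := volume.restrict D)
    (f := fun x => g x - g' x) (hl.locallyIntegrableOn D) (fun w hw hs hsub => by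
      have h1 := h.2 w hw hs hsub
      rw [h'.2 w hw hs hsub] at h1
      have h2 : ∀ x, w x • (g x - g' x) = g x * w x - g' x * w x := fun x => by
        rw [smul_eq_mul]; ring
      simp only [h2]
      rw [integral_sub (integrable_mul_test h.1 hw hs) (integrable_mul_test h'.1 hw hs)]
      linarith)
  filter_upwards [key, ae_restrict_mem hD.measurableSet] with x hx hxD
  exact sub_eq_zero.1 (hx hxD)

theorem HasWeakDiv.weakDiv_ae_eq {D : Set (E d)} (hD : IsOpen D) {v : E d → E d} {g : E d → ℝ}
    (h : HasWeakDiv D v g) : weakDiv D v =ᵐ[volume.restrict D] g :=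
  HasWeakDiv.ae_eq hD (Classical.epsilon_spec (p := HasWeakDiv D v) ⟨g, h⟩) h

theorem HasWeakDiv.congr {D : Set (E d)} {v v' : E d → E d} {g g' : E d → ℝ}
    (h : HasWeakDiv D v g) (hv : v =ᵐ[volume.restrict D] v')
    (hg : g =ᵐ[volume.restrict D] g') : HasWeakDiv D v' g' := by
  refine ⟨h.1.ae_eq hg, fun w hw hs hsub => ?_⟩
  have h1 : ∫ x in D, inner ℝ (v' x) (∇ w x) = ∫ x in D, inner ℝ (v x) (∇ w x) :=
    integral_congr_ae (by filter_upwards [hv] with x hx; rw [hx])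
  have h2 : ∫ x in D, g' x * w x = ∫ x in D, g x * w x :=
    integral_congr_ae (by filter_upwards [hg] with x hx; rw [hx])
  rw [h1, h2, h.2 w hw hs hsub]

/-- Weak divergences can be restricted to smaller open sets. -/
theorem HasWeakDiv.mono {D D' : Set (E d)} (hD : MeasurableSet D) (hsub : D' ⊆ D)
    {v : E d → E d} {g : E d → ℝ} (h : HasWeakDiv D v g) : HasWeakDiv D' v g := by
  refine ⟨h.1.mono_measure (Measure.restrict_mono hsub le_rfl), fun w hw hs hws => ?_⟩
  have h1 := h.2 w hw hs (hws.trans hsub)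
  rw [setIntegral_eq_of_subset_of_forall_sdiff_eq_zero hD hsub,
    setIntegral_eq_of_subset_of_forall_sdiff_eq_zero hD hsub] at h1
  · exact h1
  · intro x hx
    rw [image_eq_zero_of_notMem_tsupport fun h => hx.2 (hws h), mul_zero]
  · intro x hx
    rw [gradient_eq_zero_of_notMem_tsupport fun h => hx.2 (hws h), inner_zero_right]

theorem HasWeakDiv.sum {D : Set (E d)} {ι : Type*} (s : Finset ι) (a : ι → ℝ)
    {v : ι → E d → E d} {g : ι → E d → ℝ} (hv : ∀ i ∈ s, MemLp (v i) 2 (volume.restrict D))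
    (h : ∀ i ∈ s, HasWeakDiv D (v i) (g i)) :
    HasWeakDiv D (fun x => ∑ i ∈ s, a i • v i x) (fun x => ∑ i ∈ s, a i * g i x) := by
  refine ⟨memLp_finsetSum s fun i hi => (h i hi).1.const_mul (a i), fun w hw hs hsub => ?_⟩
  simp only [sum_inner, Finset.sum_mul, inner_smul_left, mul_assoc]
  rw [integral_finsetSum _ fun i hi => (integrable_inner_gradient (hv i hi) hw hs).const_mul _,
    integral_finsetSum _ fun i hi => (integrable_mul_test (h i hi).1 hw hs).const_mul _,
    ← Finset.sum_neg_distrib]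
  refine Finset.sum_congr rfl fun i hi => ?_
  rw [integral_const_mul, integral_const_mul, (h i hi).2 w hw hs hsub]
  simp

end WeakDiv

/-! ### Fields with constant normal traces on a cell -/

section HasFluxes

variable {m : ℕ} {sh : MeshShape}

/-- `V` has weak divergence `g` in `K` and the constant normal traces `α` on the facets. -/
structure HasFluxes (K : Cell (m + 1) sh) (V : E (m + 1) → E (m + 1)) (g : E (m + 1) → ℝ)
    (α : FacetIdx (m + 1) sh → ℝ) : Prop where
  memLp : MemLp V 2 (volume.restrict K.int)
  memLp_div : MemLp g 2 (volume.restrict K.int)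
  green : ∀ w : E (m + 1) → ℝ, ContDiff ℝ ∞ w → HasCompactSupport w →
    (∫ x in K.int, inner ℝ (V x) (∇ w x)) + ∫ x in K.int, g x * w x =
      ∑ j, α j * ∫ x in K.facet j, w x ∂(Measure.euclideanHausdorffMeasure m)

theorem Cell.isOpen_int (K : Cell (m + 1) sh) : IsOpen K.int := isOpen_interior

theorem Cell.isFiniteMeasure_int (K : Cell (m + 1) sh) :
    IsFiniteMeasure (volume.restrict K.int) :=
  ⟨by
    rw [Measure.restrict_apply_univ]
    exact (measure_mono interior_subset).trans_lt K.isPolytope.isCompact.measure_lt_top⟩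

theorem Cell.memLp_of_continuous (K : Cell (m + 1) sh) {F : Type*} [NormedAddCommGroup F]
    [SecondCountableTopology F]
    {v : E (m + 1) → F} (hv : Continuous v) : MemLp v 2 (volume.restrict K.int) := by
  have := K.isFiniteMeasure_int
  obtain ⟨C, hC⟩ := K.isPolytope.isCompact.exists_bound_of_continuousOn hv.continuousOn
  refine MemLp.of_bound hv.aestronglyMeasurable C ?_
  filter_upwards [ae_restrict_mem K.isOpen_int.measurableSet] with x hx
  exact hC x (interior_subset hx)

theorem continuous_divergence {v : E (m + 1) → E (m + 1)} (hv : v ∈ RT0 (m + 1) sh) :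
    Continuous (divergence v) := by
  obtain ⟨c, hc⟩ := exists_divergence_eq hv
  rw [show divergence v = fun _ => c from funext hc]
  exact continuous_const

/-- Green's formula, with the constant normal component taken out of each facet integral. -/
theorem HasFluxes.of_mem_RT0 (K : Cell (m + 1) sh) {v : E (m + 1) → E (m + 1)}
    (hv : v ∈ RT0 (m + 1) sh) : HasFluxes K v (divergence v) fun j => K.flux j v := by
  refine ⟨K.memLp_of_continuous (contDiff_of_mem_RT0 hv).continuous,
    K.memLp_of_continuous (continuous_divergence hv), fun w hw hs => ?_⟩
  rw [Cell.int, K.isPolytope.green ((contDiff_of_mem_RT0 hv).of_le (by simp)) hw hs]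
  refine Finset.sum_congr rfl fun j _ => ?_
  rw [← integral_const_mul]
  refine setIntegral_congr_fun (K.isPolytope.measurableSet_facet j) fun x hx => ?_
  rw [K.inner_eq_flux hv j (K.isPolytope.facet_subset_hyperplane j hx)]

variable {K : Cell (m + 1) sh} {V : E (m + 1) → E (m + 1)} {g : E (m + 1) → ℝ}
  {α : FacetIdx (m + 1) sh → ℝ}

theorem HasFluxes.congr (h : HasFluxes K V g α) {V' : E (m + 1) → E (m + 1)}
    {g' : E (m + 1) → ℝ} (hV : V =ᵐ[volume.restrict K.int] V')
    (hg : g =ᵐ[volume.restrict K.int] g') : HasFluxes K V' g' α := by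
  refine ⟨h.memLp.ae_eq hV, h.memLp_div.ae_eq hg, fun w hw hs => ?_⟩
  rw [← h.green w hw hs]
  congr 1
  · exact integral_congr_ae (by filter_upwards [hV] with x hx; rw [hx])
  · exact integral_congr_ae (by filter_upwards [hg] with x hx; rw [hx])

theorem HasFluxes.sum {ι : Type*} (s : Finset ι) (a : ι → ℝ) {V : ι → E (m + 1) → E (m + 1)}
    {g : ι → E (m + 1) → ℝ} {α : ι → FacetIdx (m + 1) sh → ℝ}
    (h : ∀ i ∈ s, HasFluxes K (V i) (g i) (α i)) :
    HasFluxes K (fun x => ∑ i ∈ s, a i • V i x) (fun x => ∑ i ∈ s, a i * g i x)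
      (fun j => ∑ i ∈ s, a i * α i j) := by
  refine ⟨memLp_finsetSum s fun i hi => (h i hi).memLp.const_smul (a i),
    memLp_finsetSum s fun i hi => (h i hi).memLp_div.const_mul (a i), fun w hw hs => ?_⟩
  simp only [sum_inner, Finset.sum_mul, inner_smul_left, mul_assoc]
  rw [integral_finsetSum _ fun i hi => (integrable_inner_gradient (h i hi).memLp hw hs).const_mul _,
    integral_finsetSum _ fun i hi => (integrable_mul_test (h i hi).memLp_div hw hs).const_mul _,
    Finset.sum_comm, ← Finset.sum_add_distrib]
  refine Finset.sum_congr rfl fun i hi => ?_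
  rw [integral_const_mul, integral_const_mul, ← Finset.mul_sum, ← (h i hi).green w hw hs, mul_add]
  simp

theorem HasFluxes.hasWeakDiv (h : HasFluxes K V g α) : HasWeakDiv K.int V g := by
  refine ⟨h.memLp_div, fun w hw hs hsub => ?_⟩
  have h1 := h.green w hw hs
  rw [Finset.sum_eq_zero fun j _ => ?_] at h1
  · linarith
  · rw [setIntegral_eq_zero_of_forall_eq_zero, mul_zero]
    intro x hx
    refine image_eq_zero_of_notMem_tsupport fun hxw => ?_
    exact ((K.isPolytope.mem_interior_iff x).1 (hsub hxw) j).ne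
      (K.isPolytope.facet_subset_hyperplane j hx)

theorem HasFluxes.weakDiv_ae_eq (h : HasFluxes K V g α) :
    weakDiv K.int V =ᵐ[volume.restrict K.int] g :=
  h.hasWeakDiv.weakDiv_ae_eq K.isOpen_int

/-- The divergence theorem. -/
theorem HasFluxes.integral_div (h : HasFluxes K V g α) :
    ∫ x in K.int, g x =
      ∑ j, α j * (Measure.euclideanHausdorffMeasure m).real (K.facet j) := by
  obtain ⟨R, hR⟩ := K.isPolytope.bounded.exists_norm_le
  -- A test function equal to `1` on a neighbourhood of the cell, so that the gradient term
  -- disappears.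
  let w : ContDiffBump (0 : E (m + 1)) :=
    ⟨|R| + 1, |R| + 2, by positivity, by linarith⟩
  have hone : ∀ x ∈ K.carrier, w x = 1 := fun x hx => w.one_of_mem_closedBall
    (mem_closedBall_zero_iff.2 ((hR x hx).trans ((le_abs_self R).trans (by simp [w]))))
  have hgrad : ∀ x ∈ K.carrier, ∇ (⇑w) x = 0 := by
    intro x hx
    have h1 : (⇑w) =ᶠ[nhds x] fun _ => 1 := w.eventuallyEq_one_of_mem_ball
      (mem_ball_zero_iff.2 ((hR x hx).trans_lt ((le_abs_self R).trans_lt (by simp [w]))))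
    rw [gradient, h1.fderiv_eq]
    simp
  have h1 := h.green w w.contDiff w.hasCompactSupport
  rw [setIntegral_eq_zero_of_forall_eq_zero fun x hx => by
    rw [hgrad x (interior_subset hx), inner_zero_right], zero_add] at h1
  rw [setIntegral_congr_fun K.isOpen_int.measurableSet
    (fun x hx => by simp only [hone x (interior_subset hx), mul_one] :
      EqOn (fun x => g x * w x) g K.int)] at h1
  rw [h1]
  refine Finset.sum_congr rfl fun j _ => ?_
  rw [setIntegral_congr_fun (K.isPolytope.measurableSet_facet j)
    (fun x hx => hone x (K.isPolytope.facet_subset j hx) : EqOn w (fun _ => 1) (K.facet j))]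
  simp

end HasFluxes

/-! ### Geometry of the mesh -/

/-- Near a point where the other constraints are strict, the interior of `K` is locally the open
half-space of constraint `j`. -/
theorem IsPolytope.eventually_mem_interior {m : ℕ} {J : Type*} [Finite J] {K : Set (E (m + 1))}
    {F : J → Set (E (m + 1))} {n : J → E (m + 1)} {b : J → ℝ} (hK : IsPolytope K F n b) {j : J}
    {x : E (m + 1)} (hx : ∀ i, i ≠ j → inner ℝ (n i) x < b i) :
    ∀ᶠ y in nhds x, inner ℝ (n j) y < b j → y ∈ interior K := by
  filter_upwards [(IsPolytope.isOpen_strict n b {i | i ≠ j}).mem_nhds hx] with y hy hyj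
  refine (hK.mem_interior_iff y).2 fun i => ?_
  by_cases hi : i = j
  · subst hi; exact hyj
  · exact hy i hi

section Mesh

variable {m : ℕ} {sh : MeshShape} {ι : Type} {Ω : Set (E (m + 1))} {T : ι → Cell (m + 1) sh}

/-- `x` lies in the relative interior of the facet `j` of `K`. -/
def Cell.IsRelint (K : Cell (m + 1) sh) (j : FacetIdx (m + 1) sh) (x : E (m + 1)) : Prop :=
  inner ℝ (K.normal j) x = K.offset j ∧ ∀ i, i ≠ j → inner ℝ (K.normal i) x < K.offset i

theorem Cell.IsRelint.mem_facet {K : Cell (m + 1) sh} {j : FacetIdx (m + 1) sh} {x : E (m + 1)}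
    (hx : K.IsRelint j x) : x ∈ K.facet j := by
  refine (K.isPolytope.mem_facet_iff j x).2 ⟨(K.isPolytope.mem_iff x).2 fun i => ?_, hx.1⟩
  by_cases hi : i = j
  · subst hi; exact hx.1.le
  · exact (hx.2 i hi).le

theorem Cell.ae_isRelint (K : Cell (m + 1) sh) (j : FacetIdx (m + 1) sh) :
    ∀ᵐ x ∂((Measure.euclideanHausdorffMeasure m).restrict (K.facet j)), K.IsRelint j x := by
  filter_upwards [K.isPolytope.ae_facet_strict j] with x hx
  exact ⟨K.isPolytope.facet_subset_hyperplane j hx.1, hx.2⟩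

/-- The facet `j` of `T K` is an interior facet, shared with the facet `j'` of `T K'`. -/
structure IsShared (Ω : Set (E (m + 1))) (T : ι → Cell (m + 1) sh) (K : ι)
    (j : FacetIdx (m + 1) sh) (K' : ι) (j' : FacetIdx (m + 1) sh) : Prop where
  not_subset : ¬ (T K).facet j ⊆ frontier Ω
  ne : K' ≠ K
  facet_eq : (T K').facet j' = (T K).facet j

variable {K K' : ι} {j j' : FacetIdx (m + 1) sh}

theorem IsShared.symm (h : IsShared Ω T K j K' j') : IsShared Ω T K' j' K j :=
  ⟨h.facet_eq ▸ h.not_subset, h.ne.symm, h.facet_eq.symm⟩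

theorem IsMesh.exists_isShared (hM : IsMesh Ω T) (h : ¬ (T K).facet j ⊆ frontier Ω) :
    ∃ K' j', IsShared Ω T K j K' j' := by
  rcases hM.conform K j with h' | ⟨K', j', hne, heq⟩
  · exact absurd h' h
  · exact ⟨K', j', h, hne, heq⟩

theorem IsShared.ae_isRelint (h : IsShared Ω T K j K' j') :
    ∀ᵐ x ∂((Measure.euclideanHausdorffMeasure m).restrict ((T K).facet j)),
      (T K).IsRelint j x ∧ (T K').IsRelint j' x := by
  have h1 := (T K').ae_isRelint j'
  rw [h.facet_eq] at h1
  exact ((T K).ae_isRelint j).and h1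

theorem Cell.measure_restrict_facet_ne_zero (K : Cell (m + 1) sh) (j : FacetIdx (m + 1) sh) :
    (Measure.euclideanHausdorffMeasure m).restrict (K.facet j) ≠ 0 := by
  rw [Ne, Measure.restrict_eq_zero]
  exact (K.isPolytope.measure_facet_pos j).ne'

theorem IsShared.exists_isRelint (h : IsShared Ω T K j K' j') :
    ∃ x, (T K).IsRelint j x ∧ (T K').IsRelint j' x := by
  have : NeBot (ae ((Measure.euclideanHausdorffMeasure m).restrict ((T K).facet j))) :=
    ae_neBot.2 ((T K).measure_restrict_facet_ne_zero j)
  exact h.ae_isRelint.exists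

/-- The outward normals of the two sides of an interior facet are opposite. -/
theorem IsMesh.normal_eq_neg (hM : IsMesh Ω T) (h : IsShared Ω T K j K' j') :
    (T K').normal j' = -(T K).normal j := by
  obtain ⟨x, hx, hx'⟩ := h.exists_isRelint
  by_contra hne
  have hn := (T K).isPolytope.norm_normal j
  have hn' := (T K').isPolytope.norm_normal j'
  have hgt : -1 < inner ℝ ((T K').normal j') ((T K).normal j) := by
    refine lt_of_le_of_ne ?_ fun heq =>
      hne ((inner_eq_neg_one_iff_of_norm_eq_one hn' hn).1 heq.symm)
    have := neg_le_of_abs_le (abs_real_inner_le_norm ((T K').normal j') ((T K).normal j))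
    rwa [hn, hn', one_mul] at this
  -- If the normals are not opposite, `u` has positive inner product with both, so a short step
  -- along `-u` enters both open cells, which are disjoint.
  set u := (T K).normal j + (T K').normal j' with hu
  have hlim : Tendsto (fun t : ℝ => x - t • u) (nhdsWithin 0 (Ioi 0)) (nhds x) := by
    have : Continuous fun t : ℝ => x - t • u := by fun_prop
    simpa using (this.tendsto 0).mono_left nhdsWithin_le_nhds
  have e1 := hlim.eventually ((T K).isPolytope.eventually_mem_interior hx.2)
  have e2 := hlim.eventually ((T K').isPolytope.eventually_mem_interior hx'.2)
  obtain ⟨t, ⟨ht1, ht2⟩, ht⟩ := ((e1.and e2).and self_mem_nhdsWithin).exists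
  have ht0 : 0 < t := ht
  refine Set.disjoint_left.1 (hM.disjoint K K' h.ne.symm) (ht1 ?_) (ht2 ?_)
  · rw [inner_sub_right, inner_smul_right, hx.1, hu, inner_add_right, real_inner_self_eq_norm_sq,
      hn, real_inner_comm]
    nlinarith
  · rw [inner_sub_right, inner_smul_right, hx'.1, hu, inner_add_right,
      real_inner_self_eq_norm_sq ((T K').normal j'), hn']
    nlinarith

/-- A point in the relative interior of an interior facet lies on no other facet than the two
copies of this one. -/
theorem IsMesh.eq_or_eq_of_mem_facet (hM : IsMesh Ω T) (h : IsShared Ω T K j K' j')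
    {x : E (m + 1)} (hx : (T K).IsRelint j x) (hx' : (T K').IsRelint j' x) {L : ι}
    {i : FacetIdx (m + 1) sh} (hxL : x ∈ (T L).facet i) : (L = K ∧ i = j) ∨ (L = K' ∧ i = j') := by
  have hnorm := hM.normal_eq_neg h
  have hoff : (T K').offset j' = -(T K).offset j := by
    rw [← hx.1, ← hx'.1, hnorm, inner_neg_left]
  have hn := (T K).isPolytope.norm_normal j
  have huniq : ∀ (M : ι) (l : FacetIdx (m + 1) sh), (T M).IsRelint l x → L = M → i = l := by
    rintro M l hxM rfl
    by_contra hil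
    exact (hxM.2 i hil).ne ((T L).isPolytope.facet_subset_hyperplane i hxL)
  suffices hL : L = K ∨ L = K' from
    hL.imp (fun e => ⟨e, huniq K j hx e⟩) fun e => ⟨e, huniq K' j' hx' e⟩
  -- Near `x` the two open cells fill everything off the common hyperplane. The interior of `L`
  -- comes arbitrarily close to `x`, so it must meet one of them.
  have hcl : x ∈ closure (interior (T L).carrier) :=
    (T L).isPolytope.subset_closure_interior ((T L).isPolytope.facet_subset i hxL)
  have hev := ((T K).isPolytope.eventually_mem_interior hx.2).and
    ((T K').isPolytope.eventually_mem_interior hx'.2)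
  obtain ⟨U, hU, hUo, hxU⟩ := eventually_nhds_iff.1 hev
  obtain ⟨y, hyU, hyL⟩ := mem_closure_iff.1 hcl U hUo hxU
  have hopen : IsOpen (U ∩ interior (T L).carrier) := hUo.inter isOpen_interior
  -- If the point found lies on the common hyperplane, it is moved off it within the open set.
  obtain ⟨y, ⟨hyU, hyL⟩, hyne⟩ : ∃ y ∈ U ∩ interior (T L).carrier,
      inner ℝ ((T K).normal j) y ≠ (T K).offset j := by
    by_cases hy : inner ℝ ((T K).normal j) y = (T K).offset j
    · obtain ⟨r, hr, hball⟩ := Metric.isOpen_iff.1 hopen y ⟨hyU, hyL⟩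
      refine ⟨y + (r / 2) • (T K).normal j, hball ?_, ?_⟩
      · simp [norm_smul, hn, abs_of_pos hr, hr]
      · rw [inner_add_right, hy, inner_smul_right, real_inner_self_eq_norm_sq, hn]
        linarith
    · exact ⟨y, ⟨hyU, hyL⟩, hy⟩
  rcases lt_or_gt_of_ne hyne with hlt | hgt
  · left
    by_contra hLK
    exact Set.disjoint_left.1 (hM.disjoint L K hLK) hyL ((hU y hyU).1 hlt)
  · right
    by_contra hLK
    refine Set.disjoint_left.1 (hM.disjoint L K' hLK) hyL ((hU y hyU).2 ?_)
    rw [hnorm, hoff, inner_neg_left]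
    linarith

/-- At most two cells share a facet, so passing to the neighbour's copy is an involution. -/
theorem IsMesh.isShared_unique (hM : IsMesh Ω T) (h : IsShared Ω T K j K' j') {L : ι}
    {i : FacetIdx (m + 1) sh} (hL : IsShared Ω T K j L i) : L = K' ∧ i = j' := by
  obtain ⟨x, hx, hx'⟩ := h.exists_isRelint
  have hxL : x ∈ (T L).facet i := hL.facet_eq ▸ hx.mem_facet
  exact (hM.eq_or_eq_of_mem_facet h hx hx' hxL).resolve_left fun e => hL.ne e.1

/-- An interior facet meets every other facet in a null set. -/
theorem IsMesh.measure_inter_facet (hM : IsMesh Ω T) (h : IsShared Ω T K j K' j') {L : ι}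
    {i : FacetIdx (m + 1) sh} (h1 : ¬ (L = K ∧ i = j)) (h2 : ¬ (L = K' ∧ i = j')) :
    Measure.euclideanHausdorffMeasure m ((T K).facet j ∩ (T L).facet i) = 0 := by
  have h3 := h.ae_isRelint
  rw [ae_iff, Measure.restrict_apply' ((T K).isPolytope.measurableSet_facet j)] at h3
  refine measure_mono_null ?_ h3
  rintro x hx
  refine ⟨fun hr => ?_, hx.1⟩
  rcases hM.eq_or_eq_of_mem_facet h hr.1 hr.2 hx.2 with e | e
  · exact h1 e
  · exact h2 e

/-- The fluxes `α` match across interior facets. -/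
def Balanced (Ω : Set (E (m + 1))) (T : ι → Cell (m + 1) sh)
    (α : ι → FacetIdx (m + 1) sh → ℝ) : Prop :=
  ∀ K j K' j', IsShared Ω T K j K' j' → α K' j' = -α K j

/-- The two copies of an interior facet carry opposite fluxes and the same weight, hence cancel. The
weight `I` depends on the facet as a set, which covers integrals of test functions and of
multipliers alike. -/
theorem IsMesh.sum_flux_eq_zero [Fintype ι] (hM : IsMesh Ω T) {α : ι → FacetIdx (m + 1) sh → ℝ}
    (hα : Balanced Ω T α) (I : Set (E (m + 1)) → ℝ)
    (hI : ∀ K j, (T K).facet j ⊆ frontier Ω → I ((T K).facet j) = 0) :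
    ∑ K, ∑ j, α K j * I ((T K).facet j) = 0 := by
  classical
  rw [← Fintype.sum_prod_type' (f := fun K j => α K j * I ((T K).facet j))]
  have hex : ∀ p : ι × FacetIdx (m + 1) sh, ∃ q : ι × FacetIdx (m + 1) sh,
      if (T p.1).facet p.2 ⊆ frontier Ω then q = p else IsShared Ω T p.1 p.2 q.1 q.2 := by
    intro p
    by_cases h : (T p.1).facet p.2 ⊆ frontier Ω
    · exact ⟨p, by rw [if_pos h]⟩
    · obtain ⟨K', j', hs⟩ := hM.exists_isShared h
      exact ⟨(K', j'), by rw [if_neg h]; exact hs⟩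
  choose σ hσ using hex
  have hσb : ∀ p, (T p.1).facet p.2 ⊆ frontier Ω → σ p = p := fun p h => by
    have := hσ p; rwa [if_pos h] at this
  have hσi : ∀ p, ¬ (T p.1).facet p.2 ⊆ frontier Ω → IsShared Ω T p.1 p.2 (σ p).1 (σ p).2 :=
    fun p h => by have := hσ p; rwa [if_neg h] at this
  refine Finset.sum_involution (fun p _ => σ p) ?_ ?_ (fun _ _ => Finset.mem_univ _) ?_
  · intro p _
    by_cases h : (T p.1).facet p.2 ⊆ frontier Ω
    · rw [hσb p h, hI _ _ h]; simp
    · rw [hα _ _ _ _ (hσi p h), (hσi p h).facet_eq]; ring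
  · intro p _ hne heq
    by_cases h : (T p.1).facet p.2 ⊆ frontier Ω
    · rw [hI _ _ h, mul_zero] at hne; exact hne rfl
    · exact (hσi p h).ne (congrArg Prod.fst heq)
  · intro p _
    by_cases h : (T p.1).facet p.2 ⊆ frontier Ω
    · rw [hσb p h, hσb p h]
    · have h1 := hσi p h
      have h2 := hσi (σ p) h1.symm.not_subset
      have := hM.isShared_unique h1.symm h2
      exact Prod.ext this.1 this.2

/-- Fluxes with prescribed value on an interior facet, matched on its other side. -/
theorem IsMesh.exists_balanced_single (hM : IsMesh Ω T) (h : IsShared Ω T K j K' j') (c : ℝ) :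
    ∃ α : ι → FacetIdx (m + 1) sh → ℝ, Balanced Ω T α ∧ α K j = c ∧ α K' j' = -c ∧
      ∀ L i, ¬ (L = K ∧ i = j) → ¬ (L = K' ∧ i = j') → α L i = 0 := by
  classical
  let α : ι → FacetIdx (m + 1) sh → ℝ := fun L i =>
    if L = K ∧ i = j then c else if L = K' ∧ i = j' then -c else 0
  have h1 : α K j = c := by simp [α]
  have h2 : α K' j' = -c := by
    simp only [α]
    rw [if_neg fun e => h.ne e.1]; simp
  have h3 : ∀ L i, ¬ (L = K ∧ i = j) → ¬ (L = K' ∧ i = j') → α L i = 0 := fun L i e e' => by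
    simp only [α]
    rw [if_neg e, if_neg e']
  refine ⟨α, ?_, h1, h2, h3⟩
  intro L i L' i' hs
  by_cases e : L = K ∧ i = j
  · obtain ⟨rfl, rfl⟩ := e
    obtain ⟨rfl, rfl⟩ := hM.isShared_unique h hs
    rw [h1, h2]
  by_cases e' : L = K' ∧ i = j'
  · obtain ⟨rfl, rfl⟩ := e'
    obtain ⟨rfl, rfl⟩ := hM.isShared_unique h.symm hs
    rw [h1, h2, neg_neg]
  rw [h3 L i e e', neg_zero]
  apply h3
  · rintro ⟨rfl, rfl⟩
    exact e' (hM.isShared_unique h hs.symm)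
  · rintro ⟨rfl, rfl⟩
    exact e (hM.isShared_unique h.symm hs.symm)

/-! ### Integration over the domain, cell by cell -/

theorem IsMesh.pairwise_disjoint (hM : IsMesh Ω T) :
    Pairwise (Function.onFun Disjoint fun K => (T K).int) :=
  fun K K' h => hM.disjoint K K' h

/-- The open cells miss only points on boundaries of finitely many convex cells, a null set. -/
theorem IsMesh.ae_eq_iUnion [Finite ι] (hM : IsMesh Ω T) :
    Ω =ᵐ[volume] ⋃ K, (T K).int := by
  have h1 : (⋃ K, (T K).int) ⊆ Ω := iUnion_subset hM.int_subset
  refine (ae_eq_set.2 ⟨?_, by rw [sdiff_eq_empty.2 h1, measure_empty]⟩)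
  refine measure_mono_null (t := ⋃ K, frontier (T K).carrier) ?_
    (measure_iUnion_null fun K => (T K).isPolytope.volume_frontier)
  rintro x ⟨hx, hx'⟩
  obtain ⟨K, hK⟩ := mem_iUnion.1 (hM.cover hx)
  refine mem_iUnion.2 ⟨K, subset_closure hK, fun h => hx' (mem_iUnion.2 ⟨K, h⟩)⟩

theorem IsMesh.restrict_eq [Finite ι] (hM : IsMesh Ω T) :
    volume.restrict Ω = volume.restrict (⋃ K, (T K).int) :=
  Measure.restrict_congr_set hM.ae_eq_iUnion

theorem IsMesh.ae_iff [Finite ι] (hM : IsMesh Ω T) {p : E (m + 1) → Prop} :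
    (∀ᵐ x ∂(volume.restrict Ω), p x) ↔ ∀ K, ∀ᵐ x ∂(volume.restrict (T K).int), p x := by
  rw [hM.restrict_eq, ae_restrict_iUnion_iff]

theorem IsMesh.integral_eq_sum [Fintype ι] (hM : IsMesh Ω T) {f : E (m + 1) → ℝ}
    (hf : ∀ K, IntegrableOn f (T K).int) :
    ∫ x in Ω, f x = ∑ K, ∫ x in (T K).int, f x := by
  rw [hM.restrict_eq, integral_iUnion_fintype (fun K => (T K).isOpen_int.measurableSet)
    hM.pairwise_disjoint hf]

/-- The field that equals `v K` on each open cell `K`. -/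
def glue [Fintype ι] (T : ι → Cell (m + 1) sh) {F : Type*} [AddCommMonoid F]
    (v : ι → E (m + 1) → F) (x : E (m + 1)) : F :=
  ∑ K, (T K).int.indicator (v K) x

theorem IsMesh.glue_eq [Fintype ι] (hM : IsMesh Ω T) {F : Type*} [AddCommMonoid F]
    (v : ι → E (m + 1) → F) (K : ι) {x : E (m + 1)} (hx : x ∈ (T K).int) :
    glue T v x = v K x := by
  rw [glue, Finset.sum_eq_single K]
  · exact indicator_of_mem hx _
  · intro L _ hL
    exact indicator_of_notMem (fun h => Set.disjoint_left.1 (hM.disjoint L K hL) h hx) _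
  · intro h; exact absurd (Finset.mem_univ K) h

theorem IsMesh.glue_ae_eq [Fintype ι] (hM : IsMesh Ω T) {F : Type*} [AddCommMonoid F]
    (v : ι → E (m + 1) → F) (K : ι) : glue T v =ᵐ[volume.restrict (T K).int] v K := by
  filter_upwards [ae_restrict_mem (T K).isOpen_int.measurableSet] with x hx
  exact hM.glue_eq v K hx

theorem memLp_glue [Fintype ι] (T : ι → Cell (m + 1) sh) (Ω : Set (E (m + 1)))
    {F : Type*} [NormedAddCommGroup F] {v : ι → E (m + 1) → F}
    (hv : ∀ K, MemLp (v K) 2 (volume.restrict (T K).int)) :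
    MemLp (glue T v) 2 (volume.restrict Ω) :=
  MemLp.restrict _ (memLp_finsetSum _ fun K _ =>
    (memLp_indicator_iff_restrict (T K).isOpen_int.measurableSet).2 (hv K))

/-! ### Piecewise fields in `H(div)` -/

theorem IsMesh.sum_green [Fintype ι] (hM : IsMesh Ω T) {V : E (m + 1) → E (m + 1)}
    {g : E (m + 1) → ℝ} {α : ι → FacetIdx (m + 1) sh → ℝ}
    (h : ∀ K, HasFluxes (T K) V g (α K)) {w : E (m + 1) → ℝ} (hw : ContDiff ℝ ∞ w)
    (hs : HasCompactSupport w) :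
    (∫ x in Ω, inner ℝ (V x) (∇ w x)) + ∫ x in Ω, g x * w x =
      ∑ K, ∑ j, α K j * ∫ x in (T K).facet j, w x ∂(Measure.euclideanHausdorffMeasure m) := by
  rw [hM.integral_eq_sum fun K => integrable_inner_gradient (h K).memLp hw hs,
    hM.integral_eq_sum fun K => integrable_mul_test (h K).memLp_div hw hs,
    ← Finset.sum_add_distrib]
  exact Finset.sum_congr rfl fun K _ => (h K).green w hw hs

/-- In the sum of the cellwise Green formulas, interior facets cancel by matching, and on boundary
facets the test function is zero because its support lies in the open set `Ω`. The glued local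
divergences are therefore a weak divergence. -/
theorem IsMesh.memHdiv_of_balanced [Fintype ι] (hM : IsMesh Ω T) (hΩ : IsOpen Ω)
    {V : E (m + 1) → E (m + 1)} (hV : MemLp V 2 (volume.restrict Ω)) {g : ι → E (m + 1) → ℝ}
    {α : ι → FacetIdx (m + 1) sh → ℝ} (h : ∀ K, HasFluxes (T K) V (g K) (α K))
    (hα : Balanced Ω T α) : MemHdiv Ω V := by
  refine ⟨hV, glue T g, memLp_glue T Ω fun K => (h K).memLp_div, fun w hw hs hsub => ?_⟩
  have h1 := hM.sum_green (fun K => (h K).congr (ae_eq_refl V) (hM.glue_ae_eq g K).symm) hw hs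
  rw [hM.sum_flux_eq_zero hα fun F => ∫ x in F, w x ∂(Measure.euclideanHausdorffMeasure m)] at h1
  · linarith
  · intro K j hF
    refine setIntegral_eq_zero_of_forall_eq_zero fun x hx => ?_
    refine image_eq_zero_of_notMem_tsupport fun hxw => ?_
    have := hF hx
    rw [hΩ.frontier_eq] at this
    exact this.2 (hsub hxw)

theorem IsMesh.subset_closure (hM : IsMesh Ω T) (K : ι) : (T K).carrier ⊆ closure Ω :=
  (T K).isPolytope.subset_closure_interior.trans (closure_mono (hM.int_subset K))

/-- An interior facet has points of its relative interior in `Ω`. -/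
theorem IsMesh.exists_isRelint_mem (hM : IsMesh Ω T) (hΩ : IsOpen Ω)
    (h : IsShared Ω T K j K' j') :
    ∃ x ∈ Ω, (T K).IsRelint j x ∧ (T K').IsRelint j' x := by
  obtain ⟨x, hxF, hxΩ⟩ := not_subset.1 h.not_subset
  have hx : x ∈ Ω := by
    by_contra hx
    refine hxΩ ?_
    rw [hΩ.frontier_eq]
    exact ⟨hM.subset_closure K ((T K).isPolytope.facet_subset j hxF), hx⟩
  obtain ⟨z, hz, hz'⟩ := h.exists_isRelint
  -- The point `x` of the facet in `Ω` may lie on its relative boundary; a short move towards the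
  -- relatively interior point `z` corrects this without leaving `Ω`.
  have hlim : Tendsto (fun t : ℝ => (1 - t) • x + t • z) (nhdsWithin 0 (Ioi 0)) (nhds x) := by
    have : Continuous fun t : ℝ => (1 - t) • x + t • z := by fun_prop
    simpa using (this.tendsto 0).mono_left nhdsWithin_le_nhds
  obtain ⟨t, ⟨htΩ, ht1⟩, ht⟩ := (((hlim.eventually (hΩ.mem_nhds hx)).and
    (nhdsWithin_le_nhds (gt_mem_nhds one_pos))).and self_mem_nhdsWithin).exists
  have ht0 : 0 < t := ht
  have ht1' : t < 1 := ht1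
  have key : ∀ (L : ι) (l : FacetIdx (m + 1) sh), x ∈ (T L).facet l → (T L).IsRelint l z →
      (T L).IsRelint l ((1 - t) • x + t • z) := by
    intro L l hxL hzL
    refine ⟨?_, fun i hi => ?_⟩
    · rw [inner_add_right, inner_smul_right, inner_smul_right, hzL.1,
        (T L).isPolytope.facet_subset_hyperplane l hxL]
      ring
    · rw [inner_add_right, inner_smul_right, inner_smul_right]
      have h1 := hzL.2 i hi
      have h2 := ((T L).isPolytope.mem_iff x).1 ((T L).isPolytope.facet_subset l hxL) i
      nlinarith
  exact ⟨_, htΩ, key K j hxF hz, key K' j' (h.facet_eq ▸ hxF) hz'⟩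

/-- A bump function around a relatively interior point of the facet, supported in `Ω` and away from
all other facets, reduces the summed Green formula to `α K j + α K' j' = 0` times a positive
integral. -/
theorem IsMesh.balanced_of_memHdiv [Fintype ι] (hM : IsMesh Ω T) (hΩ : IsOpen Ω)
    {V : E (m + 1) → E (m + 1)} (hV : MemHdiv Ω V) {g : ι → E (m + 1) → ℝ}
    {α : ι → FacetIdx (m + 1) sh → ℝ} (h : ∀ K, HasFluxes (T K) V (g K) (α K)) :
    Balanced Ω T α := by
  classical
  intro K j K' j' hs
  obtain ⟨G, hG⟩ := hV.2
  -- By uniqueness of weak divergences, the local ones are restrictions of the global one.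
  have hfl : ∀ L, HasFluxes (T L) V G (α L) := fun L => (h L).congr (ae_eq_refl V)
    (HasWeakDiv.ae_eq (T L).isOpen_int (h L).hasWeakDiv
      (hG.mono hΩ.measurableSet (hM.int_subset L)))
  obtain ⟨x, hxΩ, hx, hx'⟩ := hM.exists_isRelint_mem hΩ hs
  let A : Set (E (m + 1)) := Ω ∩ ⋂ (p : ι × FacetIdx (m + 1) sh),
    {y | ¬ (p.1 = K ∧ p.2 = j) → ¬ (p.1 = K' ∧ p.2 = j') → y ∉ (T p.1).facet p.2}
  have hA : IsOpen A := by
    refine hΩ.inter (isOpen_iInter_of_finite fun p => ?_)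
    by_cases h1 : p.1 = K ∧ p.2 = j
    · simp [h1]
    by_cases h2 : p.1 = K' ∧ p.2 = j'
    · simp [h2]
    · simp only [h1, h2, not_false_eq_true, forall_const]
      exact ((T p.1).isPolytope.isClosed_facet p.2).isOpen_compl
  have hxA : x ∈ A := by
    refine ⟨hxΩ, mem_iInter.2 fun p h1 h2 hp => ?_⟩
    rcases hM.eq_or_eq_of_mem_facet hs hx hx' hp with e | e
    · exact h1 e
    · exact h2 e
  obtain ⟨w, hwA, hws, hw, hwr, hwx⟩ := exists_contDiff_tsupport_subset (n := ⊤)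
    (hA.mem_nhds hxA)
  have hw' : ContDiff ℝ ∞ w := hw
  have hzero : ∀ L i, ¬ (L = K ∧ i = j) → ¬ (L = K' ∧ i = j') →
      ∫ y in (T L).facet i, w y ∂(Measure.euclideanHausdorffMeasure m) = 0 := by
    intro L i h1 h2
    refine setIntegral_eq_zero_of_forall_eq_zero fun y hy => ?_
    refine image_eq_zero_of_notMem_tsupport fun hyw => ?_
    exact mem_iInter.1 (hwA hyw).2 (L, i) h1 h2 hy
  have hpos : 0 < ∫ y in (T K).facet j, w y ∂(Measure.euclideanHausdorffMeasure m) := by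
    have hw0 : ∀ y, 0 ≤ w y := fun y => (hwr ⟨y, rfl⟩).1
    rw [setIntegral_pos_iff_support_of_nonneg_ae (Eventually.of_forall hw0)
      ((T K).isPolytope.integrableOn_facet j hw'.continuous), inter_comm]
    refine (T K).isPolytope.measure_facet_inter_pos hx.1 hx.2 ?_ (by simp [hwx])
    exact hw'.continuous.isOpen_support
  have h1 := hM.sum_green hfl hw' hws
  rw [hG.2 w hw' hws (hwA.trans inter_subset_left), neg_add_cancel,
    ← Fintype.sum_prod_type' (f := fun K j => α K j * ∫ x in (T K).facet j, w x
      ∂(Measure.euclideanHausdorffMeasure m))] at h1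
  rw [← Finset.sum_subset (Finset.subset_univ {(K, j), (K', j')}) fun p _ hp => ?_,
    Finset.sum_pair (fun e => hs.ne (congrArg Prod.fst e).symm)] at h1
  · simp only at h1
    rw [hs.facet_eq, ← add_mul] at h1
    have := (mul_eq_zero.1 h1.symm).resolve_right hpos.ne'
    linarith
  · rw [hzero, mul_zero]
    · intro e; exact hp (by simp [Prod.ext_iff, e])
    · intro e; exact hp (by simp [Prod.ext_iff, e])

end Mesh

/-! ### Piecewise spans as images of coefficient spaces -/

section CellMap

variable {m : ℕ} {sh : MeshShape} {ι : Type} [Fintype ι] {Ω : Set (E (m + 1))}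
  {T : ι → Cell (m + 1) sh} {J : Type*} [Fintype J] {F : Type*} [NormedAddCommGroup F]
  [NormedSpace ℝ F]

theorem IsMesh.lp_ext (hM : IsMesh Ω T) {u v : Lp F 2 (volume.restrict Ω)}
    (h : ∀ K, u =ᵐ[volume.restrict (T K).int] v) : u = v :=
  Lp.ext (hM.ae_iff.2 h)

theorem IsMesh.ae_int (hM : IsMesh Ω T) (K : ι) {p : E (m + 1) → Prop}
    (h : ∀ᵐ x ∂(volume.restrict Ω), p x) : ∀ᵐ x ∂(volume.restrict (T K).int), p x :=
  hM.ae_iff.1 h K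

theorem memLp_comb {β : ι → J → E (m + 1) → F}
    (hβ : ∀ K j, MemLp (β K j) 2 (volume.restrict (T K).int)) (a : ι → J → ℝ) (K : ι) :
    MemLp (fun x => ∑ j, a K j • β K j x) 2 (volume.restrict (T K).int) :=
  memLp_finsetSum _ fun j _ => (hβ K j).const_smul (a K j)

/-- The function that is the combination of the local functions `β K j` with the coefficients
`a K j` on each cell `K`. -/
def cellMap (hM : IsMesh Ω T) (β : ι → J → E (m + 1) → F)
    (hβ : ∀ K j, MemLp (β K j) 2 (volume.restrict (T K).int)) :
    (ι → J → ℝ) →ₗ[ℝ] Lp F 2 (volume.restrict Ω) where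
  toFun a := (memLp_glue T Ω (memLp_comb hβ a)).toLp _
  map_add' a b := by
    refine hM.lp_ext fun K => ?_
    filter_upwards [hM.ae_int K (MemLp.coeFn_toLp (memLp_glue T Ω (memLp_comb hβ (a + b)))),
      hM.ae_int K (MemLp.coeFn_toLp (memLp_glue T Ω (memLp_comb hβ a))),
      hM.ae_int K (MemLp.coeFn_toLp (memLp_glue T Ω (memLp_comb hβ b))),
      hM.ae_int K (Lp.coeFn_add ((memLp_glue T Ω (memLp_comb hβ a)).toLp _)
        ((memLp_glue T Ω (memLp_comb hβ b)).toLp _)),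
      ae_restrict_mem (T K).isOpen_int.measurableSet] with x h1 h2 h3 h4 hx
    rw [h4, Pi.add_apply, h1, h2, h3, hM.glue_eq _ K hx, hM.glue_eq _ K hx, hM.glue_eq _ K hx,
      ← Finset.sum_add_distrib]
    simp only [Pi.add_apply, add_smul]
  map_smul' c a := by
    refine hM.lp_ext fun K => ?_
    filter_upwards [hM.ae_int K (MemLp.coeFn_toLp (memLp_glue T Ω (memLp_comb hβ (c • a)))),
      hM.ae_int K (MemLp.coeFn_toLp (memLp_glue T Ω (memLp_comb hβ a))),
      hM.ae_int K (Lp.coeFn_smul c ((memLp_glue T Ω (memLp_comb hβ a)).toLp _)),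
      ae_restrict_mem (T K).isOpen_int.measurableSet] with x h1 h2 h4 hx
    rw [RingHom.id_apply, h4, Pi.smul_apply, h1, h2, hM.glue_eq _ K hx, hM.glue_eq _ K hx,
      Finset.smul_sum]
    simp only [Pi.smul_apply, smul_assoc]

theorem cellMap_ae_eq (hM : IsMesh Ω T) (β : ι → J → E (m + 1) → F)
    (hβ : ∀ K j, MemLp (β K j) 2 (volume.restrict (T K).int)) (a : ι → J → ℝ) (K : ι) :
    cellMap hM β hβ a =ᵐ[volume.restrict (T K).int] fun x => ∑ j, a K j • β K j x := by
  filter_upwards [hM.ae_int K (MemLp.coeFn_toLp (memLp_glue T Ω (memLp_comb hβ a))),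
    hM.glue_ae_eq (fun K x => ∑ j, a K j • β K j x) K] with x h1 h2
  exact h1.trans h2

theorem eq_cellMap_iff (hM : IsMesh Ω T) (β : ι → J → E (m + 1) → F)
    (hβ : ∀ K j, MemLp (β K j) 2 (volume.restrict (T K).int)) (u : Lp F 2 (volume.restrict Ω)) :
    (∃ a, u = cellMap hM β hβ a) ↔ ∀ K, ∃ a : J → ℝ,
      u =ᵐ[volume.restrict (T K).int] fun x => ∑ j, a j • β K j x := by
  constructor
  · rintro ⟨a, rfl⟩ K
    exact ⟨a K, cellMap_ae_eq hM β hβ a K⟩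
  · intro h
    choose a ha using h
    exact ⟨a, hM.lp_ext fun K => (ha K).trans (cellMap_ae_eq hM β hβ a K).symm⟩

end CellMap

namespace OSData

variable {m : ℕ} {sh : MeshShape} {ι : Type} {P : OSData (m + 1) sh ι}

theorem locallyInSpan_iff (K : ι) (b : FacetIdx (m + 1) sh → E (m + 1) → E (m + 1))
    (v : E (m + 1) → E (m + 1)) : P.LocallyInSpan K b v ↔ ∃ a : FacetIdx (m + 1) sh → ℝ,
      v =ᵐ[volume.restrict (P.T K).int] fun x => ∑ j, a j • b j x := by
  have hfun : ∀ a : FacetIdx (m + 1) sh → ℝ, ∑ j, a j • b j = fun x => ∑ j, a j • b j x :=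
    fun a => by ext1 x; simp
  constructor
  · rintro ⟨w, hw, hv⟩
    obtain ⟨a, rfl⟩ := (Submodule.mem_span_range_iff_exists_fun ℝ).1 hw
    exact ⟨a, hfun a ▸ hv⟩
  · rintro ⟨a, ha⟩
    exact ⟨_, (Submodule.mem_span_range_iff_exists_fun ℝ).2 ⟨a, hfun a⟩, ha⟩

/-! ### The multiscale basis functions on a cell -/

theorem IsAdmissible.int_subset (hP : P.IsAdmissible) (K : ι) : (P.T K).int ⊆ (P.S K).int :=
  interior_mono (hP.subset_block K)

theorem IsAdmissible.restrict_le (hP : P.IsAdmissible) (K : ι) :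
    volume.restrict (P.T K).int ≤ volume.restrict (P.S K).int :=
  Measure.restrict_mono (hP.int_subset K) le_rfl

theorem IsAdmissible.memLp_psiBar (hP : P.IsAdmissible) (K : ι) (j : FacetIdx (m + 1) sh) :
    MemLp (P.psiBar K j) 2 (volume.restrict (P.T K).int) :=
  memLp_finsetSum _ fun l _ =>
    (((hP.solvesS K l).psi_mem.1.mono_measure (hP.restrict_le K)).const_smul (P.c K j l))

theorem IsAdmissible.memLp_etaBar (hP : P.IsAdmissible) (K : ι) (j : FacetIdx (m + 1) sh) :
    MemLp (P.etaBar K j) 2 (volume.restrict (P.T K).int) :=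
  memLp_finsetSum _ fun l _ =>
    (((hP.solvesS K l).eta_mem.mono_measure (hP.restrict_le K)).const_smul (P.c K j l))

/-- The law `ψ + k η = 0` on the block is pointwise linear, so it survives restriction to `K` and
combination with the constants `c`. It is what eliminates the gradient unknown. -/
theorem IsAdmissible.psiBar_eq (hP : P.IsAdmissible) (K : ι) :
    ∀ᵐ x ∂(volume.restrict (P.T K).int), ∀ j,
      P.psiBar K j x = -Matrix.toEuclideanLin (P.k x) (P.etaBar K j x) := by
  have h1 : ∀ l, ∀ᵐ x ∂(volume.restrict (P.T K).int),
      P.ψS K l x + mulField P.k (P.ηS K l) x = 0 := fun l =>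
    ae_mono (hP.restrict_le K) (hP.solvesS K l).flux
  filter_upwards [ae_all_iff.2 h1] with x hx j
  simp only [psiBar, etaBar, map_sum, map_smul, ← Finset.sum_neg_distrib, ← smul_neg]
  refine Finset.sum_congr rfl fun l _ => ?_
  rw [eq_neg_of_add_eq_zero_left (hx l)]
  rfl

theorem divergence_sum {d : ℕ} {J : Type*} (s : Finset J) (a : J → ℝ) {v : J → E d → E d}
    {x : E d} (hv : ∀ j ∈ s, DifferentiableAt ℝ (v j) x) :
    divergence (fun x => ∑ j ∈ s, a j • v j x) x = ∑ j ∈ s, a j * divergence (v j) x := by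
  have h : HasFDerivAt (fun x => ∑ j ∈ s, a j • v j x) (∑ j ∈ s, a j • fderiv ℝ (v j) x) x :=
    HasFDerivAt.fun_sum fun j hj => (hv j hj).hasFDerivAt.const_smul (a j)
  simp only [divergence, h.fderiv, Finset.mul_sum]
  rw [Finset.sum_comm]
  refine Finset.sum_congr rfl fun i _ => ?_
  simp

/-- Divergences restrict from the block to the cell, unlike the boundary condition, which is imposed
on the boundary of the block. Fluxes on the cell are therefore read off `M_h`, not off `ψ̄`. -/
theorem IsAdmissible.hasWeakDiv_psiBar (hP : P.IsAdmissible) (K : ι)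
    (j : FacetIdx (m + 1) sh) :
    HasWeakDiv (P.T K).int (P.psiBar K j) (divergence (P.χ K j)) := by
  have h1 : HasWeakDiv (P.T K).int (P.psiBar K j)
      (fun x => ∑ l, P.c K j l * divergence (P.χS K l) x) :=
    HasWeakDiv.sum Finset.univ (P.c K j)
      (fun l _ => (hP.solvesS K l).psi_mem.1.mono_measure (hP.restrict_le K))
      (fun l _ => (hP.solvesS K l).div_eq.mono (P.S K).isOpen_int.measurableSet (hP.int_subset K))
  refine h1.congr (ae_eq_refl _) ?_
  filter_upwards [ae_restrict_mem (P.T K).isOpen_int.measurableSet] with x hx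
  rw [← divergence_sum Finset.univ (P.c K j) fun l _ =>
    (contDiff_of_mem_RT0 (basis_mem_RT0 (hP.basisS K) l)).differentiable (by simp) x]
  have h2 : P.χ K j =ᶠ[nhds x] fun x => ∑ l, P.c K j l • P.χS K l x := by
    filter_upwards [(P.T K).isOpen_int.mem_nhds hx] with y hy
    exact hP.coef K j y (interior_subset hy)
  simp only [divergence, h2.fderiv_eq]

/-- The fluxes of the Raviart-Thomas field with coefficients
`a` on `K`. -/
def fluxes (P : OSData (m + 1) sh ι) :
    (ι → FacetIdx (m + 1) sh → ℝ) →ₗ[ℝ] (ι → FacetIdx (m + 1) sh → ℝ) :=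
  LinearMap.pi fun K => fluxMap (P.T K) (P.χ K) ∘ₗ LinearMap.proj K

theorem fluxes_apply (a : ι → FacetIdx (m + 1) sh → ℝ) (K : ι) :
    P.fluxes a K = fluxMap (P.T K) (P.χ K) (a K) := rfl

theorem IsAdmissible.fluxes_surjective (hP : P.IsAdmissible) : Function.Surjective P.fluxes := by
  intro α
  choose a ha using fun K => fluxMap_surjective (P.T K) (hP.basis K) (α K)
  exact ⟨a, funext fun K => ha K⟩

theorem IsAdmissible.hasFluxes_chi (hP : P.IsAdmissible) (K : ι) (a : FacetIdx (m + 1) sh → ℝ) :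
    HasFluxes (P.T K) (fun x => ∑ j, a j • P.χ K j x)
      (fun x => ∑ j, a j * divergence (P.χ K j) x) (fluxMap (P.T K) (P.χ K) a) := by
  have h := HasFluxes.sum Finset.univ a
    fun j _ => HasFluxes.of_mem_RT0 (P.T K) (basis_mem_RT0 (hP.basis K) j)
  convert h using 1
  funext j
  rw [fluxMap_apply, Cell.flux_sum]

/-- The difference `ψ - χ` has zero divergence and zero normal trace, so `ψ` satisfies the same
Green formula as `χ` and inherits its constant fluxes. -/
theorem IsAdmissible.hasFluxes_psi (hP : P.IsAdmissible) (K : ι) (j : FacetIdx (m + 1) sh) :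
    HasFluxes (P.T K) (P.ψ K j) (divergence (P.χ K j)) fun i => (P.T K).flux i (P.χ K j) := by
  have hχ := HasFluxes.of_mem_RT0 (P.T K) (basis_mem_RT0 (hP.basis K) j)
  have hs := hP.solves K j
  refine ⟨hs.psi_mem.1, hχ.memLp_div, fun w hw hws => ?_⟩
  rw [← hχ.green w hw hws]
  congr 1
  have h1 := hs.bdry.2 w hw hws
  -- The boundary condition involves the chosen divergence `weakDiv` of the difference, which has to
  -- be identified with zero first.
  have h2 : HasWeakDiv (P.T K).int (fun x => P.ψ K j x - P.χ K j x) fun _ => 0 := by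
    refine ⟨MemLp.zero', fun v hv hvs hsub => ?_⟩
    simp only [inner_sub_left, zero_mul, integral_zero, neg_zero]
    rw [integral_sub (integrable_inner_gradient hs.psi_mem.1 hv hvs)
      (integrable_inner_gradient hχ.memLp hv hvs), hs.div_eq.2 v hv hvs hsub,
      hχ.hasWeakDiv.2 v hv hvs hsub, sub_self]
  have h3 : ∫ x in (P.T K).int, weakDiv (P.T K).int (fun x => P.ψ K j x - P.χ K j x) x * w x = 0 :=
    integral_eq_zero_of_ae (by
      filter_upwards [h2.weakDiv_ae_eq (P.T K).isOpen_int] with x hx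
      rw [hx, zero_mul]; rfl)
  rw [h3, add_zero] at h1
  simp only [inner_sub_left] at h1
  rw [integral_sub (integrable_inner_gradient hs.psi_mem.1 hw hws)
      (integrable_inner_gradient hχ.memLp hw hws)] at h1
  exact sub_eq_zero.1 h1

theorem IsAdmissible.hasFluxes_sum_psi (hP : P.IsAdmissible) (K : ι)
    (a : FacetIdx (m + 1) sh → ℝ) :
    HasFluxes (P.T K) (fun x => ∑ j, a j • P.ψ K j x)
      (fun x => ∑ j, a j * divergence (P.χ K j) x) (fluxMap (P.T K) (P.χ K) a) := by
  have h := HasFluxes.sum Finset.univ a fun j _ => hP.hasFluxes_psi K j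
  convert h using 1
  funext j
  rw [fluxMap_apply, Cell.flux_sum]

/-! ### Parametrisation of the discrete spaces by coefficients -/

section Spaces

variable [Fintype ι]

/-- The element of `X̃₂` with given coefficients. -/
def velocity (hP : P.IsAdmissible) : (ι → FacetIdx (m + 1) sh → ℝ) →ₗ[ℝ] P.L2Vec :=
  cellMap hP.mesh P.psiBar hP.memLp_psiBar

/-- The element of `X₁` with given coefficients. -/
def gradientField (hP : P.IsAdmissible) : (ι → FacetIdx (m + 1) sh → ℝ) →ₗ[ℝ] P.L2Vec :=
  cellMap hP.mesh P.etaBar hP.memLp_etaBar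

/-- The element of `Q` with given values. -/
def pressure (hP : P.IsAdmissible) : (ι → Unit → ℝ) →ₗ[ℝ] P.L2 :=
  cellMap hP.mesh (fun _ _ _ => 1) fun K _ => (P.T K).memLp_of_continuous continuous_const

theorem mem_X2Tilde_iff (hP : P.IsAdmissible) (u : P.L2Vec) :
    u ∈ P.X2Tilde ↔ ∃ a, u = velocity hP a := by
  rw [velocity, eq_cellMap_iff]
  exact forall_congr' fun K => locallyInSpan_iff K _ _

theorem mem_X1_iff (hP : P.IsAdmissible) (θ : P.L2Vec) :
    θ ∈ P.X1 ↔ ∃ a, θ = gradientField hP a := by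
  rw [gradientField, eq_cellMap_iff]
  exact forall_congr' fun K => locallyInSpan_iff K _ _

theorem mem_Q_iff (hP : P.IsAdmissible) (q : P.L2) : q ∈ P.Q ↔ ∃ r, q = pressure hP r := by
  rw [pressure, eq_cellMap_iff]
  refine forall_congr' fun K => ⟨?_, ?_⟩
  · rintro ⟨a, ha⟩
    exact ⟨fun _ => a, by filter_upwards [ha] with x hx; simp [hx]⟩
  · rintro ⟨a, ha⟩
    exact ⟨a (), by filter_upwards [ha] with x hx; simp [hx]⟩

theorem velocity_ae_eq (hP : P.IsAdmissible) (a : ι → FacetIdx (m + 1) sh → ℝ) (K : ι) :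
    velocity hP a =ᵐ[volume.restrict (P.T K).int] fun x => ∑ j, a K j • P.psiBar K j x :=
  cellMap_ae_eq _ _ _ a K

theorem gradientField_ae_eq (hP : P.IsAdmissible) (a : ι → FacetIdx (m + 1) sh → ℝ) (K : ι) :
    gradientField hP a =ᵐ[volume.restrict (P.T K).int] fun x => ∑ j, a K j • P.etaBar K j x :=
  cellMap_ae_eq _ _ _ a K

theorem pressure_ae_eq (hP : P.IsAdmissible) (r : ι → Unit → ℝ) (K : ι) :
    pressure hP r =ᵐ[volume.restrict (P.T K).int] fun _ => r K () := by
  refine (cellMap_ae_eq _ _ _ r K).trans (ae_of_all _ fun x => ?_)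
  simp

theorem hasWeakDiv_velocity (hP : P.IsAdmissible) (a : ι → FacetIdx (m + 1) sh → ℝ) (K : ι) :
    HasWeakDiv (P.T K).int (velocity hP a) fun x => ∑ j, a K j * divergence (P.χ K j) x :=
  (HasWeakDiv.sum Finset.univ (a K) (fun j _ => hP.memLp_psiBar K j)
    fun j _ => hP.hasWeakDiv_psiBar K j).congr (velocity_ae_eq hP a K).symm (ae_eq_refl _)

/-- The divergence form in terms of coefficients. -/
theorem brokenDiv_eq (hP : P.IsAdmissible) (r : ι → Unit → ℝ)
    (a : ι → FacetIdx (m + 1) sh → ℝ) :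
    P.brokenDiv (pressure hP r) (velocity hP a) = ∑ K, ∑ j, P.fluxes a K j *
      (r K () * (Measure.euclideanHausdorffMeasure m).real ((P.T K).facet j)) := by
  refine Finset.sum_congr rfl fun K _ => ?_
  have h1 : ∫ x in (P.T K).int, pressure hP r x * weakDiv (P.T K).int (velocity hP a) x =
      ∫ x in (P.T K).int, r K () * ∑ j, a K j * divergence (P.χ K j) x := by
    refine integral_congr_ae ?_
    filter_upwards [pressure_ae_eq hP r K,
      (hasWeakDiv_velocity hP a K).weakDiv_ae_eq (P.T K).isOpen_int] with x hx hx'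
    rw [hx, hx']
  rw [h1, integral_const_mul, (hP.hasFluxes_chi K (a K)).integral_div, Finset.mul_sum]
  refine Finset.sum_congr rfl fun j _ => ?_
  rw [fluxes_apply]
  ring

/-- Independence of the `ψ̄_j` leaves only one possible value for the chosen coefficients. -/
theorem coeff_eq (hψ : P.PsiBarIndependent) {K : ι} {u : E (m + 1) → E (m + 1)}
    {a : FacetIdx (m + 1) sh → ℝ}
    (h : u =ᵐ[volume.restrict (P.T K).int] fun x => ∑ j, a j • P.psiBar K j x) :
    P.coeff K u = a := by
  have h1 := Classical.epsilon_spec (p := fun a : FacetIdx (m + 1) sh → ℝ =>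
    ∀ᵐ x ∂(volume.restrict (P.T K).int), u x = ∑ j, a j • P.psiBar K j x) ⟨a, h⟩
  refine sub_eq_zero.1 (hψ K _ ?_)
  filter_upwards [h, h1] with x hx hx'
  simp only [Pi.sub_apply, sub_smul, Finset.sum_sub_distrib]
  rw [← hx, sub_eq_zero]
  exact hx'.symm

theorem mhLocal_velocity (hP : P.IsAdmissible) (hψ : P.PsiBarIndependent)
    (a : ι → FacetIdx (m + 1) sh → ℝ) (K : ι) :
    P.MhLocal K (velocity hP a) = fun x => ∑ j, a K j • P.χ K j x := by
  funext x
  rw [MhLocal, coeff_eq hψ (velocity_ae_eq hP a K)]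

/-- The jump form in terms of fluxes. -/
theorem C_velocity (hP : P.IsAdmissible) (hψ : P.PsiBarIndependent)
    (a : ι → FacetIdx (m + 1) sh → ℝ) (π : E (m + 1) → ℝ) :
    P.C (velocity hP a) π = ∑ K, ∑ j, P.fluxes a K j *
      ∫ x in (P.T K).facet j, π x ∂(Measure.euclideanHausdorffMeasure m) := by
  refine Finset.sum_congr rfl fun K _ => Finset.sum_congr rfl fun j _ => ?_
  rw [← integral_const_mul, mhLocal_velocity hP hψ]
  refine setIntegral_congr_fun ((P.T K).isPolytope.measurableSet_facet j) fun x hx => ?_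
  rw [(P.T K).inner_eq_flux (sum_mem_RT0 (hP.basis K) (a K)) j
    ((P.T K).isPolytope.facet_subset_hyperplane j hx), fluxes_apply, fluxMap_apply]

/-- Membership in `X₂` means that the fluxes match across interior facets. -/
theorem velocity_mem_X2_iff (hP : P.IsAdmissible) (hψ : P.PsiBarIndependent)
    (a : ι → FacetIdx (m + 1) sh → ℝ) :
    velocity hP a ∈ P.X2 ↔ Balanced P.Ω P.T (P.fluxes a) := by
  have hMh : P.Mh (velocity hP a) = glue P.T fun K x => ∑ j, a K j • P.χ K j x := by
    funext x
    rw [Mh, glue]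
    exact Finset.sum_congr rfl fun K _ => by rw [mhLocal_velocity hP hψ]
  have hfl : ∀ K, HasFluxes (P.T K) (P.Mh (velocity hP a))
      (fun x => ∑ j, a K j * divergence (P.χ K j) x) (P.fluxes a K) := fun K => by
    rw [hMh]
    exact (hP.hasFluxes_chi K (a K)).congr
      (hP.mesh.glue_ae_eq (fun K x => ∑ j, a K j • P.χ K j x) K).symm (ae_eq_refl _)
  constructor
  · rintro ⟨-, hV, -⟩
    exact hP.mesh.balanced_of_memHdiv hP.isOpen hV hfl
  · intro hα
    refine ⟨(mem_X2Tilde_iff hP _).2 ⟨a, rfl⟩,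
      hP.mesh.memHdiv_of_balanced hP.isOpen ?_ hfl hα, fun K => ?_⟩
    · rw [hMh]
      exact memLp_glue _ _ fun K => (hP.hasFluxes_chi K (a K)).memLp
    · refine ⟨_, sum_mem_RT0 (hP.basis K) (a K), ?_⟩
      rw [hMh]
      exact hP.mesh.glue_ae_eq (fun K x => ∑ j, a K j • P.χ K j x) K

end Spaces

end OSData

namespace OSData

variable {m : ℕ} {sh : MeshShape} {ι : Type} {P : OSData (m + 1) sh ι}

/-! ### The Lagrange multipliers are the functions that are constant on each interior facet -/

theorem facet_subset_skeleton (K : ι) (j : FacetIdx (m + 1) sh) :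
    (P.T K).facet j ⊆ skeleton P.T :=
  subset_iUnion₂ (s := fun K j => (P.T K).facet j) K j

theorem restrict_facet_le (K : ι) (j : FacetIdx (m + 1) sh) :
    (Measure.euclideanHausdorffMeasure m).restrict ((P.T K).facet j) ≤
      (Measure.euclideanHausdorffMeasure m).restrict (skeleton P.T) :=
  Measure.restrict_mono (facet_subset_skeleton K j) le_rfl

theorem isFiniteMeasure_facet (K : ι) (j : FacetIdx (m + 1) sh) :
    IsFiniteMeasure ((Measure.euclideanHausdorffMeasure m).restrict ((P.T K).facet j)) :=
  ⟨by rw [Measure.restrict_apply_univ]; exact (P.T K).isPolytope.measure_facet_lt_top j⟩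

theorem memLp_facet (π : P.L2Skeleton) (K : ι) (j : FacetIdx (m + 1) sh) :
    MemLp π 2 ((Measure.euclideanHausdorffMeasure m).restrict ((P.T K).facet j)) :=
  (Lp.memLp π).mono_measure (restrict_facet_le K j)

theorem integrable_facet (π : P.L2Skeleton) (K : ι) (j : FacetIdx (m + 1) sh) :
    IntegrableOn π ((P.T K).facet j) (Measure.euclideanHausdorffMeasure m) := by
  have := isFiniteMeasure_facet (P := P) K j
  exact (memLp_facet π K j).integrable (by norm_num)

theorem ae_skeleton_iff [Finite ι] {p : E (m + 1) → Prop} :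
    (∀ᵐ x ∂((Measure.euclideanHausdorffMeasure m).restrict (skeleton P.T)), p x) ↔
      ∀ K j, ∀ᵐ x ∂((Measure.euclideanHausdorffMeasure m).restrict ((P.T K).facet j)), p x := by
  rw [skeleton]
  simp only [ae_restrict_iUnion_iff]

/-- Against test functions vanishing on the other facets, Green's formula sees only `α j`. Those
supported off the other facets already determine `π` almost everywhere on facet `j`, since the other
facets meet it in a null set. -/
theorem isNormalTrace_iff {K : ι} {j : FacetIdx (m + 1) sh} {V : E (m + 1) → E (m + 1)}
    {g : E (m + 1) → ℝ} {α : FacetIdx (m + 1) sh → ℝ} (h : HasFluxes (P.T K) V g α)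
    (π : P.L2Skeleton) : P.IsNormalTrace K j V π ↔
      ∀ᵐ x ∂((Measure.euclideanHausdorffMeasure m).restrict ((P.T K).facet j)), π x = α j := by
  have hgreen : ∀ w : E (m + 1) → ℝ, ContDiff ℝ ∞ w → HasCompactSupport w →
      (∀ i, i ≠ j → ∀ x ∈ (P.T K).facet i, w x = 0) →
      (∫ x in (P.T K).int, inner ℝ (V x) (∇ w x)) +
        ∫ x in (P.T K).int, weakDiv (P.T K).int V x * w x =
      α j * ∫ x in (P.T K).facet j, w x ∂(Measure.euclideanHausdorffMeasure m) := by
    intro w hw hs hz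
    have h1 : ∫ x in (P.T K).int, weakDiv (P.T K).int V x * w x =
        ∫ x in (P.T K).int, g x * w x :=
      integral_congr_ae (by filter_upwards [h.weakDiv_ae_eq] with x hx; rw [hx])
    rw [h1, h.green w hw hs, Finset.sum_eq_single j]
    · intro i _ hi
      rw [setIntegral_eq_zero_of_forall_eq_zero (hz i hi), mul_zero]
    · intro hj; exact absurd (Finset.mem_univ j) hj
  have hfin := isFiniteMeasure_facet (P := P) K j
  constructor
  · intro htr
    have hint : Integrable (fun x => π x - α j)
        ((Measure.euclideanHausdorffMeasure m).restrict ((P.T K).facet j)) :=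
      (integrable_facet π K j).sub (integrable_const _)
    have hU : IsOpen (⋂ i, {x | i ≠ j → x ∉ (P.T K).facet i}) := by
      refine isOpen_iInter_of_finite fun i => ?_
      by_cases hi : i = j
      · simp [hi]
      · simp only [Ne, hi, not_false_eq_true, forall_const]
        exact ((P.T K).isPolytope.isClosed_facet i).isOpen_compl
    have key := hU.ae_eq_zero_of_integral_contDiff_smul_eq_zero
      (μ := (Measure.euclideanHausdorffMeasure m).restrict ((P.T K).facet j))
      (f := fun x => π x - α j) (hint.locallyIntegrable.locallyIntegrableOn _)
      (fun w hw hs hsub => by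
        have hz : ∀ i, i ≠ j → ∀ x ∈ (P.T K).facet i, w x = 0 := fun i hi x hx =>
          image_eq_zero_of_notMem_tsupport fun hxw => mem_iInter.1 (hsub hxw) i hi hx
        have h1 := hgreen w hw hs hz
        have h2 : (∫ x in (P.T K).int, inner ℝ (V x) (∇ w x)) +
            ∫ x in (P.T K).int, weakDiv (P.T K).int V x * w x =
            ∫ x in (P.T K).facet j, π x * w x ∂(Measure.euclideanHausdorffMeasure m) :=
          htr w hw hs hz
        rw [h1] at h2
        have hwL : MemLp w 2
            ((Measure.euclideanHausdorffMeasure m).restrict ((P.T K).facet j)) := by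
          obtain ⟨C, hC⟩ := hw.continuous.bounded_above_of_compact_support hs
          exact MemLp.of_bound hw.continuous.aestronglyMeasurable C (ae_of_all _ hC)
        have h3 : ∀ x, w x • (π x - α j) = π x * w x - α j * w x := fun x => by
          rw [smul_eq_mul]; ring
        simp only [h3]
        have h4 : Integrable (fun x => π x * w x)
            ((Measure.euclideanHausdorffMeasure m).restrict ((P.T K).facet j)) :=
          (memLp_facet π K j).integrable_mul hwL
        rw [integral_sub h4
          ((hwL.integrable (by norm_num)).const_mul _), integral_const_mul, h2, sub_self])
    filter_upwards [key, (P.T K).ae_isRelint j] with x hx hxr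
    refine sub_eq_zero.1 (hx (mem_iInter.2 fun i hi hxi => ?_))
    exact (hxr.2 i hi).ne ((P.T K).isPolytope.facet_subset_hyperplane i hxi)
  · intro hae w hw hs hz
    rw [hgreen w hw hs hz, ← integral_const_mul]
    refine integral_congr_ae ?_
    filter_upwards [hae] with x hx
    rw [hx]

theorem exists_hasFluxes_of_mem_X2Local (hP : P.IsAdmissible) {v : P.L2Vec}
    (hv : v ∈ P.X2Local) (K : ι) : ∃ g α, HasFluxes (P.T K) v g α := by
  obtain ⟨a, ha⟩ := (locallyInSpan_iff K _ _).1 (hv.2 K)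
  exact ⟨_, _, (hP.hasFluxes_sum_psi K a).congr ha.symm (ae_eq_refl _)⟩

/-- Matching fluxes are the fluxes of a function in `X_{2,h}^l`. -/
theorem exists_mem_X2Local [Fintype ι] (hP : P.IsAdmissible)
    {α : ι → FacetIdx (m + 1) sh → ℝ} (hα : Balanced P.Ω P.T α) :
    ∃ v ∈ P.X2Local, ∀ K, ∃ g, HasFluxes (P.T K) v g (α K) := by
  obtain ⟨a, rfl⟩ := hP.fluxes_surjective α
  have hmem : ∀ K j, MemLp (P.ψ K j) 2 (volume.restrict (P.T K).int) := fun K j =>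
    (hP.hasFluxes_psi K j).memLp
  have hae := cellMap_ae_eq hP.mesh P.ψ hmem a
  have hfl : ∀ K, HasFluxes (P.T K) (cellMap hP.mesh P.ψ hmem a)
      (fun x => ∑ j, a K j * divergence (P.χ K j) x) (P.fluxes a K) := fun K =>
    (hP.hasFluxes_sum_psi K (a K)).congr (hae K).symm (ae_eq_refl _)
  exact ⟨cellMap hP.mesh P.ψ hmem a,
    ⟨hP.mesh.memHdiv_of_balanced hP.isOpen (Lp.memLp _) hfl hα, fun K =>
      (locallyInSpan_iff K _ _).2 ⟨a K, hae K⟩⟩, fun K => ⟨_, hfl K⟩⟩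

/-- Functions in `X2Local` have constant fluxes. Conversely, a constant `c` on an interior facet is
the normal trace of such a function: prescribe flux `c` there, `-c` on the other side and zero
elsewhere. -/
theorem mem_multipliers_iff [Fintype ι] (hP : P.IsAdmissible) (π : P.L2Skeleton) :
    π ∈ P.Multipliers ↔ ∀ K j, ∃ c : ℝ,
      (∀ᵐ x ∂((Measure.euclideanHausdorffMeasure m).restrict ((P.T K).facet j)), π x = c) ∧
      ((P.T K).facet j ⊆ frontier P.Ω → c = 0) := by
  constructor
  · rintro ⟨h1, h2⟩ K j
    by_cases hF : (P.T K).facet j ⊆ frontier P.Ω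
    · exact ⟨0, h2 K j hF, fun _ => rfl⟩
    · obtain ⟨v, hv, htr⟩ := h1 K j hF
      obtain ⟨g, α, hfl⟩ := exists_hasFluxes_of_mem_X2Local hP hv K
      exact ⟨α j, (isNormalTrace_iff hfl π).1 htr, fun h => absurd h hF⟩
  · intro h
    refine ⟨fun K j hF => ?_, fun K j hF => ?_⟩
    · obtain ⟨c, hc, -⟩ := h K j
      obtain ⟨K', j', hs⟩ := hP.mesh.exists_isShared hF
      obtain ⟨α, hα, hαc, -, -⟩ := hP.mesh.exists_balanced_single hs c
      obtain ⟨v, hv, hfl⟩ := exists_mem_X2Local hP hα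
      obtain ⟨g, hg⟩ := hfl K
      exact ⟨v, hv, (isNormalTrace_iff hg π).2 (by rw [hαc]; exact hc)⟩
    · obtain ⟨c, hc, hc0⟩ := h K j
      rw [hc0 hF] at hc
      exact hc

/-- The space of Lagrange multipliers as a subspace of `L²` of the skeleton. -/
def multiplierSpace [Fintype ι] (hP : P.IsAdmissible) : Submodule ℝ P.L2Skeleton where
  carrier := P.Multipliers
  zero_mem' := by
    refine (mem_multipliers_iff hP _).2 fun K j => ⟨0, ?_, fun _ => rfl⟩
    exact ae_mono (restrict_facet_le K j) (Lp.coeFn_zero ℝ 2 _)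
  add_mem' := by
    intro π π' h h'
    refine (mem_multipliers_iff hP _).2 fun K j => ?_
    obtain ⟨c, hc, hc0⟩ := (mem_multipliers_iff hP _).1 h K j
    obtain ⟨c', hc', hc0'⟩ := (mem_multipliers_iff hP _).1 h' K j
    refine ⟨c + c', ?_, fun hF => by rw [hc0 hF, hc0' hF, add_zero]⟩
    filter_upwards [hc, hc', ae_mono (restrict_facet_le K j) (Lp.coeFn_add π π')] with x h1 h2 h3
    rw [h3, Pi.add_apply, h1, h2]
  smul_mem' := by
    intro t π h
    refine (mem_multipliers_iff hP _).2 fun K j => ?_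
    obtain ⟨c, hc, hc0⟩ := (mem_multipliers_iff hP _).1 h K j
    refine ⟨t * c, ?_, fun hF => by rw [hc0 hF, mul_zero]⟩
    filter_upwards [hc, ae_mono (restrict_facet_le K j) (Lp.coeFn_smul t π)] with x h1 h3
    rw [h3, Pi.smul_apply, h1, smul_eq_mul]

/-- The integrals of a skeleton function over the facets. -/
def facetIntegral (P : OSData (m + 1) sh ι) :
    P.L2Skeleton →ₗ[ℝ] (ι → FacetIdx (m + 1) sh → ℝ) where
  toFun π K j := ∫ x in (P.T K).facet j, π x ∂(Measure.euclideanHausdorffMeasure m)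
  map_add' π π' := by
    funext K j
    rw [Pi.add_apply, Pi.add_apply, ← integral_add (integrable_facet π K j)
      (integrable_facet π' K j)]
    exact integral_congr_ae (ae_mono (restrict_facet_le K j) (Lp.coeFn_add π π'))
  map_smul' t π := by
    funext K j
    rw [Pi.smul_apply, Pi.smul_apply, RingHom.id_apply, smul_eq_mul, ← integral_const_mul]
    exact integral_congr_ae (ae_mono (restrict_facet_le K j) (Lp.coeFn_smul t π))

theorem facetIntegral_apply (π : P.L2Skeleton) (K : ι) (j : FacetIdx (m + 1) sh) :
    P.facetIntegral π K j =
      ∫ x in (P.T K).facet j, π x ∂(Measure.euclideanHausdorffMeasure m) := rfl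

theorem facetIntegral_eq_zero_of_boundary {π : P.L2Skeleton}
    (hπ : π ∈ P.Multipliers) {K : ι} {j : FacetIdx (m + 1) sh}
    (hF : (P.T K).facet j ⊆ frontier P.Ω) : P.facetIntegral π K j = 0 :=
  integral_eq_zero_of_ae (hπ.2 K j hF)

theorem measureReal_facet_pos (K : ι) (j : FacetIdx (m + 1) sh) :
    0 < (Measure.euclideanHausdorffMeasure m).real ((P.T K).facet j) :=
  ENNReal.toReal_pos ((P.T K).isPolytope.measure_facet_pos j).ne'
    ((P.T K).isPolytope.measure_facet_lt_top j).ne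

/-- A constant on a facet of positive finite measure is determined by its integral. -/
theorem eq_zero_of_facetIntegral_eq_zero [Fintype ι] (hP : P.IsAdmissible) {π : P.L2Skeleton}
    (hπ : π ∈ P.Multipliers) (h : P.facetIntegral π = 0) : π = 0 := by
  refine Lp.ext ?_
  refine EventuallyEq.trans (g := fun _ => (0 : ℝ)) ?_ (Lp.coeFn_zero ℝ 2 _).symm
  refine ae_skeleton_iff.2 fun K j => ?_
  obtain ⟨c, hc, -⟩ := (mem_multipliers_iff hP _).1 hπ K j
  have h1 : P.facetIntegral π K j = 0 := by rw [h]; rfl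
  rw [facetIntegral_apply, integral_congr_ae (g := fun _ => c) hc, setIntegral_const,
    smul_eq_mul] at h1
  have hc0 := (mul_eq_zero.1 h1).resolve_left (measureReal_facet_pos K j).ne'
  rw [hc0] at hc
  exact hc

theorem finiteDimensional_multiplierSpace [Fintype ι] (hP : P.IsAdmissible) :
    FiniteDimensional ℝ (multiplierSpace hP) := by
  refine FiniteDimensional.of_injective (P.facetIntegral ∘ₗ (multiplierSpace hP).subtype) ?_
  rw [injective_iff_map_eq_zero]
  intro π h
  exact Subtype.ext (eq_zero_of_facetIntegral_eq_zero hP π.2 h)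

/-- The indicator function of an interior facet is a multiplier. -/
theorem exists_multiplier_single [Fintype ι] (hP : P.IsAdmissible) {K K' : ι}
    {j j' : FacetIdx (m + 1) sh} (hs : IsShared P.Ω P.T K j K' j') :
    ∃ π ∈ P.Multipliers,
      P.facetIntegral π K j = (Measure.euclideanHausdorffMeasure m).real ((P.T K).facet j) ∧
      P.facetIntegral π K' j' = (Measure.euclideanHausdorffMeasure m).real ((P.T K).facet j) ∧
      ∀ L i, ¬ (L = K ∧ i = j) → ¬ (L = K' ∧ i = j') → P.facetIntegral π L i = 0 := by
  have hmeas := (P.T K).isPolytope.measurableSet_facet j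
  let π : P.L2Skeleton := indicatorConstLp 2 hmeas (μ :=
    (Measure.euclideanHausdorffMeasure m).restrict (skeleton P.T))
    (((Measure.restrict_apply_le _ _).trans_lt
      ((P.T K).isPolytope.measure_facet_lt_top j)).ne) (1 : ℝ)
  have hπ : ∀ L i, ∀ᵐ x ∂((Measure.euclideanHausdorffMeasure m).restrict ((P.T L).facet i)),
      π x = ((P.T K).facet j).indicator (fun _ => 1) x := fun L i =>
    ae_mono (restrict_facet_le L i) indicatorConstLp_coeFn
  have hone : ∀ᵐ x ∂((Measure.euclideanHausdorffMeasure m).restrict ((P.T K).facet j)),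
      π x = 1 := by
    filter_upwards [hπ K j, ae_restrict_mem hmeas] with x hx hxF
    rw [hx, indicator_of_mem hxF]
  have hone' : ∀ᵐ x ∂((Measure.euclideanHausdorffMeasure m).restrict ((P.T K').facet j')),
      π x = 1 := by rw [hs.facet_eq]; exact hone
  have hzero : ∀ L i, ¬ (L = K ∧ i = j) → ¬ (L = K' ∧ i = j') →
      ∀ᵐ x ∂((Measure.euclideanHausdorffMeasure m).restrict ((P.T L).facet i)), π x = 0 := by
    intro L i h1 h2
    have h3 := hP.mesh.measure_inter_facet hs h1 h2
    have h4 : ∀ᵐ x ∂((Measure.euclideanHausdorffMeasure m).restrict ((P.T L).facet i)),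
        x ∉ (P.T K).facet j := by
      rw [ae_iff, Measure.restrict_apply' ((P.T L).isPolytope.measurableSet_facet i)]
      simpa using h3
    filter_upwards [hπ L i, h4] with x hx hxF
    rw [hx, indicator_of_notMem hxF]
  refine ⟨π, (mem_multipliers_iff hP _).2 fun L i => ?_, ?_, ?_, fun L i h1 h2 => ?_⟩
  · by_cases h1 : L = K ∧ i = j
    · obtain ⟨rfl, rfl⟩ := h1
      exact ⟨1, hone, fun h => absurd h hs.not_subset⟩
    by_cases h2 : L = K' ∧ i = j'
    · obtain ⟨rfl, rfl⟩ := h2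
      exact ⟨1, hone', fun h => absurd h hs.symm.not_subset⟩
    · exact ⟨0, hzero L i h1 h2, fun _ => rfl⟩
  · rw [facetIntegral_apply, integral_congr_ae (g := fun _ => 1) hone, setIntegral_const]
    simp
  · rw [facetIntegral_apply, integral_congr_ae (g := fun _ => 1) hone', setIntegral_const,
      hs.facet_eq]
    simp
  · exact integral_eq_zero_of_ae (hzero L i h1 h2)

/-- A sum over all facets of all cells in which only the two copies of an interior facet count. -/
theorem sum_eq_add_of_isShared [Fintype ι] {K K' : ι} {j j' : FacetIdx (m + 1) sh}
    (hs : IsShared P.Ω P.T K j K' j') {f : ι → FacetIdx (m + 1) sh → ℝ}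
    (hf : ∀ L i, ¬ (L = K ∧ i = j) → ¬ (L = K' ∧ i = j') → f L i = 0) :
    ∑ L, ∑ i, f L i = f K j + f K' j' := by
  classical
  rw [← Fintype.sum_prod_type' (f := f), ← Finset.sum_subset
    (Finset.subset_univ {(K, j), (K', j')}) fun p _ hp => ?_,
    Finset.sum_pair (fun e => hs.ne (congrArg Prod.fst e).symm)]
  apply hf
  · intro e; exact hp (by simp [Prod.ext_iff, e])
  · intro e; exact hp (by simp [Prod.ext_iff, e])

/-- The jump form vanishes for all multipliers exactly when the fluxes match. -/
theorem balanced_iff [Fintype ι] (hP : P.IsAdmissible) (α : ι → FacetIdx (m + 1) sh → ℝ) :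
    Balanced P.Ω P.T α ↔
      ∀ π ∈ P.Multipliers, ∑ K, ∑ j, α K j * P.facetIntegral π K j = 0 := by
  constructor
  · intro hα π hπ
    exact hP.mesh.sum_flux_eq_zero hα
      (fun F => ∫ x in F, π x ∂(Measure.euclideanHausdorffMeasure m))
      fun K j hF => facetIntegral_eq_zero_of_boundary hπ hF
  · intro h K j K' j' hs
    obtain ⟨π, hπ, h1, h2, h3⟩ := exists_multiplier_single hP hs
    have h4 := h π hπ
    rw [sum_eq_add_of_isShared hs fun L i e e' => by rw [h3 L i e e', mul_zero], h1, h2,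
      ← add_mul] at h4
    have := (mul_eq_zero.1 h4).resolve_right (measureReal_facet_pos K j).ne'
    linarith

/-- A multiplier that is annihilated by all fluxes vanishes. -/
theorem multiplier_eq_zero [Fintype ι] (hP : P.IsAdmissible) {π : P.L2Skeleton}
    (hπ : π ∈ P.Multipliers)
    (h : ∀ α : ι → FacetIdx (m + 1) sh → ℝ, ∑ K, ∑ j, α K j * P.facetIntegral π K j = 0) :
    π = 0 := by
  refine eq_zero_of_facetIntegral_eq_zero hP hπ ?_
  -- Taking the facet integrals themselves as fluxes turns the pairing into a sum of squares.
  have h1 := h (P.facetIntegral π)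
  rw [Finset.sum_eq_zero_iff_of_nonneg fun K _ => Finset.sum_nonneg fun j _ => mul_self_nonneg _]
    at h1
  funext K j
  have h2 := h1 K (Finset.mem_univ K)
  rw [Finset.sum_eq_zero_iff_of_nonneg fun j _ => mul_self_nonneg _] at h2
  exact mul_self_eq_zero.1 (h2 j (Finset.mem_univ j))

/-- The divergence maps the balanced fluxes onto the piecewise constants: a piecewise constant
function orthogonal to all divergences vanishes. -/
theorem pressure_coeff_eq_zero [Fintype ι] (hP : P.IsAdmissible) (r : ι → Unit → ℝ)
    (h : ∀ α, Balanced P.Ω P.T α → ∑ K, ∑ j, α K j *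
      (r K () * (Measure.euclideanHausdorffMeasure m).real ((P.T K).facet j)) = 0) : r = 0 := by
  -- Unit flux through a single interior facet tests the pressure difference of its two cells.
  have hr : ∀ K j K' j', IsShared P.Ω P.T K j K' j' → r K' () = r K () := by
    intro K j K' j' hs
    obtain ⟨α, hα, h1, h2, h3⟩ := hP.mesh.exists_balanced_single hs 1
    have h4 := h α hα
    rw [sum_eq_add_of_isShared hs fun L i e e' => by rw [h3 L i e e', zero_mul], h1, h2,
      hs.facet_eq] at h4
    have h5 : (r K () - r K' ()) *
        (Measure.euclideanHausdorffMeasure m).real ((P.T K).facet j) = 0 := by linarith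
    have := (mul_eq_zero.1 h5).resolve_right (measureReal_facet_pos K j).ne'
    linarith
  have hfl : ∀ K, HasFluxes (P.T K) (fun x => x) (divergence fun x => x)
      fun j => (P.T K).flux j fun x => x := fun K => HasFluxes.of_mem_RT0 _ id_mem_RT0
  -- The field `r x` has matching fluxes because `r` agrees across interior facets; boundary fluxes
  -- are unconstrained. Its divergence is `(m + 1) r`, so the pairing is a sum of `r ^ 2` with
  -- positive weights. Connectedness of the domain plays no role.
  have hbal : Balanced P.Ω P.T fun K j => r K () * (P.T K).flux j fun x => x := by
    intro K j K' j' hs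
    obtain ⟨x, hx, hx'⟩ := hs.exists_isRelint
    simp only
    rw [hr K j K' j' hs, ← (P.T K).inner_eq_flux id_mem_RT0 j hx.1,
      ← (P.T K').inner_eq_flux id_mem_RT0 j' hx'.1, hP.mesh.normal_eq_neg hs, inner_neg_right,
      mul_neg]
  have h1 := h _ hbal
  have h2 : ∀ K, ∑ j, (r K () * (P.T K).flux j fun x => x) *
      (r K () * (Measure.euclideanHausdorffMeasure m).real ((P.T K).facet j)) =
      r K () ^ 2 * ((m + 1) * volume.real (P.T K).int) := by
    intro K
    have h3 := (hfl K).integral_div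
    simp only [divergence_id, setIntegral_const, smul_eq_mul] at h3
    rw [mul_comm ((m : ℝ) + 1), h3, Finset.mul_sum]
    exact Finset.sum_congr rfl fun j _ => by ring
  simp only [h2] at h1
  have hvol : ∀ K, 0 < ((m : ℝ) + 1) * volume.real (P.T K).int := fun K => by
    refine mul_pos (by positivity) (ENNReal.toReal_pos ?_ ?_)
    · exact ((P.T K).isOpen_int.measure_pos volume (P.T K).isPolytope.nonempty_interior).ne'
    · exact ((measure_mono interior_subset).trans_lt
        (P.T K).isPolytope.isCompact.measure_lt_top).ne
  rw [Finset.sum_eq_zero_iff_of_nonneg fun K _ => mul_nonneg (sq_nonneg _) (hvol K).le] at h1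
  funext K u
  have := (mul_eq_zero.1 (h1 K (Finset.mem_univ K))).resolve_right (hvol K).ne'
  exact pow_eq_zero_iff (two_ne_zero) |>.1 this

end OSData

namespace OSData

variable {m : ℕ} {sh : MeshShape} {ι : Type} [Fintype ι] {P : OSData (m + 1) sh ι}

/-! ### The two problems in terms of coefficients -/

theorem ip_eq_inner (v w : P.L2Vec) : P.ip v w = inner ℝ v w := (L2.inner_def v w).symm

theorem mulField_gradientField (hP : P.IsAdmissible) (a : ι → FacetIdx (m + 1) sh → ℝ) :
    ∀ᵐ x ∂(volume.restrict P.Ω), mulField P.k (gradientField hP a) x = -velocity hP a x := by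
  refine hP.mesh.ae_iff.2 fun K => ?_
  filter_upwards [gradientField_ae_eq hP a K, velocity_ae_eq hP a K, hP.psiBar_eq K]
    with x h1 h2 h3
  rw [mulField, h1, h2, map_sum, ← Finset.sum_neg_distrib]
  refine Finset.sum_congr rfl fun j _ => ?_
  rw [map_smul, h3 j, smul_neg, neg_neg]

theorem ip_mulField (hP : P.IsAdmissible) (a : ι → FacetIdx (m + 1) sh → ℝ) (ξ : P.L2Vec) :
    P.ip (mulField P.k (gradientField hP a)) ξ = -inner ℝ (velocity hP a) ξ := by
  rw [← ip_eq_inner, ip, ip, ← integral_neg]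
  refine integral_congr_ae ?_
  filter_upwards [mulField_gradientField hP a] with x hx
  rw [hx, inner_neg_left]

/-- The form coupling the velocity and the gradient is definite. -/
theorem eq_zero_of_inner_eq_zero (hP : P.IsAdmissible) (hψ : P.PsiBarIndependent)
    {a : ι → FacetIdx (m + 1) sh → ℝ}
    (h : inner ℝ (velocity hP a) (gradientField hP a) = 0) : a = 0 := by
  obtain ⟨kmin, kmax, hk, hell⟩ := hP.k_elliptic
  -- With equal coefficients the velocity is `-k` times the gradient field, and the lower
  -- ellipticity bound applies pointwise.
  have h1 : (inner ℝ (velocity hP a) (gradientField hP a) : ℝ) ≤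
      -kmin * inner ℝ (gradientField hP a) (gradientField hP a) := by
    rw [L2.inner_def, L2.inner_def, ← integral_const_mul]
    refine integral_mono_ae (L2.integrable_inner _ _)
      ((L2.integrable_inner _ _).const_mul _) ?_
    filter_upwards [mulField_gradientField hP a, ae_restrict_mem hP.isOpen.measurableSet]
      with x hx hxΩ
    have h2 := (hell x hxΩ (gradientField hP a x)).1
    have h3 : velocity hP a x = -Matrix.toEuclideanLin (P.k x) (gradientField hP a x) := by
      rw [← neg_eq_iff_eq_neg, ← hx]; rfl
    rw [h3, inner_neg_left, real_inner_comm, real_inner_self_eq_norm_sq]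
    linarith
  rw [h, real_inner_self_eq_norm_sq] at h1
  have h4 : gradientField hP a = 0 := by
    rw [← norm_eq_zero]
    by_contra hne
    have : 0 < ‖gradientField hP a‖ ^ 2 := by positivity
    nlinarith
  -- A vanishing gradient field makes the velocity vanish, again by `-k`, and independence of the
  -- `ψ̄_j` gives the coefficients.
  funext K
  refine hψ K (a K) ?_
  have hz : ∀ᵐ x ∂(volume.restrict P.Ω), gradientField hP a x = 0 := by
    rw [h4]; exact Lp.coeFn_zero _ 2 _
  filter_upwards [velocity_ae_eq hP a K, hP.mesh.ae_int K (mulField_gradientField hP a),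
    hP.mesh.ae_int K hz] with x h5 h6 h7
  rw [← h5, ← neg_eq_zero, ← h6, mulField, h7, map_zero]

/-- Replacing `k θ` by minus the velocity with the same coefficients leaves an inner product with
the velocity of `b - a`. The test function is the gradient field of `b - a`. -/
theorem flux_equation_iff (hP : P.IsAdmissible) (hψ : P.PsiBarIndependent)
    (a b : ι → FacetIdx (m + 1) sh → ℝ) :
    (∀ ξ ∈ P.X1, P.ip (mulField P.k (gradientField hP a)) ξ + P.ip (velocity hP b) ξ = 0) ↔
      b = a := by
  constructor
  · intro h
    have h1 := h _ ((mem_X1_iff hP _).2 ⟨b - a, rfl⟩)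
    rw [ip_mulField, ip_eq_inner, neg_add_eq_sub, ← inner_sub_left, ← map_sub] at h1
    exact sub_eq_zero.1 (eq_zero_of_inner_eq_zero hP hψ h1)
  · rintro rfl ξ -
    rw [ip_mulField, ip_eq_inner, neg_add_cancel]

/-- The duality pairing between facet coefficients. -/
def facetPairing (ι : Type) [Fintype ι] (J : Type) [Fintype J] :
    (ι → J → ℝ) →ₗ[ℝ] (ι → J → ℝ) →ₗ[ℝ] ℝ :=
  LinearMap.mk₂ ℝ (fun α φ => ∑ K, ∑ j, α K j * φ K j)
    (fun α α' φ => by simp [add_mul, Finset.sum_add_distrib])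
    (fun c α φ => by simp [Finset.mul_sum, mul_assoc])
    (fun α φ φ' => by simp [mul_add, Finset.sum_add_distrib])
    (fun c α φ => by simp [Finset.mul_sum, mul_left_comm])

theorem facetPairing_apply {J : Type} [Fintype J] (α φ : ι → J → ℝ) :
    facetPairing ι J α φ = ∑ K, ∑ j, α K j * φ K j := rfl

/-- The integral of a piecewise constant function over the facets of each cell. -/
def facetWeight (P : OSData (m + 1) sh ι) :
    (ι → Unit → ℝ) →ₗ[ℝ] (ι → FacetIdx (m + 1) sh → ℝ) where
  toFun r K j := r K () * (Measure.euclideanHausdorffMeasure m).real ((P.T K).facet j)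
  map_add' r r' := by funext K j; simp [add_mul]
  map_smul' c r := by funext K j; simp [mul_assoc]

theorem brokenDiv_eq_facetPairing (hP : P.IsAdmissible) (r : ι → Unit → ℝ)
    (a : ι → FacetIdx (m + 1) sh → ℝ) :
    P.brokenDiv (pressure hP r) (velocity hP a) =
      facetPairing ι _ (P.fluxes a) (P.facetWeight r) := brokenDiv_eq hP r a

theorem C_eq_facetPairing (hP : P.IsAdmissible) (hψ : P.PsiBarIndependent)
    (a : ι → FacetIdx (m + 1) sh → ℝ) (π : P.L2Skeleton) :
    P.C (velocity hP a) π = facetPairing ι _ (P.fluxes a) (P.facetIntegral π) :=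
  C_velocity hP hψ a π

theorem integral_mul_pressure (hP : P.IsAdmissible) (f : P.L2) (r : ι → Unit → ℝ) :
    ∫ x in P.Ω, f x * pressure hP r x = inner ℝ (pressure hP r) f := by
  rw [L2.inner_def]
  rfl

theorem solvesNonconforming_iff (hP : P.IsAdmissible) (hψ : P.PsiBarIndependent) (f : P.L2)
    (θ u : P.L2Vec) (p : P.L2) : P.SolvesNonconforming f (θ, u, p) ↔
      ∃ a r, θ = gradientField hP a ∧ u = velocity hP a ∧ p = pressure hP r ∧
        Balanced P.Ω P.T (P.fluxes a) ∧
        (∀ c, Balanced P.Ω P.T (P.fluxes c) → inner ℝ (gradientField hP a) (velocity hP c) +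
          facetPairing ι _ (P.fluxes c) (P.facetWeight r) = 0) ∧
        ∀ r', facetPairing ι _ (P.fluxes a) (P.facetWeight r') = inner ℝ (pressure hP r') f := by
  constructor
  · rintro ⟨h1, h2, h3, e1, e2, e3⟩
    obtain ⟨a, rfl⟩ := (mem_X1_iff hP θ).1 h1
    obtain ⟨b, rfl⟩ := (mem_X2Tilde_iff hP u).1 h2.1
    obtain ⟨r, rfl⟩ := (mem_Q_iff hP p).1 h3
    obtain rfl := (flux_equation_iff hP hψ a b).1 e1
    refine ⟨b, r, rfl, rfl, rfl, (velocity_mem_X2_iff hP hψ b).1 h2, fun c hc => ?_, fun r' => ?_⟩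
    · rw [← ip_eq_inner, ← brokenDiv_eq_facetPairing hP]
      exact e2 _ ((velocity_mem_X2_iff hP hψ c).2 hc)
    · rw [← brokenDiv_eq_facetPairing hP, ← integral_mul_pressure]
      exact e3 _ ((mem_Q_iff hP _).2 ⟨r', rfl⟩)
  · rintro ⟨a, r, rfl, rfl, rfl, h1, h2, h3⟩
    refine ⟨(mem_X1_iff hP _).2 ⟨a, rfl⟩, (velocity_mem_X2_iff hP hψ a).2 h1,
      (mem_Q_iff hP _).2 ⟨r, rfl⟩, (flux_equation_iff hP hψ a a).2 rfl, ?_, ?_⟩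
    · intro τ hτ
      obtain ⟨c, rfl⟩ := (mem_X2Tilde_iff hP τ).1 hτ.1
      rw [ip_eq_inner, brokenDiv_eq_facetPairing hP]
      exact h2 c ((velocity_mem_X2_iff hP hψ c).1 hτ)
    · intro q hq
      obtain ⟨r', rfl⟩ := (mem_Q_iff hP q).1 hq
      rw [brokenDiv_eq_facetPairing hP, integral_mul_pressure]
      exact h3 r'

theorem solvesHybrid_iff (hP : P.IsAdmissible) (hψ : P.PsiBarIndependent) (f : P.L2)
    (θ u : P.L2Vec) (p : P.L2) (lam : P.L2Skeleton) : P.SolvesHybrid f (θ, u, p, lam) ↔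
      ∃ a r, θ = gradientField hP a ∧ u = velocity hP a ∧ p = pressure hP r ∧
        lam ∈ P.Multipliers ∧
        (∀ c, inner ℝ (gradientField hP a) (velocity hP c) +
          facetPairing ι _ (P.fluxes c) (P.facetWeight r) =
            facetPairing ι _ (P.fluxes c) (P.facetIntegral lam)) ∧
        (∀ r', facetPairing ι _ (P.fluxes a) (P.facetWeight r') = inner ℝ (pressure hP r') f) ∧
        ∀ π ∈ P.Multipliers, facetPairing ι _ (P.fluxes a) (P.facetIntegral π) = 0 := by
  constructor
  · rintro ⟨h1, h2, h3, h4, e1, e2, e3, e4⟩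
    obtain ⟨a, rfl⟩ := (mem_X1_iff hP θ).1 h1
    obtain ⟨b, rfl⟩ := (mem_X2Tilde_iff hP u).1 h2
    obtain ⟨r, rfl⟩ := (mem_Q_iff hP p).1 h3
    obtain rfl := (flux_equation_iff hP hψ a b).1 e1
    refine ⟨b, r, rfl, rfl, rfl, h4, fun c => ?_, fun r' => ?_, fun π hπ => ?_⟩
    · rw [← ip_eq_inner, ← brokenDiv_eq_facetPairing hP, ← C_eq_facetPairing hP hψ]
      exact e2 _ ((mem_X2Tilde_iff hP _).2 ⟨c, rfl⟩)
    · rw [← brokenDiv_eq_facetPairing hP, ← integral_mul_pressure]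
      exact e3 _ ((mem_Q_iff hP _).2 ⟨r', rfl⟩)
    · rw [← C_eq_facetPairing hP hψ]
      exact e4 π hπ
  · rintro ⟨a, r, rfl, rfl, rfl, h4, h1, h2, h3⟩
    refine ⟨(mem_X1_iff hP _).2 ⟨a, rfl⟩, (mem_X2Tilde_iff hP _).2 ⟨a, rfl⟩,
      (mem_Q_iff hP _).2 ⟨r, rfl⟩, h4, (flux_equation_iff hP hψ a a).2 rfl, ?_, ?_, ?_⟩
    · intro τ hτ
      obtain ⟨c, rfl⟩ := (mem_X2Tilde_iff hP τ).1 hτ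
      rw [ip_eq_inner, brokenDiv_eq_facetPairing hP, C_eq_facetPairing hP hψ]
      exact h1 c
    · intro q hq
      obtain ⟨r', rfl⟩ := (mem_Q_iff hP q).1 hq
      rw [brokenDiv_eq_facetPairing hP, integral_mul_pressure]
      exact h2 r'
    · intro π hπ
      rw [C_eq_facetPairing hP hψ]
      exact h3 π hπ

/-! ### Existence and uniqueness -/

/-- The homogeneous nonconforming problem has only the trivial solution. -/
theorem coeff_eq_zero_of_homogeneous (hP : P.IsAdmissible) (hψ : P.PsiBarIndependent)
    {a : ι → FacetIdx (m + 1) sh → ℝ} {r : ι → Unit → ℝ} (h1 : Balanced P.Ω P.T (P.fluxes a))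
    (h2 : ∀ c, Balanced P.Ω P.T (P.fluxes c) → inner ℝ (gradientField hP a) (velocity hP c) +
      facetPairing ι _ (P.fluxes c) (P.facetWeight r) = 0)
    (h3 : ∀ r', facetPairing ι _ (P.fluxes a) (P.facetWeight r') = 0) : a = 0 ∧ r = 0 := by
  have ha : a = 0 := by
    refine eq_zero_of_inner_eq_zero hP hψ ?_
    -- The solution is itself an admissible test field, and its divergence term vanishes by the
    -- third equation.
    have := h2 a h1
    rwa [h3, add_zero, real_inner_comm] at this
  refine ⟨ha, pressure_coeff_eq_zero hP r fun α hα => ?_⟩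
  obtain ⟨c, rfl⟩ := hP.fluxes_surjective α
  have := h2 c hα
  rw [ha, map_zero, inner_zero_left, zero_add] at this
  exact this

theorem solvesNonconforming_unique (hP : P.IsAdmissible) (hψ : P.PsiBarIndependent) {f : P.L2}
    {θ u θ' u' : P.L2Vec} {p p' : P.L2} (h : P.SolvesNonconforming f (θ, u, p))
    (h' : P.SolvesNonconforming f (θ', u', p')) : θ = θ' ∧ u = u' ∧ p = p' := by
  obtain ⟨a, r, rfl, rfl, rfl, h1, h2, h3⟩ := (solvesNonconforming_iff hP hψ f θ u p).1 h
  obtain ⟨a', r', rfl, rfl, rfl, h1', h2', h3'⟩ := (solvesNonconforming_iff hP hψ f _ _ _).1 h'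
  have hb : Balanced P.Ω P.T (P.fluxes (a - a')) := by
    intro K j K' j' hs
    have e := h1 K j K' j' hs
    have e' := h1' K j K' j' hs
    simp only [map_sub, Pi.sub_apply, e, e']
    ring
  obtain ⟨ha, hr⟩ := coeff_eq_zero_of_homogeneous hP hψ (a := a - a') (r := r - r') hb
    (fun c hc => by
      have e := h2 c hc
      have e' := h2' c hc
      simp only [map_sub, inner_sub_left]
      linarith)
    (fun q => by
      simp only [map_sub, LinearMap.sub_apply, h3, h3', sub_self])
  rw [sub_eq_zero.1 ha, sub_eq_zero.1 hr]
  exact ⟨rfl, rfl, rfl⟩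

/-- A solution of the hybrid problem yields a solution of the nonconforming problem. -/
theorem SolvesHybrid.solvesNonconforming (hP : P.IsAdmissible) (hψ : P.PsiBarIndependent)
    {f : P.L2} {θ u : P.L2Vec} {p : P.L2} {lam : P.L2Skeleton}
    (h : P.SolvesHybrid f (θ, u, p, lam)) : P.SolvesNonconforming f (θ, u, p) := by
  obtain ⟨a, r, rfl, rfl, rfl, h4, h1, h2, h3⟩ := (solvesHybrid_iff hP hψ f θ u p lam).1 h
  refine (solvesNonconforming_iff hP hψ f _ _ _).2
    ⟨a, r, rfl, rfl, rfl, (balanced_iff hP _).2 h3, fun c hc => ?_, h2⟩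
  rw [h1 c]
  exact (balanced_iff hP _).1 hc lam h4

/-- The first three components are fixed by the nonconforming problem. Subtracting the second
equations then shows that the difference of the multipliers pairs to zero with arbitrary fluxes,
since `X2Tilde` realises all of them. -/
theorem solvesHybrid_unique (hP : P.IsAdmissible) (hψ : P.PsiBarIndependent) {f : P.L2}
    {s s' : P.L2Vec × P.L2Vec × P.L2 × P.L2Skeleton} (h : P.SolvesHybrid f s)
    (h' : P.SolvesHybrid f s') : s = s' := by
  obtain ⟨θ, u, p, lam⟩ := s
  obtain ⟨θ', u', p', lam'⟩ := s'
  obtain ⟨rfl, rfl, rfl⟩ := solvesNonconforming_unique hP hψ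
    (h.solvesNonconforming hP hψ) (h'.solvesNonconforming hP hψ)
  have hlam : lam - lam' = 0 := by
    refine multiplier_eq_zero hP ((multiplierSpace hP).sub_mem h.lam_mem h'.lam_mem) fun α => ?_
    obtain ⟨c, rfl⟩ := hP.fluxes_surjective α
    have hc := (mem_X2Tilde_iff hP _).2 ⟨c, rfl⟩
    have e := (h.eq2 _ hc).symm.trans (h'.eq2 _ hc)
    simp only at e
    rw [C_eq_facetPairing hP hψ, C_eq_facetPairing hP hψ] at e
    rw [← facetPairing_apply, map_sub, map_sub, e, sub_self]
  rw [sub_eq_zero.1 hlam]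

/-- The bilinear form of the hybrid problem in terms of coefficients. -/
def hybridForm (hP : P.IsAdmissible) :
    ((ι → FacetIdx (m + 1) sh → ℝ) × (ι → Unit → ℝ) × multiplierSpace hP) →ₗ[ℝ]
      ((ι → FacetIdx (m + 1) sh → ℝ) × (ι → Unit → ℝ) × multiplierSpace hP) →ₗ[ℝ] ℝ :=
  LinearMap.mk₂ ℝ (fun x y => inner ℝ (gradientField hP x.1) (velocity hP y.1) +
      facetPairing ι _ (P.fluxes y.1) (P.facetWeight x.2.1) -
      facetPairing ι _ (P.fluxes y.1) (P.facetIntegral x.2.2) +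
      facetPairing ι _ (P.fluxes x.1) (P.facetWeight y.2.1) +
      facetPairing ι _ (P.fluxes x.1) (P.facetIntegral y.2.2))
    (fun x x' y => by
      simp only [Prod.fst_add, Prod.snd_add, Submodule.coe_add, map_add, inner_add_left,
        LinearMap.add_apply]
      ring)
    (fun c x y => by
      simp only [Prod.smul_fst, Prod.smul_snd, Submodule.coe_smul, map_smul, inner_smul_left,
        LinearMap.smul_apply, smul_eq_mul, conj_trivial]
      ring)
    (fun x y y' => by
      simp only [Prod.fst_add, Prod.snd_add, Submodule.coe_add, map_add, inner_add_right,
        LinearMap.add_apply]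
      ring)
    (fun c x y => by
      simp only [Prod.smul_fst, Prod.smul_snd, Submodule.coe_smul, map_smul, inner_smul_right,
        LinearMap.smul_apply, smul_eq_mul]
      ring)

theorem hybridForm_apply (hP : P.IsAdmissible)
    (x y : (ι → FacetIdx (m + 1) sh → ℝ) × (ι → Unit → ℝ) × multiplierSpace hP) :
    hybridForm hP x y = inner ℝ (gradientField hP x.1) (velocity hP y.1) +
      facetPairing ι _ (P.fluxes y.1) (P.facetWeight x.2.1) -
      facetPairing ι _ (P.fluxes y.1) (P.facetIntegral x.2.2) +
      facetPairing ι _ (P.fluxes x.1) (P.facetWeight y.2.1) +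
      facetPairing ι _ (P.fluxes x.1) (P.facetIntegral y.2.2) := rfl

/-- A coefficient vector that represents the load gives a solution of the hybrid problem. -/
theorem solvesHybrid_of_hybridForm_eq (hP : P.IsAdmissible) (hψ : P.PsiBarIndependent) (f : P.L2)
    (x : (ι → FacetIdx (m + 1) sh → ℝ) × (ι → Unit → ℝ) × multiplierSpace hP)
    (h : ∀ y, hybridForm hP x y = inner ℝ (pressure hP y.2.1) f) :
    P.SolvesHybrid f (gradientField hP x.1, velocity hP x.1, pressure hP x.2.1, x.2.2) := by
  refine (solvesHybrid_iff hP hψ f _ _ _ _).2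
    ⟨x.1, x.2.1, rfl, rfl, rfl, x.2.2.2, fun c => ?_, fun r => ?_, fun π hπ => ?_⟩
  -- The form adds up the three remaining equations; test vectors with a single nonzero component
  -- separate them again.
  · have := h (c, 0, 0)
    simp only [hybridForm_apply, map_zero, inner_zero_left, Submodule.coe_zero] at this
    linarith
  · have := h (0, r, 0)
    simp only [hybridForm_apply, map_zero, inner_zero_right, Submodule.coe_zero,
      LinearMap.zero_apply] at this
    linarith
  · have := h (0, 0, ⟨π, hπ⟩)
    simp only [hybridForm_apply, map_zero, inner_zero_right, inner_zero_left,
      LinearMap.zero_apply] at this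
    linarith

/-- A kernel element and `0` both solve the hybrid problem with zero load, so they give the same
functions. The velocity coefficients then vanish by definiteness, and the pressure values by
`pressure_coeff_eq_zero`. -/
theorem hybridForm_injective (hP : P.IsAdmissible) (hψ : P.PsiBarIndependent) :
    Function.Injective (hybridForm hP) := by
  rw [injective_iff_map_eq_zero]
  intro x hx
  have h1 := solvesHybrid_of_hybridForm_eq hP hψ 0 x fun y => by
    rw [hx, inner_zero_right, LinearMap.zero_apply]
  have h0 := solvesHybrid_of_hybridForm_eq hP hψ 0 0 fun y => by
    rw [map_zero, inner_zero_right, LinearMap.zero_apply]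
  have h2 := solvesHybrid_unique hP hψ h1 h0
  simp only [Prod.mk.injEq, Prod.fst_zero, Prod.snd_zero, map_zero] at h2
  obtain ⟨e1, -, -, e4⟩ := h2
  have ha : x.1 = 0 := eq_zero_of_inner_eq_zero hP hψ (by rw [e1, inner_zero_right])
  have hl : x.2.2 = 0 := Subtype.ext e4
  have hr : x.2.1 = 0 := by
    refine pressure_coeff_eq_zero hP _ fun α _ => ?_
    obtain ⟨c, rfl⟩ := hP.fluxes_surjective α
    have := LinearMap.congr_fun hx (c, 0, 0)
    simp only [hybridForm_apply, ha, hl, map_zero, inner_zero_left, Submodule.coe_zero,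
      LinearMap.zero_apply, zero_add, sub_zero, add_zero] at this
    exact this
  exact Prod.ext ha (Prod.ext hr hl)

/-- Trial and test spaces coincide and are finite-dimensional, so the injective map into the dual is
onto and represents the load functional. -/
theorem exists_solvesHybrid (hP : P.IsAdmissible) (hψ : P.PsiBarIndependent) (f : P.L2) :
    ∃ θ u p lam, P.SolvesHybrid f (θ, u, p, lam) := by
  have := finiteDimensional_multiplierSpace hP
  have hsurj : Function.Surjective (hybridForm hP) :=
    (LinearMap.injective_iff_surjective_of_finrank_eq_finrank
      Subspace.dual_finrank_eq.symm).1 (hybridForm_injective hP hψ)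
  let load : ((ι → FacetIdx (m + 1) sh → ℝ) × (ι → Unit → ℝ) × multiplierSpace hP) →ₗ[ℝ] ℝ :=
    (innerₗ P.L2 f) ∘ₗ pressure hP ∘ₗ LinearMap.fst ℝ _ _ ∘ₗ LinearMap.snd ℝ _ _
  obtain ⟨x, hx⟩ := hsurj load
  refine ⟨_, _, _, _, solvesHybrid_of_hybridForm_eq hP hψ f x fun y => ?_⟩
  rw [hx, real_inner_comm]
  rfl

end OSData

end ExpMsFEM

end

theorem theorem4p4 {d : ℕ} (hd : d = 2 ∨ d = 3) {sh : ExpMsFEM.MeshShape} {ι : Type} [Fintype ι]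
    (P : ExpMsFEM.OSData d sh ι) (hP : P.IsAdmissible) (hψ : P.PsiBarIndependent) (f : P.L2) :
    (∃! s, P.SolvesHybrid f s) ∧ (∃! t, P.SolvesNonconforming f t) ∧
      ∀ θ u p lam θ' u' p', P.SolvesHybrid f (θ, u, p, lam) →
        P.SolvesNonconforming f (θ', u', p') → θ = θ' ∧ u = u' ∧ p = p' := by
  -- The argument needs only positive dimension; with `d = m + 1` the facet dimension `d - 1`
  -- reduces to `m`.
  obtain ⟨m, rfl⟩ : ∃ m, d = m + 1 := by
    rcases hd with rfl | rfl
    · exact ⟨1, rfl⟩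
    · exact ⟨2, rfl⟩
  obtain ⟨θ, u, p, lam, h⟩ := ExpMsFEM.OSData.exists_solvesHybrid hP hψ f
  refine ⟨⟨_, h, fun s hs => ExpMsFEM.OSData.solvesHybrid_unique hP hψ hs h⟩,
    ⟨_, h.solvesNonconforming hP hψ, ?_⟩, ?_⟩
  · rintro ⟨θ', u', p'⟩ h'
    obtain ⟨rfl, rfl, rfl⟩ := ExpMsFEM.OSData.solvesNonconforming_unique hP hψ h'
      (h.solvesNonconforming hP hψ)
    rfl
  · intro θ u p lam θ' u' p' h1 h2
    exact ExpMsFEM.OSData.solvesNonconforming_unique hP hψ (h1.solvesNonconforming hP hψ) h2
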